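/- All graphs are finite, simple and connected; $d$ is the graph distance, and $d(s,vw)=\min\{d(s,v),d(s,w)\}$ for a vertex $s$ and an edge $vw$. A set $S\subseteq V(G)$ is a vertex (edge) metric generator if for any two distinct vertices (edges) $x,y$ there is $s\in S$ with $d(s,x)\ne d(s,y)$; $\dim(G)$ ($\mathrm{edim}(G)$) is the smallest size of such a set. A cactus is a connected graph whose cycles are pairwise edge disjoint. **Threads.** A thread of length $k\ge 1$ hanging at a vertex $v$ of degree $\ge 3$ is a path $u_1\cdots u_k$ such that $u_1$ is a leaf, $u_2,\dots,u_k$ have degree $2$, and $u_k$ is adjacent to $v$. Let $\ell(v)$ be the number of threads hanging at $v$ and $L(G)=\sum_{\ell(v)>1}(\ell(v)-1)$. A thread is $S$-free if it contains no vertex of $S$. A set $S\subseteq V(G)$ is branch-resolving if at most one $S$-free thread hangs at every vertex of degree $\ge 3$. **Activity.** For a vertex $v$ of a cycle $C$ let $T_v(C)$ be the component of $G-E(C)$ containing $v$. The vertex $v$ is branch-active on $C$ if $\deg(v)\ge 4$ or $T_v(C)$ contains a vertex of degree $\ge 3$ other than $v$; $b(C)$ is the number of branch-active vertices on $C$, and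 $B(G)=\sum_C\max\{0,2-b(C)\}$, the sum being over all cycles of $G$. The vertex $v$ is $S$-active on $C$ if $T_v(C)$ contains a vertex of $S$; $a_S(C)$ is the number of $S$-active vertices on $C$. The set $S$ is biactive if $a_S(C)\ge 2$ for every cycle $C$. A smallest biactive branch-resolving set is one of minimum cardinality. **Configurations.** Let $S$ be a biactive branch-resolving set and $C$ a cycle of length $g$. A labelling $C=v_0v_1\cdots v_{g-1}$ is canonical if $v_0$ is $S$-active and $k=\max\{i: v_i\text{ is }S\text{-active}\}$ is as small as possible. With respect to $S$ the canonically labelled cycle $C$ contains configuration - $\mathcal A$ if $a_S(C)=2$, $g$ is even and $k=g/2$; - $\mathcal B$ if $k\le\lfloor g/2\rfloor-1$ and an $S$-free thread hangs at $v_i$ for some $i\in[k,\lfloor g/2\rfloor-1]\cup[\lceil g/2\rceil+k+1,g-1]\cup\{0\}$; - $\mathcal C$ if $a_S(C)=2$, $g$ is even, $k\le g/2$ and an $S$-free thread of length $\ge g/2-k$ hangs at $v_i$ for some $i\in[0,k]$; - $\mathcal D$ if $k\le\lceil g/2\rceil-1$ and an $S$-free thread hangs at $v_i$ for some $i\in[k,\lceil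 g/2\rceil-1]\cup[\lfloor g/2\rfloor+k+1,g-1]\cup\{0\}$; - $\mathcal E$ if $a_S(C)=2$ and an $S$-free thread of length $\ge\lfloor g/2\rfloor-k+1$ hangs at $v_i$ for some $i\in[0,k]$ such that moreover, if $g$ is even, an $S$-free thread hangs at $v_j$ with $j=g/2+k-i$ (where $v_g=v_0$). A cycle is $\mathcal{ABC}$-negative ($\mathcal{ADE}$-negative) if there is a smallest biactive branch-resolving set with respect to which it contains none of $\mathcal A,\mathcal B,\mathcal C$ (none of $\mathcal A,\mathcal D,\mathcal E$), and positive otherwise; $c_{\mathcal{ABC}}(G)$ and $c_{\mathcal{ADE}}(G)$ are the numbers of positive cycles. **Critical incidence.** An $S$-path of $C$ is a shortest subpath of $C$ containing all $S$-active vertices of $C$. A vertex is vertex-critical (edge-critical) on $C$ with respect to $S$ if it is an end-vertex of an $S$-path of $C$ of length at most $\lfloor g/2\rfloor-1$ (at most $\lceil g/2\rceil-1$). Two distinct cycles are vertex-critically (edge-critically) incident with respect to $S$ if they share a vertex which is vertex-critical (edge-critical) on both. A smallest biactive branch-resolving set $S$ is vertex-nice (edge-nice) if no $\mathcal{ABC}$-negative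 ($\mathcal{ADE}$-negative) cycle contains any of $\mathcal A,\mathcal B,\mathcal C$ (any of $\mathcal A,\mathcal D,\mathcal E$) with respect to $S$ and, among all smallest biactive branch-resolving sets with this property, $S$ has the smallest number of vertex-critically (edge-critically) incident pairs of cycles. For a vertex-nice (edge-nice) set $S$, the graph $G_{vi}$ (the graph $G_{ei}$) has the cycles of $G$ as vertices, two being adjacent if both are $\mathcal{ABC}$-negative and they are vertex-critically incident (both are $\mathcal{ADE}$-negative and they are edge-critically incident) with respect to $S$. Finally, $\tau$ denotes the vertex cover number. **Theorem.** Let $G$ be a cactus graph. Vertex-nice sets and edge-nice sets exist in $G$. If $G$ is not a path with at least two vertices, then for every vertex-nice set $S$ used to define $G_{vi}$, $$\dim(G)=L(G)+B(G)+c_{\mathcal{ABC}}(G)+\tau(G_{vi}).$$ If $G$ is not a path with at least three vertices, then for every edge-nice set $S$ used to define $G_{ei}$, $$\mathrm{edim}(G)=L(G)+B(G)+c_{\mathcal{ADE}}(G)+\tau(G_{ei}).$$ -/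

import Mathlib

namespace Cactus

section Dimensions

variable {V : Type*} [Fintype V] (G : SimpleGraph V)

/-- The distance between a vertex `s` and an edge `vw`, the minimum of `d(s,v)` and `d(s,w)`. -/
noncomputable def edgeDist (s : V) (e : Sym2 V) : ℕ :=
  Sym2.lift ⟨fun v w => min (G.dist s v) (G.dist s w), fun _ _ => min_comm _ _⟩ e

/-- `S` is a vertex metric generator. -/
def IsVertexGenerator (S : Finset V) : Prop :=
  ∀ u v : V, u ≠ v → ∃ s ∈ S, G.dist s u ≠ G.dist s v

/-- `S` is an edge metric generator. -/
def IsEdgeGenerator (S : Finset V) : Prop :=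
  ∀ e ∈ G.edgeSet, ∀ f ∈ G.edgeSet, e ≠ f → ∃ s ∈ S, edgeDist G s e ≠ edgeDist G s f

/-- The vertex metric dimension (the whole vertex set is always a generator). -/
noncomputable def dim : ℕ := sInf {n | ∃ S : Finset V, IsVertexGenerator G S ∧ S.card = n}

/-- The edge metric dimension (the whole vertex set is always a generator). -/
noncomputable def edim : ℕ := sInf {n | ∃ S : Finset V, IsEdgeGenerator G S ∧ S.card = n}

end Dimensions

section Cycles

variable {V : Type*}

/-- The cycles of `G`, as subgraphs (no base point, no orientation). -/
def Cycle (G : SimpleGraph V) : Type _ :=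
  {C : G.Subgraph // ∃ (u : V) (w : G.Walk u u), w.IsCycle ∧ w.toSubgraph = C}

noncomputable instance [Fintype V] (G : SimpleGraph V) : Fintype (Cycle G) :=
  haveI : Finite (Cycle G) := by unfold Cycle; infer_instance
  Fintype.ofFinite _

/-- A cactus: a connected graph whose cycles are pairwise edge disjoint. -/
def IsCactus (G : SimpleGraph V) : Prop :=
  G.Connected ∧ ∀ C D : Cycle G, C ≠ D → Disjoint C.1.edgeSet D.1.edgeSet

variable {G : SimpleGraph V}

/-- The length `g` of a cycle. -/
noncomputable def Cycle.len (C : Cycle G) : ℕ := C.1.verts.ncard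

/-- The vertex set of `T_v(C)`, the connected component of `G - E(C)` that contains `v`. -/
def Cycle.comp (C : Cycle G) (v : V) : Set V :=
  {x | (G.deleteEdges C.1.edgeSet).Reachable v x}

/-- A labelling `C = v_0 v_1 ⋯ v_{g-1}`: a closed walk that goes once around `C`. -/
structure Labelling (C : Cycle G) where
  start : V
  walk : G.Walk start start
  isCycle : walk.IsCycle
  toSubgraph_eq : walk.toSubgraph = C.1

/-- The vertex `v_i` of a labelling. -/
def Labelling.vert {C : Cycle G} (lab : Labelling C) (i : ℕ) : V := lab.walk.getVert i

/-- `v` is an `S`-active vertex of `C`. -/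
def Cycle.IsActive (C : Cycle G) (S : Finset V) (v : V) : Prop :=
  v ∈ C.1.verts ∧ ∃ s ∈ S, s ∈ C.comp v

/-- `a_S(C)`, the number of `S`-active vertices on `C`. -/
noncomputable def Cycle.numActive (C : Cycle G) (S : Finset V) : ℕ :=
  {v | C.IsActive S v}.ncard

/-- `S` is biactive. -/
def IsBiactive (G : SimpleGraph V) (S : Finset V) : Prop :=
  ∀ C : Cycle G, 2 ≤ C.numActive S

/-- `v_0` is `S`-active and `k` is the largest index of an `S`-active vertex. -/
def Labelling.HasMaxActive {C : Cycle G} (lab : Labelling C) (S : Finset V) (k : ℕ) : Prop :=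
  C.IsActive S (lab.vert 0) ∧ IsGreatest {i | i < C.len ∧ C.IsActive S (lab.vert i)} k

/-- The labelling is canonical with respect to `S`, and `k` is the largest index of an `S`-active
vertex: `v_0` is `S`-active and `k` is as small as possible among all such labellings. -/
def Labelling.IsCanonical {C : Cycle G} (lab : Labelling C) (S : Finset V) (k : ℕ) : Prop :=
  lab.HasMaxActive S k ∧ ∀ (lab' : Labelling C) (k' : ℕ), lab'.HasMaxActive S k' → k ≤ k'

/-- The walk `p` is a subpath of `C` that contains all `S`-active vertices of `C`. -/
def Cycle.IsCoveringPath (C : Cycle G) (S : Finset V) {a b : V} (p : G.Walk a b) : Prop :=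
  p.IsPath ∧ p.toSubgraph ≤ C.1 ∧ ∀ v, C.IsActive S v → v ∈ p.support

/-- The walk `p` is an `S`-path of `C`. -/
def Cycle.IsSPath (C : Cycle G) (S : Finset V) {a b : V} (p : G.Walk a b) : Prop :=
  C.IsCoveringPath S p ∧
    ∀ (a' b' : V) (q : G.Walk a' b'), C.IsCoveringPath S q → p.length ≤ q.length

/-- The two variants, vertex and edge. -/
inductive Kind
  | vertex
  | edge

/-- `⌊g/2⌋ - 1` in the vertex variant, `⌈g/2⌉ - 1` in the edge variant (here `g ≥ 3`). -/
def Kind.critBound : Kind → ℕ → ℕ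
  | .vertex, g => g / 2 - 1
  | .edge, g => (g + 1) / 2 - 1

/-- `v` is vertex-critical (edge-critical) on `C`: it is an end-vertex of an `S`-path `P` with
`|P| ≤ ⌊g/2⌋ - 1` (`|P| ≤ ⌈g/2⌉ - 1`). -/
def Cycle.IsCritical (C : Cycle G) (κ : Kind) (S : Finset V) (v : V) : Prop :=
  ∃ (b : V) (p : G.Walk v b), C.IsSPath S p ∧ p.length ≤ κ.critBound C.len

/-- The graph on the cycles of `G` in which two distinct cycles are adjacent when they are
vertex-critically (edge-critically) incident with respect to `S`. -/
def criticalGraph (G : SimpleGraph V) (κ : Kind) (S : Finset V) : SimpleGraph (Cycle G) where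
  Adj C D := C ≠ D ∧ ∃ v, C.IsCritical κ S v ∧ D.IsCritical κ S v
  symm := ⟨fun _ _ h => ⟨h.1.symm, h.2.imp fun _ hv => ⟨hv.2, hv.1⟩⟩⟩
  loopless := ⟨fun _ h => h.1 rfl⟩

end Cycles

section Threads

variable {V : Type*} [Fintype V] (G : SimpleGraph V) [DecidableRel G.Adj]

/-- The list `l = [u_1, …, u_k]` is a thread hanging at the vertex `v` of degree at least `3`:
a path in which `u_1` is a leaf, `u_2, …, u_k` have degree `2`, and `u_k` is adjacent to `v`.
The length of the thread is `k`. -/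
def IsThread (v : V) (l : List V) : Prop :=
  3 ≤ G.degree v ∧ l.Nodup ∧ (l ++ [v]).IsChain G.Adj ∧
    ∃ (u : V) (t : List V), l = u :: t ∧ G.degree u = 1 ∧ ∀ x ∈ t, G.degree x = 2

/-- `l` is an `S`-free thread hanging at `v`. -/
def IsFreeThread (S : Finset V) (v : V) (l : List V) : Prop :=
  IsThread G v l ∧ ∀ x ∈ l, x ∉ S

/-- `ℓ(v)`, the number of threads hanging at `v`. -/
noncomputable def numThreads (v : V) : ℕ := {l | IsThread G v l}.ncard

/-- `L(G)`, the sum of `ℓ(v) - 1` over the vertices with `ℓ(v) > 1`. -/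
noncomputable def surplusThreads : ℕ := ∑ v with 1 < numThreads G v, (numThreads G v - 1)

/-- `S` is branch-resolving: at most one `S`-free thread hangs at every vertex of degree `≥ 3`. -/
def IsBranchResolving (S : Finset V) : Prop :=
  ∀ v, {l | IsFreeThread G S v l}.Subsingleton

/-- `S` is a smallest biactive branch-resolving set. -/
def IsSmallestBBR (S : Finset V) : Prop :=
  (IsBiactive G S ∧ IsBranchResolving G S) ∧
    ∀ S' : Finset V, IsBiactive G S' ∧ IsBranchResolving G S' → S.card ≤ S'.card

variable {G}

/-- `v` is a branch-active vertex of `C`. -/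
def Cycle.IsBranchActive (C : Cycle G) (v : V) : Prop :=
  v ∈ C.1.verts ∧ (4 ≤ G.degree v ∨ ∃ x ∈ C.comp v, x ≠ v ∧ 3 ≤ G.degree x)

/-- `b(C)`, the number of branch-active vertices on `C`. -/
noncomputable def Cycle.numBranchActive (C : Cycle G) : ℕ := {v | C.IsBranchActive v}.ncard

/-- `B(G)`, the sum of `max {0, 2 - b(C)}` (truncated subtraction) over all cycles. -/
noncomputable def missingBranchActive (G : SimpleGraph V) [DecidableRel G.Adj] : ℕ :=
  ∑ C : Cycle G, (2 - C.numBranchActive)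

/-- Configuration `𝒜` on the labelled cycle. -/
def Labelling.ConfigA {C : Cycle G} (_lab : Labelling C) (S : Finset V) (k : ℕ) : Prop :=
  C.numActive S = 2 ∧ Even C.len ∧ k = C.len / 2

/-- Configuration `ℬ` on the labelled cycle. -/
def Labelling.ConfigB {C : Cycle G} (lab : Labelling C) (S : Finset V) (k : ℕ) : Prop :=
  k ≤ C.len / 2 - 1 ∧ ∃ i l, IsFreeThread G S (lab.vert i) l ∧
    ((k ≤ i ∧ i ≤ C.len / 2 - 1) ∨ ((C.len + 1) / 2 + k + 1 ≤ i ∧ i ≤ C.len - 1) ∨ i = 0)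

/-- Configuration `𝒞` on the labelled cycle; the thread has length at least `g/2 - k`. -/
def Labelling.ConfigC {C : Cycle G} (lab : Labelling C) (S : Finset V) (k : ℕ) : Prop :=
  C.numActive S = 2 ∧ Even C.len ∧ k ≤ C.len / 2 ∧
    ∃ i l, i ≤ k ∧ IsFreeThread G S (lab.vert i) l ∧ C.len / 2 - k ≤ l.length

/-- Configuration `𝒟` on the labelled cycle. -/
def Labelling.ConfigD {C : Cycle G} (lab : Labelling C) (S : Finset V) (k : ℕ) : Prop :=
  k ≤ (C.len + 1) / 2 - 1 ∧ ∃ i l, IsFreeThread G S (lab.vert i) l ∧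
    ((k ≤ i ∧ i ≤ (C.len + 1) / 2 - 1) ∨ (C.len / 2 + k + 1 ≤ i ∧ i ≤ C.len - 1) ∨ i = 0)

/-- Configuration `ℰ` on the labelled cycle; the thread at `v_i` has length at least
`⌊g/2⌋ - k + 1`, written without subtraction. -/
def Labelling.ConfigE {C : Cycle G} (lab : Labelling C) (S : Finset V) (k : ℕ) : Prop :=
  C.numActive S = 2 ∧
    ∃ i l, i ≤ k ∧ IsFreeThread G S (lab.vert i) l ∧ C.len / 2 + 1 ≤ l.length + k ∧
      (Even C.len → ∃ l', IsFreeThread G S (lab.vert (C.len / 2 + k - i)) l')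

/-- `C`, canonically labelled, contains one of the configurations `𝒜, ℬ, 𝒞` (vertex variant)
or one of `𝒜, 𝒟, ℰ` (edge variant) with respect to `S`. -/
def Cycle.ContainsConfig (C : Cycle G) (κ : Kind) (S : Finset V) : Prop :=
  ∃ (lab : Labelling C) (k : ℕ), lab.IsCanonical S k ∧
    match κ with
    | .vertex => lab.ConfigA S k ∨ lab.ConfigB S k ∨ lab.ConfigC S k
    | .edge => lab.ConfigA S k ∨ lab.ConfigD S k ∨ lab.ConfigE S k

/-- `C` is `𝒜ℬ𝒞`-negative (vertex variant) or `𝒜𝒟ℰ`-negative (edge variant). -/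
def Cycle.IsNegative (C : Cycle G) (κ : Kind) : Prop :=
  ∃ S : Finset V, IsSmallestBBR G S ∧ ¬ C.ContainsConfig κ S

variable (G)

/-- The number of positive cycles: `c_{𝒜ℬ𝒞}(G)` or `c_{𝒜𝒟ℰ}(G)`. -/
noncomputable def numPositive (κ : Kind) : ℕ := {C : Cycle G | ¬ C.IsNegative κ}.ncard

/-- `S` is a smallest biactive branch-resolving set for which every negative cycle avoids the
configurations. -/
def AvoidsConfigs (κ : Kind) (S : Finset V) : Prop :=
  IsSmallestBBR G S ∧ ∀ C : Cycle G, C.IsNegative κ → ¬ C.ContainsConfig κ S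

/-- `S` is nice: it avoids the configurations on all negative cycles and has, among all such
sets, the smallest number of critically incident pairs of cycles. -/
def IsNice (κ : Kind) (S : Finset V) : Prop :=
  AvoidsConfigs G κ S ∧ ∀ S' : Finset V, AvoidsConfigs G κ S' →
    (criticalGraph G κ S).edgeSet.ncard ≤ (criticalGraph G κ S').edgeSet.ncard

/-- The vertex-incident graph `G_vi` or the edge-incident graph `G_ei` with respect to `S`: two
cycles are adjacent when both are negative and they are critically incident. -/
def incidentGraph (κ : Kind) (S : Finset V) : SimpleGraph (Cycle G) where
  Adj C D := C.IsNegative κ ∧ D.IsNegative κ ∧ (criticalGraph G κ S).Adj C D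
  symm := ⟨fun _ _ h => ⟨h.2.1, h.1, h.2.2.symm⟩⟩
  loopless := ⟨fun _ h => h.2.2.ne rfl⟩

end Threads

end Cactus

/-! Call a neighbour `y` of `v` a shadow of `v` if no landmark is nearer to `y` than to `v`; in the
vertex variant every landmark must be exactly one step farther from `y`. Two shadows of one vertex
defeat a generator: the shadows themselves (vertex variant) or the edges from `v` to them (edge
variant) are not told apart. This one obstruction accounts for biactivity, branch resolution,
configurations ℬ and 𝒟 and critical incidence. Configurations 𝒜, 𝒞 and ℰ are explicit unresolved
pairs on a cycle with exactly two active vertices. Hence every generator is good, that is, biactive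
and branch-resolving, without configurations and critical incidences (`IsGenerator.isGood`).

Conversely, a good set has unique shadows unless the graph is a path (`IsGood.hasUniqueShadows`). If
two objects have different positions on some cycle, their distances are compared on a circle with
doubled lengths; a case analysis (`unresolved_cases`) shows that an unresolved pair forces a
configuration or two shadows (`exists_ne_of_profile`). Objects that no cycle separates are moved
towards each other over bridges until two shadows of one vertex appear (`eq_of_not_separated`,
`eq_of_edgeDist_eq`). So generators and good sets are the same, and the smallest size of a good set
remains to be found.

Being biactive and branch-resolving splits into independent requirements in pairwise disjoint cells,
one for each vertex and each cycle. The cells need `L(G) + B(G)` elements in total, and smallest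
sets can be recombined cell by cell (`IsSmallestBBR.splice`). For the upper bound, a nice set
receives one more vertex on each positive cycle and on each cycle of a minimum vertex cover, so that
three active vertices cut the cycle into geodesics. Such a cycle has no configuration and no
critical vertex, and activity on the other cycles does not change (`AvoidsConfigs.exists_isGood`).
For the lower bound, a good set pays one surplus element for each positive cycle and each cycle of
some vertex cover (`IsNice.exists_isVertexCover`); niceness ensures that the incidences of the nice
set cannot be avoided for free. -/

namespace Cactus

open SimpleGraph

/-! ### Periodic parametrizations of cycles. -/

variable {V : Type*} {G : SimpleGraph V}

/-- A parametrization of the cycle `C` by the integers, going round and round. -/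
structure Param (C : Cycle G) (c : ℤ → V) : Prop where
  eq_iff : ∀ i j, c i = c j ↔ (C.len : ℤ) ∣ i - j
  mem_iff : ∀ v, v ∈ C.1.verts ↔ ∃ i, c i = v
  adj_iff : ∀ x y, C.1.Adj x y ↔ ∃ i, (x = c i ∧ y = c (i + 1)) ∨ (x = c (i + 1) ∧ y = c i)

theorem Labelling.length_eq {C : Cycle G} (lab : Labelling C) : lab.walk.length = C.len := by
  have h : C.1.verts = lab.walk.getVert '' {i | i ≤ lab.walk.length - 1} := by
    ext v
    rw [← lab.toSubgraph_eq, Walk.mem_verts_toSubgraph, Walk.mem_support_iff_exists_getVert]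
    have h3 := lab.isCycle.three_le_length
    constructor
    · rintro ⟨i, rfl, hi⟩
      rcases hi.lt_or_eq with h | h
      · exact ⟨i, Nat.le_sub_one_of_lt h, rfl⟩
      · exact ⟨0, Nat.zero_le _, by subst h; simp⟩
    · rintro ⟨i, hi, rfl⟩
      exact ⟨i, rfl, by simp at hi; omega⟩
  have h3 := lab.isCycle.three_le_length
  unfold Cycle.len
  rw [h, lab.isCycle.getVert_injOn'.ncard_image]
  have : {i | i ≤ lab.walk.length - 1} = ((Finset.range lab.walk.length : Finset ℕ) : Set ℕ) := by
    ext i; simp; omega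
  rw [this, Set.ncard_coe_finset, Finset.card_range]

theorem Cycle.nonempty_labelling (C : Cycle G) : Nonempty (Labelling C) := by
  obtain ⟨C, u, w, hw, h⟩ := C
  exact ⟨⟨u, w, hw, h⟩⟩

theorem Cycle.three_le_len (C : Cycle G) : 3 ≤ C.len := by
  obtain ⟨lab⟩ := C.nonempty_labelling
  rw [← lab.length_eq]
  exact lab.isCycle.three_le_length

theorem Labelling.vert_len {C : Cycle G} (lab : Labelling C) : lab.vert C.len = lab.vert 0 := by
  unfold Labelling.vert
  rw [← lab.length_eq]; simp

theorem Labelling.vert_inj {C : Cycle G} (lab : Labelling C) {i j : ℕ} (hi : i < C.len)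
    (hj : j < C.len) (h : lab.vert i = lab.vert j) : i = j := by
  rw [← lab.length_eq] at hi hj
  exact lab.isCycle.getVert_injOn' (by simp; omega) (by simp; omega) h

/-- Indices are reduced modulo the length. Rotating or reflecting a labelling then becomes a
substitution in the index. -/
theorem Labelling.exists_param {C : Cycle G} (lab : Labelling C) :
    ∃ c, Param C c ∧ ∀ i : ℕ, i ≤ C.len → c i = lab.vert i := by
  have h3 := C.three_le_len
  have hn : (0 : ℤ) < C.len := by omega
  have key : ∀ i : ℤ, ∃ m : ℕ, m < C.len ∧ (m : ℤ) = i % C.len := fun i =>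
    ⟨(i % C.len).toNat, by have := Int.emod_lt_of_pos i hn; have := Int.emod_nonneg i hn.ne'; omega,
      Int.toNat_of_nonneg (Int.emod_nonneg i hn.ne')⟩
  choose m hm hm' using key
  have succ : ∀ i : ℤ, lab.vert (m (i + 1)) = lab.vert (m i + 1) := by
    intro i
    have e : (i + 1) % C.len = ((m i : ℤ) + 1) % C.len := by rw [hm']; simp
    have h := hm' (i + 1)
    rw [e] at h
    rcases (Nat.succ_le_of_lt (hm i)).lt_or_eq with hlt | heq
    · rw [Int.emod_eq_of_lt (by omega) (by omega)] at h
      have : m (i + 1) = m i + 1 := by omega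
      rw [this]
    · have h2 : (m i : ℤ) + 1 = C.len := by omega
      rw [h2, Int.emod_self] at h
      have h0 : m (i + 1) = 0 := by omega
      have h1 : m i + 1 = C.len := by omega
      rw [h0, h1, lab.vert_len]
  have small : ∀ i : ℕ, i < C.len → m i = i := by
    intro i hi
    have := hm' i
    rw [Int.emod_eq_of_lt (by omega) (by omega)] at this
    omega
  refine ⟨fun i => lab.vert (m i), ⟨?_, ?_, ?_⟩, ?_⟩
  · intro i j
    have : (C.len : ℤ) ∣ i - j ↔ m i = m j := by
      rw [Int.dvd_iff_emod_eq_zero, ← Int.emod_eq_emod_iff_emod_sub_eq_zero, ← hm', ← hm']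
      omega
    rw [this]
    exact ⟨lab.vert_inj (hm i) (hm j), fun h => by rw [h]⟩
  · intro v
    rw [← lab.toSubgraph_eq, Walk.mem_verts_toSubgraph, Walk.mem_support_iff_exists_getVert]
    constructor
    · rintro ⟨i, rfl, hi⟩
      rw [lab.length_eq] at hi
      rcases hi.lt_or_eq with h | h
      · exact ⟨i, by simp only [small i h]; rfl⟩
      · refine ⟨0, ?_⟩
        have := small 0 (by omega)
        rw [Nat.cast_zero] at this
        simp only [this]
        subst h
        exact lab.vert_len.symm
    · rintro ⟨i, rfl⟩
      exact ⟨m i, rfl, by rw [lab.length_eq]; exact (hm i).le⟩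
  · intro x y
    rw [← lab.toSubgraph_eq, Walk.toSubgraph_adj_iff]
    constructor
    · rintro ⟨i, h, hi⟩
      rw [lab.length_eq] at hi
      refine ⟨i, ?_⟩
      simp only [succ, small i hi]
      rw [Sym2.eq_iff] at h
      rcases h with ⟨h1, h2⟩ | ⟨h1, h2⟩
      · exact Or.inl ⟨h1.symm, h2.symm⟩
      · exact Or.inr ⟨h2.symm, h1.symm⟩
    · rintro ⟨i, h⟩
      simp only [succ] at h
      refine ⟨m i, ?_, by rw [lab.length_eq]; exact hm i⟩
      rw [Sym2.eq_iff]
      rcases h with ⟨h1, h2⟩ | ⟨h1, h2⟩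
      · exact Or.inl ⟨h1.symm, h2.symm⟩
      · exact Or.inr ⟨h2.symm, h1.symm⟩
  · intro i hi
    rcases hi.lt_or_eq with h | h
    · simp only [small i h]
    · have h0 : m i = 0 := by
        have e : (i : ℤ) % C.len = 0 := by rw [h, Int.emod_self]
        have := hm' i
        omega
      simp only [h0]
      rw [h, lab.vert_len]

namespace Param

variable {C : Cycle G} {c : ℤ → V}

theorem shift (hc : Param C c) (a : ℤ) : Param C fun i => c (a + i) where
  eq_iff i j := by rw [hc.eq_iff]; ring_nf
  mem_iff v := by
    rw [hc.mem_iff]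
    exact ⟨fun ⟨i, h⟩ => ⟨i - a, by simpa using h⟩, fun ⟨i, h⟩ => ⟨_, h⟩⟩
  adj_iff x y := by
    rw [hc.adj_iff]
    exact ⟨fun ⟨i, h⟩ => ⟨i - a, by simpa [← add_assoc] using h⟩,
      fun ⟨i, h⟩ => ⟨a + i, by simpa [← add_assoc] using h⟩⟩

theorem reflect (hc : Param C c) (a : ℤ) : Param C fun i => c (a - i) where
  eq_iff i j := by rw [hc.eq_iff, ← dvd_neg]; ring_nf
  mem_iff v := by
    rw [hc.mem_iff]
    exact ⟨fun ⟨i, h⟩ => ⟨a - i, by simpa using h⟩, fun ⟨i, h⟩ => ⟨_, h⟩⟩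
  adj_iff x y := by
    rw [hc.adj_iff]
    constructor
    · rintro ⟨i, h⟩
      refine ⟨a - i - 1, ?_⟩
      have e1 : a - (a - i - 1) = i + 1 := by ring
      have e2 : a - (a - i - 1 + 1) = i := by ring
      rw [e1, e2]; exact h.symm
    · rintro ⟨i, h⟩
      refine ⟨a - i - 1, ?_⟩
      have e1 : a - i - 1 = a - (i + 1) := by ring
      have e2 : a - i - 1 + 1 = a - i := by ring
      rw [e2, e1]; exact h.symm

theorem mem (hc : Param C c) (i : ℤ) : c i ∈ C.1.verts := (hc.mem_iff _).2 ⟨i, rfl⟩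

theorem adj_succ (hc : Param C c) (i : ℤ) : C.1.Adj (c i) (c (i + 1)) :=
  (hc.adj_iff _ _).2 ⟨i, Or.inl ⟨rfl, rfl⟩⟩

theorem adj_pred (hc : Param C c) (i : ℤ) : C.1.Adj (c i) (c (i - 1)) := by
  have := (hc.adj_succ (i - 1)).symm
  rwa [sub_add_cancel] at this

theorem add_len (hc : Param C c) (i : ℤ) : c (i + C.len) = c i :=
  (hc.eq_iff _ _).2 (by simp)

theorem inj (hc : Param C c) {i j : ℤ} (h : c i = c j) (h1 : i - j < C.len) (h2 : j - i < C.len) :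
    i = j := by
  obtain ⟨t, ht⟩ := (hc.eq_iff i j).1 h
  have hn : (0 : ℤ) < C.len := by have := C.three_le_len; omega
  have : t < 1 := by nlinarith
  have : -1 < t := by nlinarith
  have : t = 0 := by omega
  subst this
  simp at ht; omega

theorem exists_rep (hc : Param C c) (a : ℤ) {v : V} (hv : v ∈ C.1.verts) :
    ∃ i, a ≤ i ∧ i < a + C.len ∧ c i = v := by
  obtain ⟨i, rfl⟩ := (hc.mem_iff v).1 hv
  have hn : (0 : ℤ) < C.len := by have := C.three_le_len; omega
  refine ⟨a + (i - a) % C.len, ?_, ?_, ?_⟩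
  · have := Int.emod_nonneg (i - a) hn.ne'; omega
  · have := Int.emod_lt_of_pos (i - a) hn; omega
  · rw [hc.eq_iff, show a + (i - a) % C.len - i = -((i - a) - (i - a) % C.len) by ring, dvd_neg]
    exact Int.dvd_self_sub_emod

theorem adj_cases (hc : Param C c) {i : ℤ} {y : V} (h : C.1.Adj (c i) y) :
    y = c (i + 1) ∨ y = c (i - 1) := by
  obtain ⟨j, ⟨h1, h2⟩ | ⟨h1, h2⟩⟩ := (hc.adj_iff _ _).1 h
  · left; rw [h2, hc.eq_iff]
    obtain ⟨t, ht⟩ := (hc.eq_iff _ _).1 h1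
    exact ⟨-t, by rw [mul_neg, ← ht]; ring⟩
  · right; rw [h2, hc.eq_iff]
    obtain ⟨t, ht⟩ := (hc.eq_iff _ _).1 h1
    exact ⟨-t, by rw [mul_neg, ← ht]; ring⟩

theorem exists_arc (hc : Param C c) (a : ℤ) (m : ℕ) :
    ∃ p : G.Walk (c a) (c (a + m)), p.length = m ∧ ∀ t : ℕ, t ≤ m → p.getVert t = c (a + t) := by
  induction m with
  | zero => exact ⟨Walk.nil.copy rfl (by simp), by simp, fun t ht => by
      obtain rfl : t = 0 := by omega
      simp⟩
  | succ m ih =>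
    obtain ⟨p, hp, hp'⟩ := ih
    have hadj : G.Adj (c (a + m)) (c (a + m + 1)) := (hc.adj_succ _).adj_sub
    refine ⟨(p.concat hadj).copy rfl (by push_cast; ring_nf), by simp [hp], ?_⟩
    intro t ht
    rw [Walk.getVert_copy, Walk.concat_eq_append, Walk.getVert_append, hp]
    split_ifs with h
    · exact hp' t h.le
    · obtain rfl | rfl : t = m ∨ t = m + 1 := by omega
      · simp
      · simp [add_assoc]

theorem exists_labelling (hc : Param C c) :
    ∃ lab : Labelling C, ∀ i : ℕ, i ≤ C.len → lab.vert i = c i := by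
  have h3 := C.three_le_len
  obtain ⟨p, hp, hp'⟩ := hc.exists_arc 0 C.len
  have e : c (0 + C.len) = c 0 := hc.add_len 0
  set w : G.Walk (c 0) (c 0) := p.copy rfl e with hw
  have hwl : w.length = C.len := by simp [hw, hp]
  have hwv : ∀ t : ℕ, t ≤ C.len → w.getVert t = c t := by
    intro t ht; rw [hw, Walk.getVert_copy, hp' t ht, zero_add]
  have hcyc : w.IsCycle := by
    rw [Walk.isCycle_iff_isPath_tail_and_le_length]
    refine ⟨?_, by omega⟩
    rw [← Walk.IsPath.getVert_injOn_iff]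
    have hl : w.tail.length + 1 = w.length := Walk.length_tail_add_one (by
      rw [← Walk.length_eq_zero_iff]; omega)
    intro i hi j hj h
    simp only [Set.mem_ofPred_eq] at hi hj
    rw [Walk.getVert_tail, Walk.getVert_tail, hwv _ (by omega), hwv _ (by omega)] at h
    have := hc.inj h (by omega) (by omega)
    omega
  refine ⟨⟨c 0, w, hcyc, ?_⟩, hwv⟩
  apply SimpleGraph.Subgraph.ext
  · ext v
    rw [Walk.mem_verts_toSubgraph, Walk.mem_support_iff_exists_getVert]
    constructor
    · rintro ⟨i, rfl, hi⟩
      rw [hwv i (by omega)]; exact hc.mem _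
    · intro hv
      obtain ⟨i, h0, h1, rfl⟩ := hc.exists_rep 0 hv
      exact ⟨i.toNat, by rw [hwv _ (by omega)]; congr 1; omega, by omega⟩
  · ext x y
    rw [Walk.toSubgraph_adj_iff, hc.adj_iff]
    constructor
    · rintro ⟨i, h, hi⟩
      rw [hwv _ (by omega), hwv _ (by omega), Sym2.eq_iff] at h
      refine ⟨i, ?_⟩
      push_cast at h
      rcases h with ⟨h1, h2⟩ | ⟨h1, h2⟩
      · exact Or.inl ⟨h1.symm, h2.symm⟩
      · exact Or.inr ⟨h2.symm, h1.symm⟩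
    · rintro ⟨i, h⟩
      obtain ⟨j, h0, h1, hj⟩ := hc.exists_rep 0 (hc.mem i)
      have hj' : c (j + 1) = c (i + 1) := by
        rw [hc.eq_iff] at hj ⊢; convert hj using 1; ring
      rw [← hj, ← hj'] at h
      refine ⟨j.toNat, ?_, by omega⟩
      rw [hwv _ (by omega), hwv _ (by omega), Sym2.eq_iff]
      have e1 : ((j.toNat : ℕ) : ℤ) = j := by omega
      have e2 : (((j.toNat + 1 : ℕ)) : ℤ) = j + 1 := by omega
      rw [e1, e2]
      rcases h with ⟨h1, h2⟩ | ⟨h1, h2⟩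
      · exact Or.inl ⟨h1.symm, h2.symm⟩
      · exact Or.inr ⟨h2.symm, h1.symm⟩

end Param

theorem Cycle.exists_param (C : Cycle G) : ∃ c, Param C c := by
  obtain ⟨lab⟩ := C.nonempty_labelling
  obtain ⟨c, hc, -⟩ := lab.exists_param
  exact ⟨c, hc⟩

theorem Cycle.exists_param_zero {C : Cycle G} {v : V} (hv : v ∈ C.1.verts) :
    ∃ c, Param C c ∧ c 0 = v := by
  obtain ⟨c, hc⟩ := C.exists_param
  obtain ⟨i, hi⟩ := (hc.mem_iff v).1 hv
  exact ⟨_, hc.shift i, by simpa using hi⟩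

theorem Cycle.exists_param_adj {C : Cycle G} {v y : V} (h : C.1.Adj v y) :
    ∃ c, Param C c ∧ c 0 = v ∧ c 1 = y := by
  obtain ⟨c, hc, rfl⟩ := Cycle.exists_param_zero h.fst_mem
  rcases hc.adj_cases h with rfl | rfl
  · exact ⟨c, hc, rfl, by simp⟩
  · exact ⟨_, hc.reflect 0, by simp, by simp⟩

/-- Every path inside a cycle is an initial segment of a parametrization. -/
theorem Cycle.exists_param_path {C : Cycle G} {a b : V} {p : G.Walk a b} (hp : p.IsPath)
    (hpC : p.toSubgraph ≤ C.1) :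
    ∃ c, Param C c ∧ ∀ t : ℕ, t ≤ p.length → p.getVert t = c t := by
  have hadj : ∀ t, t < p.length → C.1.Adj (p.getVert t) (p.getVert (t + 1)) := fun t ht =>
    hpC.2 (p.toSubgraph_adj_getVert ht)
  have key : ∀ m : ℕ, m ≤ p.length → ∃ c, Param C c ∧ ∀ t : ℕ, t ≤ m → p.getVert t = c t := by
    intro m
    induction m with
    | zero =>
      intro _
      obtain ⟨c, hc, h0⟩ := Cycle.exists_param_zero (C := C) (v := a)
        (hpC.1 (by simp))
      exact ⟨c, hc, fun t ht => by simp at ht; simp [ht, h0]⟩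
    | succ m ih =>
      intro hm
      rcases Nat.eq_zero_or_pos m with rfl | hm0
      · obtain ⟨c, hc, h0, h1⟩ := Cycle.exists_param_adj (hadj 0 (by omega))
        refine ⟨c, hc, fun t ht => ?_⟩
        have : t = 0 ∨ t = 1 := by omega
        rcases this with rfl | rfl
        · simpa using h0.symm
        · simpa using h1.symm
      · obtain ⟨c, hc, h⟩ := ih (by omega)
        refine ⟨c, hc, fun t ht => ?_⟩
        rcases ht.lt_or_eq with ht | rfl
        · exact h t (by omega)
        · have hA := hadj m (by omega)
          rw [h m le_rfl] at hA
          rcases hc.adj_cases hA with e | e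
          · rw [e]; push_cast; rfl
          -- Turning back on the cycle would revisit the vertex of index `m - 1`.
          · exfalso
            have h1 := h (m - 1) (by omega)
            have e2 : ((m - 1 : ℕ) : ℤ) = (m : ℤ) - 1 := by omega
            rw [e2, ← e] at h1
            have := hp.getVert_injOn (by simp; omega) (by simp; omega) h1
            omega
  exact key _ le_rfl

end Cactus

/-! ### Cut vertices, bridges and distances in a cactus. -/

namespace Cactus

open SimpleGraph

variable {V : Type*} {G : SimpleGraph V}

/-! ### Distances and gates -/

/-- Every edge that leaves `K` starts at `a`, so a shortest walk from `s` to `x` passes through `a`.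
-/
theorem dist_eq_add_of_gate (hconn : G.Connected) {K : Set V} {a : V}
    (hK : ∀ y z, G.Adj y z → y ∈ K → z ∉ K → y = a) {s x : V} (hs : s ∈ K) (hx : x ∉ K) :
    G.dist s x = G.dist s a + G.dist a x := by
  classical
  apply le_antisymm hconn.dist_triangle
  obtain ⟨p, hp⟩ := hconn.exists_walk_length_eq_dist s x
  obtain ⟨d, hd, hd1, hd2⟩ := p.exists_boundary_dart K hs hx
  have ha : a ∈ p.support := by
    rw [← hK _ _ d.adj hd1 hd2]
    exact Walk.dart_fst_mem_support_of_mem_darts p hd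
  have := congrArg Walk.length (p.take_spec ha)
  rw [Walk.length_append] at this
  have h1 := dist_le (p.takeUntil a ha)
  have h2 := dist_le (p.dropUntil a ha)
  omega

/-- A source of lower bounds for distances; the potential used below is computed from the position
of the root on a cycle. -/
theorem le_add_dist_of_lipschitz (hconn : G.Connected) {φ : V → ℤ}
    (hφ : ∀ x y, G.Adj x y → φ y ≤ φ x + 1) (s x : V) : φ x ≤ φ s + G.dist s x := by
  obtain ⟨p, hp⟩ := hconn.exists_walk_length_eq_dist s x
  rw [← hp]
  clear hp
  induction p with
  | nil => simp
  | cons h q ih =>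
    have := hφ _ _ h
    rw [Walk.length_cons]; push_cast; omega

theorem dist_le_dist_add_one (hconn : G.Connected) {x y : V} (h : G.Adj x y) (s : V) :
    G.dist s y ≤ G.dist s x + 1 := by
  have := hconn.dist_triangle (u := s) (v := x) (w := y)
  rwa [dist_eq_one_iff_adj.2 h] at this

theorem exists_adj_dist_eq (hconn : G.Connected) {u x : V} {m : ℕ} (h : G.dist u x = m + 1) :
    ∃ y, G.Adj y x ∧ G.dist u y = m := by
  obtain ⟨p, hp⟩ := hconn.exists_walk_length_eq_dist u x
  have hadj := p.adj_getVert_succ (i := m) (by omega)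
  rw [show m + 1 = p.length by omega, Walk.getVert_length] at hadj
  refine ⟨_, hadj, le_antisymm ?_ ?_⟩
  · have := dist_le (p.take m)
    rw [Walk.take_length] at this
    omega
  · have := dist_le_dist_add_one hconn hadj u
    omega

/-! ### Components of `G - E(C)` -/

theorem IsCactus.eq_of_adj (hG : IsCactus G) {C D : Cycle G} {x y : V} (hC : C.1.Adj x y)
    (hD : D.1.Adj x y) : C = D := by
  by_contra h
  exact Set.disjoint_left.1 (hG.2 C D h) (Subgraph.mem_edgeSet.2 hC) (Subgraph.mem_edgeSet.2 hD)

theorem Cycle.mem_comp_self (C : Cycle G) (v : V) : v ∈ C.comp v := Reachable.refl _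

theorem Cycle.comp_adj_iff {C : Cycle G} {x y : V} :
    (G.deleteEdges C.1.edgeSet).Adj x y ↔ G.Adj x y ∧ ¬ C.1.Adj x y := by
  rw [deleteEdges_adj, Subgraph.mem_edgeSet]

theorem Cycle.mem_comp_of_adj {C : Cycle G} {v x y : V} (hx : x ∈ C.comp v) (h : G.Adj x y)
    (hC : ¬ C.1.Adj x y) : y ∈ C.comp v :=
  Reachable.trans hx (Adj.reachable (Cycle.comp_adj_iff.2 ⟨h, hC⟩))

/-- Distinct vertices of a cycle of a cactus lie in distinct components of `G - E(C)`. -/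
theorem IsCactus.eq_of_mem_comp (hG : IsCactus G) {C : Cycle G} {u w : V} (hu : u ∈ C.1.verts)
    (hw : w ∈ C.1.verts) (h : w ∈ C.comp u) : w = u := by
  obtain ⟨c, hc, rfl⟩ := Cycle.exists_param_zero hu
  obtain ⟨j, hj0, hj1, rfl⟩ := hc.exists_rep 0 hw
  have h3 := C.three_le_len
  by_contra hne
  have hj : 0 < j := lt_of_le_of_ne hj0 (by rintro rfl; exact hne rfl)
  -- With one cycle edge at `c 0` removed, the other one becomes a bridge: a cycle through it would
  -- share an edge with `C`, hence be `C`, which uses the removed edge. A connection from `c 0` to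
  -- `c j` outside `E(C)`, continued along the arc from `c j` to `c 1`, would bypass this bridge.
  set H := G.deleteEdges {s(c (-1), c 0)} with hH
  have heH : s(c 0, c 1) ∈ H.edgeSet := by
    rw [mem_edgeSet, hH, deleteEdges_adj]
    refine ⟨(hc.adj_succ 0).adj_sub, ?_⟩
    rw [Set.mem_singleton_iff, Sym2.eq_iff]
    rintro (⟨h1, -⟩ | ⟨-, h1⟩)
    · have := hc.inj h1 (by omega) (by omega); omega
    · have := hc.inj h1 (by omega) (by omega); omega
  have hbr : H.IsBridge s(c 0, c 1) := by
    rw [isBridge_iff_forall_cycle_notMem heH]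
    intro u p hp hmem
    have hle : H ≤ G := deleteEdges_le _
    have hp' : (p.mapLe hle).IsCycle := (Walk.isCycle_mapLe hle).2 hp
    let D : Cycle G := ⟨_, u, _, hp', rfl⟩
    have hD : D.1.Adj (c 0) (c 1) := by
      rw [← Subgraph.mem_edgeSet, Walk.mem_edges_toSubgraph]
      simpa using hmem
    have hCD : C = D := hG.eq_of_adj (hc.adj_succ 0) hD
    have h2 : D.1.Adj (c (-1)) (c 0) := by
      rw [← hCD]; exact hc.adj_succ (-1)
    rw [← Subgraph.mem_edgeSet, Walk.mem_edges_toSubgraph] at h2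
    have h4 : s(c (-1), c 0) ∈ p.edges := by simpa using h2
    have := p.edges_subset_edgeSet h4
    rw [mem_edgeSet, hH, deleteEdges_adj] at this
    exact this.2 rfl
  rw [isBridge_iff] at hbr
  apply hbr
  have harc : ∀ m : ℕ, 1 ≤ m → (m : ℤ) ≤ j →
      (H.deleteEdges {s(c 0, c 1)}).Reachable (c 1) (c m) := by
    intro m hm
    induction m, hm using Nat.le_induction with
    | base => intro _; exact Reachable.refl _
    | succ m hm ih =>
      intro hmj
      refine (ih (by omega)).trans (Adj.reachable ?_)
      have hA : G.Adj (c m) (c (m + 1 : ℕ)) := by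
        push_cast; exact (hc.adj_succ m).adj_sub
      rw [deleteEdges_adj, hH, deleteEdges_adj]
      refine ⟨⟨hA, ?_⟩, ?_⟩ <;> rw [Set.mem_singleton_iff, Sym2.eq_iff]
      · rintro (⟨h1, h2⟩ | ⟨h1, h2⟩)
        · have := hc.inj h2 (by omega) (by omega); omega
        · have := hc.inj h1 (by omega) (by omega); omega
      · rintro (⟨h1, h2⟩ | ⟨h1, h2⟩)
        · have := hc.inj h1 (by omega) (by omega); omega
        · have := hc.inj h2 (by omega) (by omega); omega
  have h1 := harc j.toNat (by omega) (by omega)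
  rw [Int.toNat_of_nonneg hj0] at h1
  refine (Reachable.mono ?_ h).trans h1.symm
  rw [hH, deleteEdges_deleteEdges]
  apply deleteEdges_anti
  rintro e (rfl | rfl)
  · exact Subgraph.mem_edgeSet.2 (hc.adj_succ (-1))
  · exact Subgraph.mem_edgeSet.2 (hc.adj_succ 0)

theorem IsCactus.exists_mem_comp (hG : IsCactus G) (C : Cycle G) (x : V) :
    ∃ v ∈ C.1.verts, x ∈ C.comp v := by
  obtain ⟨c, hc⟩ := C.exists_param
  obtain ⟨p⟩ := hG.1.preconnected (c 0) x
  suffices H : ∀ {a b : V} (q : G.Walk a b), (∃ v ∈ C.1.verts, a ∈ C.comp v) →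
      ∃ v ∈ C.1.verts, b ∈ C.comp v from H p ⟨c 0, hc.mem 0, C.mem_comp_self _⟩
  intro a b q
  induction q with
  | nil => exact id
  | @cons a b d h q ih =>
    rintro ⟨v, hv, hav⟩
    apply ih
    by_cases hC : C.1.Adj a b
    · exact ⟨b, hC.snd_mem, C.mem_comp_self _⟩
    · exact ⟨v, hv, Cycle.mem_comp_of_adj hav h hC⟩

open Classical in
/-- The vertex of the cycle `C` whose component of `G - E(C)` contains `x`. -/
noncomputable def Cycle.root (C : Cycle G) (x : V) : V :=
  if h : ∃ v ∈ C.1.verts, x ∈ C.comp v then h.choose else x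

section Root

variable {C : Cycle G}

theorem IsCactus.root_mem (hG : IsCactus G) (C : Cycle G) (x : V) : C.root x ∈ C.1.verts := by
  unfold Cycle.root
  rw [dif_pos (hG.exists_mem_comp C x)]
  exact (hG.exists_mem_comp C x).choose_spec.1

theorem IsCactus.mem_comp_root (hG : IsCactus G) (C : Cycle G) (x : V) :
    x ∈ C.comp (C.root x) := by
  unfold Cycle.root
  rw [dif_pos (hG.exists_mem_comp C x)]
  exact (hG.exists_mem_comp C x).choose_spec.2

theorem IsCactus.mem_comp_iff (hG : IsCactus G) {v x : V} (hv : v ∈ C.1.verts) :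
    x ∈ C.comp v ↔ C.root x = v := by
  constructor
  · intro h
    refine hG.eq_of_mem_comp hv (hG.root_mem C x) ?_
    exact Reachable.trans h (hG.mem_comp_root C x).symm
  · rintro rfl; exact hG.mem_comp_root C x

theorem IsCactus.root_self (hG : IsCactus G) {v : V} (hv : v ∈ C.1.verts) : C.root v = v :=
  (hG.mem_comp_iff hv).1 (C.mem_comp_self v)

theorem IsCactus.root_eq_of_adj (hG : IsCactus G) {x y : V} (h : G.Adj x y) (h' : ¬ C.1.Adj x y) :
    C.root y = C.root x :=
  (hG.mem_comp_iff (hG.root_mem C x)).1 (Cycle.mem_comp_of_adj (hG.mem_comp_root C x) h h')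

theorem IsCactus.dist_eq_of_root_ne (hG : IsCactus G) {s x : V} (h : C.root s ≠ C.root x) :
    G.dist s x = G.dist s (C.root s) + G.dist (C.root s) x := by
  refine dist_eq_add_of_gate hG.1 (K := {y | C.root y = C.root s}) ?_ rfl (Ne.symm h)
  intro y z hyz hy hz
  by_cases hC : C.1.Adj y z
  · rw [← hG.root_self hC.fst_mem]; exact hy
  · exact absurd ((hG.root_eq_of_adj hyz hC).trans hy) hz

theorem IsCactus.dist_eq_of_mem (hG : IsCactus G) {s v : V} (hv : v ∈ C.1.verts) :
    G.dist s v = G.dist s (C.root s) + G.dist (C.root s) v := by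
  by_cases h : C.root s = v
  · simp [h]
  · exact hG.dist_eq_of_root_ne (by rwa [hG.root_self hv])

/-- Cycles of a cactus are isometric. The two arcs bound the distance from above. For the lower
bound, an edge off `C` keeps the root and an edge of `C` moves it by one position, so the circular
distance of the root from `c i` is a 1-Lipschitz potential. -/
theorem IsCactus.dist_param (hG : IsCactus G) {c : ℤ → V} (hc : Param C c) {i j : ℤ} (hij : i ≤ j)
    (hji : j ≤ i + C.len) : (G.dist (c i) (c j) : ℤ) = min (j - i) (C.len - (j - i)) := by
  have h3 := C.three_le_len
  apply le_antisymm
  · refine le_min ?_ ?_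
    · obtain ⟨p, hp, -⟩ := hc.exists_arc i (j - i).toNat
      have := dist_le p
      rw [hp, show i + ((j - i).toNat : ℤ) = j by omega] at this
      omega
    · obtain ⟨p, hp, -⟩ := hc.exists_arc j (i + C.len - j).toNat
      have := dist_le p
      rw [hp, show j + ((i + C.len - j).toNat : ℤ) = i + C.len by omega, hc.add_len,
        dist_comm] at this
      omega
  · choose m hm1 hm2 hm3 using fun x => hc.exists_rep i (hG.root_mem C x)
    have huniq : ∀ x t, i ≤ t → t < i + C.len → c t = C.root x → m x = t := fun x t h1 h2 h =>
      hc.inj ((hm3 x).trans h.symm) (by have := hm2 x; omega) (by have := hm1 x; omega)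
    have hlip := le_add_dist_of_lipschitz hG.1 (φ := fun x => min (m x - i) (C.len - (m x - i)))
      (by
        intro x y hxy
        by_cases hC : C.1.Adj x y
        · have hx : c (m x) = x := (hm3 x).trans (hG.root_self hC.fst_mem)
          have hy : C.root y = y := hG.root_self hC.snd_mem
          have := hm1 x
          have := hm2 x
          rw [← hx] at hC
          rcases hc.adj_cases hC with h | h
          · by_cases hlt : m x + 1 < i + C.len
            · have := huniq y (m x + 1) (by omega) hlt (by rw [hy, h])
              simp only [this]; omega
            · have := huniq y i le_rfl (by omega) (by
                rw [hy, h, show m x + 1 = i + C.len by omega, hc.add_len])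
              simp only [this]; omega
          · by_cases hlt : i ≤ m x - 1
            · have := huniq y (m x - 1) hlt (by omega) (by rw [hy, h])
              simp only [this]; omega
            · have := huniq y (i + C.len - 1) (by omega) (by omega) (by
                rw [hy, h, show m x = i by omega,
                  show i + (C.len : ℤ) - 1 = (i - 1) + C.len by ring, hc.add_len])
              simp only [this]; omega
        · have h := hG.root_eq_of_adj hxy hC
          have := huniq y (m x) (hm1 x) (hm2 x) (by rw [h, hm3])
          simp only [this]; omega) (c i) (c j)
    have hi := huniq (c i) i le_rfl (by omega) (hG.root_self (hc.mem i)).symm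
    simp only [hi] at hlip
    rcases hji.lt_or_eq with hlt | heq
    · have hj := huniq (c j) j hij hlt (hG.root_self (hc.mem j)).symm
      simp only [hj] at hlip
      omega
    · omega

end Root

/-! ### Branches at a vertex -/

/-- The vertices that can be reached from `z` without passing through `v`. -/
def branch (G : SimpleGraph V) (v z : V) : Set V := {x | ∃ p : G.Walk z x, v ∉ p.support}

theorem branch_induction {v z : V} {P : V → Prop} (h0 : P z)
    (h : ∀ x y, x ∈ branch G v z → P x → G.Adj x y → y ≠ v → P y) {x : V}
    (hx : x ∈ branch G v z) : P x := by
  obtain ⟨p, hp⟩ := hx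
  suffices H : ∀ {a b : V} (q : G.Walk a b), v ∉ q.support → a ∈ branch G v z → P a → P b by
    exact H p hp ⟨Walk.nil, by simpa using fun h => hp (by subst h; simp)⟩ h0
  intro a b q
  induction q with
  | nil => exact fun _ _ => id
  | @cons a b d hab q ih =>
    intro hv ha hPa
    rw [Walk.support_cons, List.mem_cons, not_or] at hv
    have hb : b ≠ v := by rintro rfl; exact hv.2 (by simp)
    refine ih hv.2 ?_ (h a b ha hPa hab hb)
    obtain ⟨r, hr⟩ := ha
    exact ⟨r.concat hab, by simp [Walk.support_concat, hr, hb.symm]⟩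

theorem mem_branch_self {v z : V} (h : z ≠ v) : z ∈ branch G v z :=
  ⟨Walk.nil, by simpa using h.symm⟩

theorem ne_of_mem_branch {v z x : V} (h : x ∈ branch G v z) : x ≠ v := by
  rintro rfl
  obtain ⟨p, hp⟩ := h
  exact hp (by simp)

theorem mem_branch_of_adj {v z x y : V} (h : x ∈ branch G v z) (hxy : G.Adj x y) (hy : y ≠ v) :
    y ∈ branch G v z := by
  obtain ⟨p, hp⟩ := h
  exact ⟨p.concat hxy, by simp [Walk.support_concat, hp, hy.symm]⟩

theorem branch_trans {v x y z : V} (h : x ∈ branch G v y) (h' : y ∈ branch G v z) :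
    x ∈ branch G v z := by
  obtain ⟨p, hp⟩ := h
  obtain ⟨q, hq⟩ := h'
  exact ⟨q.append p, by rw [Walk.mem_support_append_iff]; tauto⟩

theorem branch_symm {v x z : V} (h : x ∈ branch G v z) : z ∈ branch G v x := by
  obtain ⟨p, hp⟩ := h
  exact ⟨p.reverse, by simpa using hp⟩

theorem branch_subset {u v z z' : V} (h : v ∉ branch G u z') (h' : z' ∈ branch G v z) :
    branch G u z' ⊆ branch G v z := by
  intro x hx
  refine branch_induction (P := fun x => x ∈ branch G v z) h' ?_ hx
  intro x y hx hxv hxy hy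
  refine mem_branch_of_adj hxv hxy ?_
  rintro rfl
  exact h (mem_branch_of_adj hx hxy hy)

theorem dist_eq_of_mem_branch (hconn : G.Connected) {v z s x : V} (hs : s ∉ branch G v z)
    (hx : x ∈ branch G v z) : G.dist s x = G.dist s v + G.dist v x := by
  refine dist_eq_add_of_gate hconn (K := (branch G v z)ᶜ) ?_ hs (by simpa using hx)
  intro y w hyw hy hw
  by_contra hne
  exact hy (mem_branch_of_adj (by simpa using hw) hyw.symm hne)

/-- A vertex in neither branch would reach `z` only through `v` and `v` only through `z`, so each of
them would be farther than the other. -/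
theorem mem_branch_or (hconn : G.Connected) {v z : V} (h : G.Adj v z) (x : V) :
    x ∈ branch G v z ∨ x ∈ branch G z v := by
  by_contra! hx
  have h1 := dist_eq_of_mem_branch hconn hx.1 (mem_branch_self h.ne')
  have h2 := dist_eq_of_mem_branch hconn hx.2 (mem_branch_self h.ne)
  rw [dist_eq_one_iff_adj.2 h] at h1
  rw [dist_eq_one_iff_adj.2 h.symm] at h2
  omega

/-- The edge `vz` lies on no cycle. -/
def OffCycles (G : SimpleGraph V) (v z : V) : Prop := ∀ C : Cycle G, ¬ C.1.Adj v z

theorem OffCycles.symm {v z : V} (h : OffCycles G v z) : OffCycles G z v :=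
  fun C hC => h C hC.symm

/-- An edge on no cycle is a bridge, so `v` and `z` are not joined via `x` without using it. -/
theorem OffCycles.not_mem_branch {v z x : V} (hadj : G.Adj v z) (h : OffCycles G v z)
    (hx : x ∈ branch G v z) : x ∉ branch G z v := by
  rintro ⟨q, hq⟩
  obtain ⟨p, hp⟩ := hx
  have hbr : G.IsBridge s(v, z) := by
    rw [isBridge_iff_forall_cycle_notMem (by simpa using hadj)]
    intro u w hw hmem
    exact h ⟨_, u, w, hw, rfl⟩ (by rwa [← Subgraph.mem_edgeSet, Walk.mem_edges_toSubgraph])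
  rw [isBridge_iff_forall_walk_mem_edges] at hbr
  have := hbr (q.append p.reverse)
  rw [Walk.edges_append, List.mem_append, Walk.edges_reverse, List.mem_reverse] at this
  rcases this with h1 | h1
  · exact hq (q.snd_mem_support_of_mem_edges h1)
  · exact hp (p.fst_mem_support_of_mem_edges h1)

section Branch

variable {C : Cycle G}

theorem IsCactus.branch_subset_comp (hG : IsCactus G) {v z : V} (hv : v ∈ C.1.verts)
    (hadj : G.Adj v z) (hz : ¬ C.1.Adj v z) : branch G v z ⊆ C.comp v := by
  intro x hx
  refine branch_induction (P := fun x => x ∈ C.comp v)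
    (Cycle.mem_comp_of_adj (C.mem_comp_self v) hadj hz) ?_ hx
  intro x y hx hxv hxy hy
  refine Cycle.mem_comp_of_adj hxv hxy fun hC => ?_
  exact ne_of_mem_branch hx (hG.eq_of_mem_comp hv hC.fst_mem hxv)

theorem Cycle.exists_branch {v x : V} (hx : x ∈ C.comp v) (hne : x ≠ v) :
    ∃ z, G.Adj v z ∧ ¬ C.1.Adj v z ∧ x ∈ branch G v z := by
  obtain ⟨p, hp⟩ := Reachable.exists_isPath hx
  cases p with
  | nil => exact absurd rfl hne
  | @cons _ z _ h q =>
    rw [Walk.cons_isPath_iff] at hp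
    have h' := Cycle.comp_adj_iff.1 h
    exact ⟨z, h'.1, h'.2, q.mapLe (deleteEdges_le _), by simpa using hp.2⟩

theorem Cycle.mem_branch {v z u : V} (h : C.1.Adj v z) (hu : u ∈ C.1.verts) (hne : u ≠ v) :
    u ∈ branch G v z := by
  obtain ⟨c, hc, rfl, rfl⟩ := Cycle.exists_param_adj h
  obtain ⟨j, hj0, hj1, rfl⟩ := hc.exists_rep 0 hu
  have hj : 0 < j := lt_of_le_of_ne hj0 (by rintro rfl; exact hne rfl)
  have harc : ∀ m : ℕ, 1 ≤ m → (m : ℤ) ≤ j → c m ∈ branch G (c 0) (c 1) := by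
    intro m hm
    induction m, hm using Nat.le_induction with
    | base => intro _; exact mem_branch_self h.adj_sub.ne'
    | succ m hm ih =>
      intro hmj
      refine mem_branch_of_adj (ih (by omega)) (by push_cast; exact (hc.adj_succ m).adj_sub) ?_
      intro h
      have := hc.inj h (by omega) (by omega)
      omega
  have := harc j.toNat (by omega) (by omega)
  rwa [Int.toNat_of_nonneg hj0] at this

end Branch

theorem Cycle.exists_nbrs {C : Cycle G} {v : V} (hv : v ∈ C.1.verts) :
    ∃ x y, x ≠ y ∧ C.1.Adj v x ∧ C.1.Adj v y ∧ ∀ z, C.1.Adj v z → z = x ∨ z = y := by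
  obtain ⟨c, hc, rfl⟩ := Cycle.exists_param_zero hv
  have h3 := C.three_le_len
  refine ⟨c (0 + 1), c (0 - 1), fun h => ?_, hc.adj_succ 0, hc.adj_pred 0,
    fun z hz => hc.adj_cases hz⟩
  have := hc.inj h (by omega) (by omega)
  omega

theorem OffCycles.dist_ne (hconn : G.Connected) {x y : V} (h : G.Adj x y) (h' : OffCycles G x y)
    (s : V) : G.dist s x ≠ G.dist s y := by
  have h1 := dist_eq_one_iff_adj.2 h
  have h2 := dist_eq_one_iff_adj.2 h.symm
  rcases mem_branch_or hconn h s with hs | hs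
  · have := dist_eq_of_mem_branch hconn (h'.not_mem_branch h hs) (mem_branch_self h.ne)
    omega
  · have := dist_eq_of_mem_branch hconn (h'.symm.not_mem_branch h.symm hs) (mem_branch_self h.ne')
    omega

end Cactus

/-! ### Threads, and branches that contain no landmark. -/

namespace Cactus

open SimpleGraph

variable {V : Type*} [Fintype V] {G : SimpleGraph V} [DecidableRel G.Adj]

/-! ### Degrees -/

theorem card_le_degree {v : V} (T : Finset V) (hT : ∀ x ∈ T, G.Adj v x) : T.card ≤ G.degree v := by
  rw [← card_neighborFinset_eq_degree]
  exact Finset.card_le_card fun x hx => by simpa using hT x hx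

theorem degree_le_card {v : V} (T : Finset V) (hT : ∀ x, G.Adj v x → x ∈ T) :
    G.degree v ≤ T.card := by
  rw [← card_neighborFinset_eq_degree]
  exact Finset.card_le_card fun x hx => hT x (by simpa using hx)

theorem two_le_degree {v x y : V} (hx : G.Adj v x) (hy : G.Adj v y) (hxy : x ≠ y) :
    2 ≤ G.degree v := by
  classical
  have := card_le_degree (G := G) {x, y} (v := v) (by simp [hx, hy])
  rwa [Finset.card_pair hxy] at this

theorem three_le_degree {v x y z : V} (hx : G.Adj v x) (hy : G.Adj v y) (hz : G.Adj v z)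
    (hxy : x ≠ y) (hxz : x ≠ z) (hyz : y ≠ z) : 3 ≤ G.degree v := by
  classical
  have := card_le_degree (G := G) {x, y, z} (v := v) (by simp [hx, hy, hz])
  rwa [Finset.card_eq_three.2 ⟨x, y, z, hxy, hxz, hyz, rfl⟩] at this

theorem four_le_degree {v x y z w : V} (hx : G.Adj v x) (hy : G.Adj v y) (hz : G.Adj v z)
    (hw : G.Adj v w) (hxy : x ≠ y) (hxz : x ≠ z) (hyz : y ≠ z) (hwx : w ≠ x) (hwy : w ≠ y)
    (hwz : w ≠ z) : 4 ≤ G.degree v := by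
  classical
  have := card_le_degree (G := G) {w, x, y, z} (v := v) (by simp [hx, hy, hz, hw])
  rwa [Finset.card_insert_of_notMem (by simp [hwx, hwy, hwz]),
    Finset.card_eq_three.2 ⟨x, y, z, hxy, hxz, hyz, rfl⟩] at this

theorem Cycle.two_le_degree {C : Cycle G} {v : V} (hv : v ∈ C.1.verts) : 2 ≤ G.degree v := by
  obtain ⟨x, y, hxy, hx, hy, -⟩ := Cycle.exists_nbrs hv
  exact Cactus.two_le_degree hx.adj_sub hy.adj_sub hxy

theorem Cycle.three_le_degree {C : Cycle G} {v z : V} (hv : v ∈ C.1.verts) (hz : G.Adj v z)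
    (hz' : ¬ C.1.Adj v z) : 3 ≤ G.degree v := by
  obtain ⟨x, y, hxy, hx, hy, -⟩ := Cycle.exists_nbrs hv
  refine Cactus.three_le_degree hx.adj_sub hy.adj_sub hz hxy ?_ ?_ <;> rintro rfl <;>
    exact hz' (by assumption)

theorem Cycle.four_le_degree {C : Cycle G} {v z w : V} (hv : v ∈ C.1.verts) (hz : G.Adj v z)
    (hz' : ¬ C.1.Adj v z) (hw : G.Adj v w) (hw' : ¬ C.1.Adj v w) (hzw : z ≠ w) :
    4 ≤ G.degree v := by
  obtain ⟨x, y, hxy, hx, hy, -⟩ := Cycle.exists_nbrs hv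
  refine Cactus.four_le_degree hx.adj_sub hy.adj_sub hz hw hxy ?_ ?_ ?_ ?_ hzw.symm <;>
    rintro rfl <;>
    first | exact hz' (by assumption) | exact hw' (by assumption)

/-! ### Tails -/

/-- The list `l` satisfies the conditions on a thread at `v` except for the degree of `v`. -/
def IsTail (G : SimpleGraph V) [DecidableRel G.Adj] (v : V) (l : List V) : Prop :=
  l.Nodup ∧ (l ++ [v]).IsChain G.Adj ∧
    ∃ (u : V) (t : List V), l = u :: t ∧ G.degree u = 1 ∧ ∀ x ∈ t, G.degree x = 2

theorem isThread_iff {v : V} {l : List V} : IsThread G v l ↔ 3 ≤ G.degree v ∧ IsTail G v l :=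
  Iff.rfl

theorem IsTail.degree_le {v x : V} {l : List V} (h : IsTail G v l) (hx : x ∈ l) :
    G.degree x ≤ 2 := by
  obtain ⟨-, -, u, t, rfl, hu, ht⟩ := h
  rcases List.mem_cons.1 hx with rfl | hx
  · omega
  · exact (ht x hx).le

theorem IsThread.not_mem {v : V} {l : List V} (h : IsThread G v l) : v ∉ l := fun hv => by
  have := IsTail.degree_le (isThread_iff.1 h).2 hv
  have := h.1
  omega

/-- Peeling off the vertex of a tail that is adjacent to the vertex at which it hangs. -/
theorem IsTail.cases {v : V} {l : List V} (h : IsTail G v l) (hv : v ∉ l) :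
    ∃ z, G.Adj v z ∧ ((l = [z] ∧ G.degree z = 1) ∨
      ∃ l', l = l' ++ [z] ∧ G.degree z = 2 ∧ IsTail G z l' ∧ z ∉ l' ∧ v ∉ l') := by
  obtain ⟨hnd, hch, u, t, rfl, hu, ht⟩ := h
  rcases List.eq_nil_or_concat t with rfl | ⟨t', z, rfl⟩
  · refine ⟨u, ?_, Or.inl ⟨rfl, hu⟩⟩
    simpa [adj_comm] using hch
  · refine ⟨z, ?_, Or.inr ⟨u :: t', by simp, ht z (by simp), ⟨?_, ?_, u, t', rfl, hu, ?_⟩, ?_, ?_⟩⟩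
    · have h2 : (u :: t' ++ [z] ++ [v]).IsChain G.Adj := by simpa using hch
      have := (List.isChain_append.1 h2).2.2 z (by rw [List.getLast?_append]; simp) v (by simp)
      exact this.symm
    · exact hnd.sublist (by simp)
    · have h2 : ((u :: t' ++ [z]) ++ [v]).IsChain G.Adj := by simpa using hch
      exact h2.left_of_append
    · exact fun x hx => ht x (by simp [hx])
    · have h2 : (u :: t' ++ [z]).Nodup := by simpa using hnd
      rw [List.nodup_append] at h2
      intro hz
      exact h2.2.2 z hz z (by simp) rfl
    · intro hv'
      apply hv
      rw [List.mem_cons] at hv'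
      simp only [List.concat_eq_append, List.mem_cons, List.mem_append]
      tauto

/-- A tail, unlike a thread, may hang at a vertex of degree two. Therefore what remains after
removing the vertex next to `v` is again a tail, and induction is possible. -/
theorem IsTail.induction {P : V → List V → Prop}
    (base : ∀ v z, G.Adj v z → G.degree z = 1 → P v [z])
    (step : ∀ v z l, G.Adj v z → G.degree z = 2 → IsTail G z l → z ∉ l → v ∉ l → P z l →
      P v (l ++ [z])) {v : V} {l : List V} (h : IsTail G v l) (hv : v ∉ l) : P v l := by
  induction hn : l.length generalizing v l with
  | zero =>
    obtain ⟨-, -, u, t, rfl, -⟩ := h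
    simp at hn
  | succ n ih =>
    obtain ⟨z, hvz, ⟨rfl, hz⟩ | ⟨l', rfl, hz, h', hz', hv'⟩⟩ := h.cases hv
    · exact base v z hvz hz
    · exact step v z l' hvz hz h' hz' hv' (ih h' hz' (by simpa using hn))

theorem IsTail.exists_last {v : V} {l : List V} (h : IsTail G v l) (hv : v ∉ l) :
    ∃ z l', l = l' ++ [z] ∧ G.Adj v z := by
  obtain ⟨z, hvz, ⟨rfl, -⟩ | ⟨l', rfl, -⟩⟩ := h.cases hv
  · exact ⟨z, [], rfl, hvz⟩
  · exact ⟨z, l', rfl, hvz⟩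

theorem eq_of_degree_two {z x y w : V} (hz : G.degree z = 2) (hx : G.Adj z x) (hy : G.Adj z y)
    (hxy : x ≠ y) (hw : G.Adj z w) : w = x ∨ w = y := by
  by_contra! h
  have := three_le_degree hx hy hw hxy h.1.symm h.2.symm
  omega

theorem eq_of_degree_one {z x y : V} (hz : G.degree z = 1) (hx : G.Adj z x) (hy : G.Adj z y) :
    y = x := by
  by_contra! h
  have := two_le_degree hx hy h.symm
  omega

theorem IsTail.closed {v : V} {l : List V} (h : IsTail G v l) (hv : v ∉ l) :
    ∀ x ∈ l, ∀ y, G.Adj x y → y ∈ l ∨ y = v := by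
  refine IsTail.induction (P := fun v l => ∀ x ∈ l, ∀ y, G.Adj x y → y ∈ l ∨ y = v) ?_ ?_ h hv
  · intro v z hvz hz x hx y hxy
    rw [List.mem_singleton] at hx
    subst hx
    exact Or.inr (eq_of_degree_one hz hvz.symm hxy)
  · intro v z l hvz hz hl hzl hvl ih x hx y hxy
    rw [List.mem_append, List.mem_singleton] at hx ⊢
    rcases hx with hx | rfl
    · exact Or.inl (ih x hx y hxy)
    · obtain ⟨z', l', rfl, hz'⟩ := hl.exists_last hzl
      rcases eq_of_degree_two hz hvz.symm hz' (by rintro rfl; exact hvl (by simp)) hxy with h | h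
      · exact Or.inr h
      · subst h; exact Or.inl (Or.inl (by simp))

theorem IsTail.eq_last_of_adj {v : V} {l : List V} {z : V} (h : IsTail G v (l ++ [z]))
    (hv : v ∉ l ++ [z]) {x : V} (hx : x ∈ l ++ [z]) (hxv : G.Adj x v) : x = z := by
  obtain ⟨z', -, ⟨h1, -⟩ | ⟨l', h1, -, h', hz', hv'⟩⟩ := h.cases hv
  · rw [h1] at hx
    have := List.append_eq_singleton_iff.1 h1
    simp_all
  · obtain ⟨rfl, h2⟩ := List.append_inj' h1 (by simp)
    obtain rfl : z = z' := by simpa using h2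
    rw [List.mem_append, List.mem_singleton] at hx
    rcases hx with hx | hx
    · rcases h'.closed hz' x hx v hxv with h3 | h3
      · exact absurd h3 hv'
      · subst h3; simp at hv
    · exact hx

theorem IsTail.mem_iff_mem_branch {v : V} {l : List V} {z : V} (h : IsTail G v (l ++ [z]))
    (hv : v ∉ l ++ [z]) (x : V) : x ∈ l ++ [z] ↔ x ∈ branch G v z := by
  have hvz : z ≠ v := by rintro rfl; simp at hv
  constructor
  · revert x
    suffices H : ∀ v l', IsTail G v l' → v ∉ l' → ∀ l z, l' = l ++ [z] →
        ∀ x ∈ l', x ∈ branch G v z from H v _ h hv l z rfl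
    intro v l' h hv
    refine IsTail.induction (P := fun v l' => ∀ l z, l' = l ++ [z] → ∀ x ∈ l', x ∈ branch G v z)
      ?_ ?_ h hv
    · intro v z hvz _ l z' h x hx
      obtain ⟨rfl, h2⟩ := List.append_inj' (t₁ := [z]) (s₁ := []) h (by simp)
      simp only [List.cons.injEq, and_true] at h2
      subst h2
      rw [List.mem_singleton] at hx
      subst hx
      exact mem_branch_self hvz.ne'
    · intro v z l hvz hz hl hzl hvl ih l' z' h x hx
      obtain ⟨rfl, h2⟩ := List.append_inj' h (by simp)
      obtain rfl : z = z' := by simpa using h2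
      rw [List.mem_append, List.mem_singleton] at hx
      rcases hx with hx | rfl
      · obtain ⟨w, l', rfl, hw⟩ := hl.exists_last hzl
        have hwv : w ≠ v := by rintro rfl; exact hvl (by simp)
        have hxb := ih l' w rfl x hx
        refine branch_subset ?_ (mem_branch_of_adj (mem_branch_self hvz.ne') hw hwv) hxb
        intro hv'
        have : v ∈ l' ++ [w] := by
          refine branch_induction (P := fun y => y ∈ l' ++ [w]) (by simp) ?_ hv'
          intro a b _ ha hab hb
          exact (hl.closed hzl a ha b hab).resolve_right hb
        exact hvl this
      · exact mem_branch_self hvz.ne'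
  · intro hx
    refine branch_induction (P := fun x => x ∈ l ++ [z]) (by simp) ?_ hx
    intro a b _ ha hab hb
    exact (h.closed hv a ha b hab).resolve_right hb

theorem IsTail.not_mem_verts {v : V} {l : List V} (h : IsTail G v l) (hv : v ∉ l) (C : Cycle G) :
    ∀ x ∈ l, x ∉ C.1.verts := by
  refine IsTail.induction (P := fun v l => ∀ x ∈ l, x ∉ C.1.verts) ?_ ?_ h hv
  · intro v z hvz hz x hx hC
    rw [List.mem_singleton] at hx
    subst hx
    have := Cycle.two_le_degree hC
    omega
  · intro v z l hvz hz hl hzl hvl ih x hx hC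
    rw [List.mem_append, List.mem_singleton] at hx
    rcases hx with hx | rfl
    · exact ih x hx hC
    · obtain ⟨z', l', rfl, hz'⟩ := hl.exists_last hzl
      have hne : v ≠ z' := by rintro rfl; exact hvl (by simp)
      have hzC := ih z' (by simp)
      obtain ⟨a, b, hab, ha, hb, -⟩ := Cycle.exists_nbrs hC
      have h1 := (eq_of_degree_two hz hvz.symm hz' hne ha.adj_sub).resolve_right
        (by rintro rfl; exact hzC ha.snd_mem)
      have h2 := (eq_of_degree_two hz hvz.symm hz' hne hb.adj_sub).resolve_right
        (by rintro rfl; exact hzC hb.snd_mem)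
      exact hab (h1.trans h2.symm)

theorem IsTail.unique {v : V} {l₁ l₂ : List V} {z : V} (h₁ : IsTail G v (l₁ ++ [z]))
    (hv₁ : v ∉ l₁ ++ [z]) (h₂ : IsTail G v (l₂ ++ [z])) (hv₂ : v ∉ l₂ ++ [z]) : l₁ = l₂ := by
  induction hn : l₁.length generalizing v l₁ l₂ z with
  | zero =>
    obtain rfl := List.eq_nil_of_length_eq_zero hn
    obtain ⟨z', -, ⟨h1', hz⟩ | ⟨l', h1, hz, h', hz', hv'⟩⟩ := h₁.cases hv₁
    · obtain ⟨z'', -, ⟨h2, -⟩ | ⟨l', h1, hz2, -⟩⟩ := h₂.cases hv₂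
      · have := List.append_eq_singleton_iff.1 h2
        simp_all
      · obtain ⟨rfl, h2⟩ := List.append_inj' h1 (by simp)
        obtain rfl : z = z'' := by simpa using h2
        obtain rfl : z = z' := by simpa using h1'
        omega
    · obtain ⟨rfl, h2⟩ := List.append_inj' h1 (by simp)
      obtain ⟨-, -, u, t, h, -⟩ := h'
      simp at h
  | succ n ih =>
    obtain ⟨z', hvz, ⟨h1, -⟩ | ⟨l', h1, hz, h', hz', hv'⟩⟩ := h₁.cases hv₁
    · have := congrArg List.length h1
      simp [hn] at this
    · obtain ⟨rfl, h2⟩ := List.append_inj' h1 (by simp)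
      obtain rfl : z = z' := by simpa using h2
      obtain ⟨z'', -, ⟨h1', hz2⟩ | ⟨l', h1', hz2, h'', hz'', hv''⟩⟩ := h₂.cases hv₂
      · obtain rfl : z = z'' := by simpa using (List.append_inj' (s₂ := []) h1' (by simp)).2
        omega
      · obtain ⟨rfl, h2⟩ := List.append_inj' h1' (by simp)
        obtain rfl : z = z'' := by simpa using h2
        obtain ⟨w, t, rfl, hw⟩ := h'.exists_last hz'
        obtain ⟨w', t', rfl, hw'⟩ := h''.exists_last hz''
        have hvw : v ≠ w := by rintro rfl; exact hv' (by simp)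
        have hvw' : v ≠ w' := by rintro rfl; exact hv'' (by simp)
        obtain rfl := (eq_of_degree_two hz hvz.symm hw hvw hw').resolve_left hvw'.symm
        rw [ih h' hz' h'' hz'' (by simpa using hn)]

/-- Threads with a common vertex coincide. -/
theorem IsThread.eq_of_mem {v v' x : V} {l l' : List V} (h : IsThread G v l)
    (h' : IsThread G v' l') (hx : x ∈ l) (hx' : x ∈ l') : v = v' ∧ l = l' := by
  have hv := h.not_mem
  have hv' := h'.not_mem
  have hd := h.1
  have hd' := h'.1
  have ht := (isThread_iff.1 h).2
  have ht' := (isThread_iff.1 h').2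
  obtain ⟨z, t, rfl, hz⟩ := ht.exists_last hv
  obtain ⟨z', t', rfl, hz'⟩ := ht'.exists_last hv'
  have hvl : v ∉ t' ++ [z'] := fun h => by have := ht'.degree_le h; omega
  have hvl' : v' ∉ t ++ [z] := fun h => by have := ht.degree_le h; omega
  -- The second thread is followed from the common vertex to its last vertex. It cannot leave the
  -- first thread, whose only exit `v` has degree at least three and so does not lie on the second.
  have hz'l : z' ∈ t ++ [z] := by
    have hb : z' ∈ branch G v' x := branch_symm ((ht'.mem_iff_mem_branch hv' x).1 hx')
    refine branch_induction (P := fun y => y ∈ t ++ [z]) hx ?_ hb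
    intro a b ha hal hab hbv
    refine (ht.closed hv a hal b hab).resolve_right ?_
    rintro rfl
    apply hvl
    rw [ht'.mem_iff_mem_branch hv']
    exact branch_trans (mem_branch_of_adj ha hab hbv) ((ht'.mem_iff_mem_branch hv' x).1 hx')
  obtain rfl := (ht.closed hv z' hz'l v' hz'.symm).resolve_left hvl'
  obtain rfl := ht.eq_last_of_adj hv hz'l hz'.symm
  exact ⟨rfl, by rw [ht.unique hv ht' hv']⟩

theorem IsTail.dist_le_length (hconn : G.Connected) {v : V} {l : List V} (h : IsTail G v l)
    (hv : v ∉ l) : ∀ x ∈ l, G.dist v x ≤ l.length := by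
  refine IsTail.induction (P := fun v l => ∀ x ∈ l, G.dist v x ≤ l.length) ?_ ?_ h hv
  · intro v z hvz hz x hx
    rw [List.mem_singleton] at hx
    subst hx
    simp [dist_eq_one_iff_adj.2 hvz]
  · intro v z l hvz hz hl hzl hvl ih x hx
    have h1 := dist_eq_one_iff_adj.2 hvz
    rw [List.mem_append, List.mem_singleton] at hx
    rw [List.length_append, List.length_singleton]
    rcases hx with hx | rfl
    · have h2 := hconn.dist_triangle (u := v) (v := z) (w := x)
      have := ih x hx
      omega
    · omega

theorem IsTail.exists_dist_eq (hconn : G.Connected) {v : V} {l : List V} (h : IsTail G v l)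
    (hv : v ∉ l) : ∀ m, 1 ≤ m → m ≤ l.length → ∃ x ∈ l, G.dist v x = m := by
  refine IsTail.induction (P := fun v l => ∀ m, 1 ≤ m → m ≤ l.length → ∃ x ∈ l, G.dist v x = m)
    ?_ ?_ h hv
  · intro v z hvz hz m hm hm'
    rw [List.length_singleton] at hm'
    exact ⟨z, by simp, by rw [dist_eq_one_iff_adj.2 hvz]; omega⟩
  · intro v z l hvz hz hl hzl hvl ih m hm hm'
    rw [List.length_append, List.length_singleton] at hm'
    have h1 := dist_eq_one_iff_adj.2 hvz
    rcases hm.eq_or_lt with rfl | hm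
    · exact ⟨z, by simp, h1⟩
    · obtain ⟨x, hx, hxm⟩ := ih (m - 1) (by omega) (by omega)
      obtain ⟨w, l', rfl, hw⟩ := hl.exists_last hzl
      rw [hl.mem_iff_mem_branch hzl] at hx hvl
      refine ⟨x, List.mem_append_left _ ((hl.mem_iff_mem_branch hzl x).2 hx), ?_⟩
      rw [dist_eq_of_mem_branch hconn hvl hx]
      omega

/-! ### Branches that avoid `S` -/

/-- Every cycle has at least two vertices that are branch-active or `S`-active. -/
def IsWeaklyBiactive (G : SimpleGraph V) [DecidableRel G.Adj] (S : Finset V) : Prop :=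
  ∀ C : Cycle G, 2 ≤ {v | C.IsBranchActive v ∨ C.IsActive S v}.ncard

theorem IsBiactive.isWeaklyBiactive {S : Finset V} (h : IsBiactive G S) :
    IsWeaklyBiactive G S := fun C =>
  (h C).trans (Set.ncard_le_ncard (fun _ hv => Or.inr hv) (Set.toFinite _))

theorem eq_of_free_tails {S : Finset V} (hbr : IsBranchResolving G S) {u a b : V}
    (hu : 3 ≤ G.degree u)
    (ha : ∃ l, IsTail G u (l ++ [a]) ∧ ∀ x, x ∈ l ++ [a] ↔ x ∈ branch G u a)
    (hb : ∃ l, IsTail G u (l ++ [b]) ∧ ∀ x, x ∈ l ++ [b] ↔ x ∈ branch G u b)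
    (ha' : ∀ s ∈ S, s ∉ branch G u a) (hb' : ∀ s ∈ S, s ∉ branch G u b) : a = b := by
  obtain ⟨l, hl, hl'⟩ := ha
  obtain ⟨m, hm, hm'⟩ := hb
  have := hbr u (x := l ++ [a]) ⟨⟨hu, hl⟩, fun x hx hxS => ha' x hxS ((hl' x).1 hx)⟩
    (y := m ++ [b]) ⟨⟨hu, hm⟩, fun x hx hxS => hb' x hxS ((hm' x).1 hx)⟩
  simpa using (List.append_inj' this (by simp)).2

theorem Cycle.exists_two_nbrs_of_four_le_degree {C : Cycle G} {u : V} (hu : u ∈ C.1.verts)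
    (h4 : 4 ≤ G.degree u) :
    ∃ w w', w ≠ w' ∧ (G.Adj u w ∧ ¬ C.1.Adj u w) ∧ (G.Adj u w' ∧ ¬ C.1.Adj u w') := by
  classical
  obtain ⟨a, b, hab, ha, hb, honly⟩ := Cycle.exists_nbrs hu
  by_contra! hcon
  have hex : ∃ t, ∀ x, G.Adj u x → x ∈ ({a, b, t} : Finset V) := by
    by_cases hw : ∃ w, G.Adj u w ∧ ¬ C.1.Adj u w
    · obtain ⟨w, hw, hw'⟩ := hw
      refine ⟨w, fun x hx => ?_⟩
      by_cases hxC : C.1.Adj u x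
      · rcases honly x hxC with rfl | rfl <;> simp
      · by_cases hwx : w = x
        · simp [hwx]
        · exact absurd (hcon w x hwx ⟨hw, hw'⟩ hx) hxC
    · push Not at hw
      refine ⟨a, fun x hx => ?_⟩
      rcases honly x (hw x hx) with rfl | rfl <;> simp
  obtain ⟨t, ht⟩ := hex
  have := degree_le_card _ ht
  have := Finset.card_le_three (a := a) (b := b) (c := t)
  omega

/-- Degree four would give two free threads at `u`, and tails contain no vertex of degree three. -/
theorem not_isBranchActive_of_tails {S : Finset V} (hbr : IsBranchResolving G S) {C : Cycle G}
    {u : V} (hu : u ∈ C.1.verts)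
    (h : ∀ w, G.Adj u w → ¬ C.1.Adj u w → (∀ s ∈ S, s ∉ branch G u w) ∧
      ∃ l, IsTail G u (l ++ [w]) ∧ ∀ x, x ∈ l ++ [w] ↔ x ∈ branch G u w) :
    ¬ C.IsBranchActive u := by
  rintro ⟨-, h4 | ⟨x, hx, hxu, hx3⟩⟩
  · obtain ⟨w, w', hne, ⟨hw, hwC⟩, hw', hwC'⟩ := Cycle.exists_two_nbrs_of_four_le_degree hu h4
    obtain ⟨f1, t1⟩ := h w hw hwC
    obtain ⟨f2, t2⟩ := h w' hw' hwC'
    exact hne (eq_of_free_tails hbr (by omega) t1 t2 f1 f2)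
  · obtain ⟨w, hw, hw', hxw⟩ := Cycle.exists_branch hx hxu
    obtain ⟨-, l, hl, hl'⟩ := h w hw hw'
    have := hl.degree_le ((hl' x).2 hxw)
    omega

/-- Induction on the size of the branch. If `vz` lay on a cycle, the other vertices of that cycle
would carry only smaller landmark-free branches, which are tails; none of them would be active or
branch-active, against weak biactivity. So `vz` is a bridge. Beyond it `z` has at most one further
neighbour, since two would start two free threads at `z`, and the branch towards that neighbour is a
tail by induction. -/
theorem exists_tail_of_branch (hG : IsCactus G) {S : Finset V} (hbr : IsBranchResolving G S)
    (hS : IsWeaklyBiactive G S) {v z : V} (hvz : G.Adj v z) (hfree : ∀ s ∈ S, s ∉ branch G v z) :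
    OffCycles G v z ∧ ∃ l, IsTail G v (l ++ [z]) ∧ ∀ x, x ∈ l ++ [z] ↔ x ∈ branch G v z := by
  classical
  induction hn : (branch G v z).ncard using Nat.strong_induction_on generalizing v z with
  | _ n ih =>
  subst hn
  have hoff : OffCycles G v z := by
    intro C hC
    have hsub : ∀ u ∈ C.1.verts, u ≠ v → ∀ w, G.Adj u w → ¬ C.1.Adj u w →
        branch G u w ⊆ branch G v z ∧ (branch G u w).ncard < (branch G v z).ncard := by
      intro u hu huv w hw hw'
      have hub := Cycle.mem_branch hC hu huv
      have h1 : v ∉ branch G u w := fun h =>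
        huv (hG.eq_of_mem_comp hu hC.fst_mem (hG.branch_subset_comp hu hw hw' h)).symm
      have hwv : w ≠ v := fun h => h1 (h ▸ mem_branch_self hw.ne')
      have h2 := branch_subset h1 (mem_branch_of_adj hub hw hwv)
      refine ⟨h2, Set.ncard_lt_ncard ⟨h2, fun h => ?_⟩ (Set.toFinite _)⟩
      exact ne_of_mem_branch (h hub) rfl
    have hinact : ∀ u ∈ C.1.verts, u ≠ v → ¬ C.IsActive S u := by
      rintro u hu huv ⟨-, s, hs, hsu⟩
      by_cases hsu' : s = u
      · subst hsu'; exact hfree s hs (Cycle.mem_branch hC hu huv)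
      · obtain ⟨w, hw, hw', hsw⟩ := Cycle.exists_branch hsu hsu'
        exact hfree s hs ((hsub u hu huv w hw hw').1 hsw)
    have hnba : ∀ u ∈ C.1.verts, u ≠ v → ¬ C.IsBranchActive u := by
      intro u hu huv
      refine not_isBranchActive_of_tails hbr hu fun w hw hw' => ?_
      obtain ⟨hs1, hl1⟩ := hsub u hu huv w hw hw'
      have f1 : ∀ s ∈ S, s ∉ branch G u w := fun s hs h => hfree s hs (hs1 h)
      exact ⟨f1, (ih _ hl1 hw f1 rfl).2⟩
    have h2 := hS C
    have : {u | C.IsBranchActive u ∨ C.IsActive S u} ⊆ {v} := by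
      rintro u hu
      by_contra huv
      rcases hu with hu | hu
      · exact hnba u hu.1 huv hu
      · exact hinact u hu.1 huv hu
    have := Set.ncard_le_ncard this (Set.toFinite _)
    rw [Set.ncard_singleton] at this
    omega
  refine ⟨hoff, ?_⟩
  have hsub : ∀ w, G.Adj z w → w ≠ v → v ∉ branch G z w ∧ branch G z w ⊆ branch G v z ∧
      (branch G z w).ncard < (branch G v z).ncard := by
    intro w hw hwv
    have hwb := mem_branch_of_adj (mem_branch_self hvz.ne') hw hwv
    have h1 : v ∉ branch G z w := fun h => hoff.not_mem_branch hvz hwb (branch_symm h)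
    have h2 := branch_subset h1 hwb
    refine ⟨h1, h2, Set.ncard_lt_ncard ⟨h2, fun h => ?_⟩ (Set.toFinite _)⟩
    exact ne_of_mem_branch (h (mem_branch_self hvz.ne')) rfl
  by_cases hw : ∃ w, G.Adj z w ∧ w ≠ v
  · obtain ⟨w, hw, hwv⟩ := hw
    obtain ⟨hv1, hs1, hl1⟩ := hsub w hw hwv
    have f1 : ∀ s ∈ S, s ∉ branch G z w := fun s hs h => hfree s hs (hs1 h)
    obtain ⟨-, hT⟩ := ih _ hl1 hw f1 rfl
    have honly : ∀ x, G.Adj z x → x = v ∨ x = w := by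
      intro x hx
      by_contra! hne
      obtain ⟨-, hs2, hl2⟩ := hsub x hx hne.1
      have f2 : ∀ s ∈ S, s ∉ branch G z x := fun s hs h => hfree s hs (hs2 h)
      exact hne.2 (eq_of_free_tails hbr
        (three_le_degree hvz.symm hw hx hwv.symm hne.1.symm hne.2.symm)
        (ih _ hl2 hx f2 rfl).2 hT f2 f1)
    have hdeg : G.degree z = 2 := by
      apply le_antisymm
      · have := degree_le_card (G := G) (v := z) {v, w} (by simpa using honly)
        exact this.trans Finset.card_le_two
      · exact two_le_degree hvz.symm hw hwv.symm
    obtain ⟨l, ⟨hnd, hch, u, t, hut, hu, ht⟩, hmem⟩ := hT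
    refine ⟨l ++ [w], ⟨?_, ?_, u, t ++ [z], by rw [hut]; simp, hu, ?_⟩, ?_⟩
    · rw [List.nodup_append]
      refine ⟨hnd, by simp, ?_⟩
      rintro a ha b hb rfl
      rw [List.mem_singleton] at hb
      subst hb
      exact ne_of_mem_branch ((hmem a).1 ha) rfl
    · rw [List.isChain_append]
      exact ⟨hch, by simp, by simp [hvz.symm]⟩
    · intro x hx
      rw [List.mem_append, List.mem_singleton] at hx
      rcases hx with hx | rfl
      · exact ht x hx
      · exact hdeg
    · intro x
      rw [List.mem_append, hmem, List.mem_singleton]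
      constructor
      · rintro (h | rfl)
        · exact hs1 h
        · exact mem_branch_self hvz.ne'
      · intro hx
        refine branch_induction (P := fun x => x ∈ branch G z w ∨ x = z) (Or.inr rfl) ?_ hx
        rintro a b - (ha | rfl) hab hb
        · by_cases hbz : b = z
          · exact Or.inr hbz
          · exact Or.inl (mem_branch_of_adj ha hab hbz)
        · rcases honly b hab with h | rfl
          · exact absurd h hb
          · exact Or.inl (mem_branch_self hab.ne')
  · push Not at hw
    refine ⟨[], ⟨by simp, by simp [hvz.symm], z, [], rfl, ?_, by simp⟩, ?_⟩
    · apply le_antisymm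
      · exact degree_le_card (G := G) (v := z) {v} (by simpa using hw)
      · have := card_le_degree (G := G) (v := z) {v} (by simpa using hvz.symm)
        simpa using this
    · intro x
      rw [List.nil_append, List.mem_singleton]
      constructor
      · rintro rfl; exact mem_branch_self hvz.ne'
      · intro hx
        refine branch_induction (P := fun x => x = z) rfl ?_ hx
        rintro a b - rfl hab hb
        exact absurd (hw b hab) hb

end Cactus

/-! ### Windows of active vertices and geodesic triples. -/

namespace Cactus

open SimpleGraph

section Param

variable {V : Type*} {G : SimpleGraph V} {C : Cycle G} {S : Finset V}

theorem IsCactus.isActive_iff (hG : IsCactus G) {v : V} :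
    C.IsActive S v ↔ ∃ s ∈ S, C.root s = v := by
  constructor
  · rintro ⟨hv, s, hs, h⟩
    exact ⟨s, hs, (hG.mem_comp_iff hv).1 h⟩
  · rintro ⟨s, hs, rfl⟩
    exact ⟨hG.root_mem C s, s, hs, hG.mem_comp_root C s⟩

/-! ### Canonical labellings and `S`-paths -/

/-- In the parametrization `c` all `S`-active vertices are among `c 0, …, c k`. -/
def ActiveWithin (C : Cycle G) (S : Finset V) (c : ℤ → V) (k : ℕ) : Prop :=
  ∀ v, C.IsActive S v → ∃ j : ℤ, 0 ≤ j ∧ j ≤ k ∧ c j = v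

theorem ActiveWithin.reflect {c : ℤ → V} {k : ℕ} (h : ActiveWithin C S c k) :
    ActiveWithin C S (fun i => c (k - i)) k := by
  intro v hv
  obtain ⟨j, h0, h1, rfl⟩ := h v hv
  exact ⟨k - j, by omega, by omega, by simp⟩

theorem Param.dist_le_of_le {c : ℤ → V} (hc : Param C c) {k : ℕ} {a b : ℤ}
    (ha : 0 ≤ a) (hak : a ≤ k) (hb : 0 ≤ b) (hbk : b ≤ k) : G.dist (c a) (c b) ≤ k := by
  wlog hab : a ≤ b generalizing a b
  · rw [dist_comm]; exact this hb hbk ha hak (by omega)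
  obtain ⟨p, hp, -⟩ := hc.exists_arc a (b - a).toNat
  have := dist_le p
  rw [hp, show a + ((b - a).toNat : ℤ) = b by omega] at this
  omega

/-- For `2k ≤ g` the two active ends are at distance `k`, while a labelling with largest active
index `k'` keeps all active vertices within distance `k'` of each other. -/
theorem IsCactus.isCanonical_of_short (hG : IsCactus G) {c : ℤ → V} (hc : Param C c) {k : ℕ}
    (h0 : C.IsActive S (c 0)) (hk : C.IsActive S (c k)) (hall : ActiveWithin C S c k)
    (hkn : 2 * k ≤ C.len) :
    ∃ lab : Labelling C, (∀ i : ℕ, i ≤ C.len → lab.vert i = c i) ∧ lab.IsCanonical S k := by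
  have h3 := C.three_le_len
  obtain ⟨lab, hlab⟩ := hc.exists_labelling
  refine ⟨lab, hlab, ⟨?_, ⟨?_, ?_⟩, ?_⟩, ?_⟩
  · rw [hlab 0 (by omega)]; exact h0
  · omega
  · rw [hlab k (by omega)]; exact hk
  · rintro i ⟨hi, hact⟩
    rw [hlab i hi.le] at hact
    obtain ⟨j, hj0, hjk, hj⟩ := hall _ hact
    have := hc.inj hj (by omega) (by omega)
    omega
  · rintro lab' k' ⟨-, ⟨hk'n, -⟩, hub⟩
    obtain ⟨c', hc', hc'lab⟩ := lab'.exists_param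
    have hrep : ∀ v, C.IsActive S v → ∃ a : ℤ, 0 ≤ a ∧ a ≤ k' ∧ c' a = v := by
      intro v hv
      obtain ⟨a, ha0, ha1, rfl⟩ := hc'.exists_rep 0 hv.1
      refine ⟨a, ha0, ?_, rfl⟩
      have : a.toNat ≤ k' := by
        refine hub ⟨by omega, ?_⟩
        rw [← hc'lab _ (by omega), Int.toNat_of_nonneg ha0]
        exact hv
      omega
    obtain ⟨a, ha0, ha1, ha⟩ := hrep _ h0
    obtain ⟨b, hb0, hb1, hb⟩ := hrep _ hk
    have h1 := hc'.dist_le_of_le ha0 ha1 hb0 hb1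
    have h2 := hG.dist_param hc (i := 0) (j := k) (by omega) (by omega)
    rw [ha, hb] at h1
    omega

theorem dist_le_length_of_mem {x y a b : V} {p : G.Walk a b} (hx : x ∈ p.support)
    (hy : y ∈ p.support) : G.dist x y ≤ p.length := by
  classical
  have h := congrArg Walk.length (p.take_spec hx)
  rw [Walk.length_append] at h
  have hy' := hy
  rw [← p.take_spec hx, Walk.mem_support_append_iff] at hy'
  rcases hy' with hy' | hy'
  · have h1 := dist_le ((p.takeUntil x hx).dropUntil y hy')
    have h2 := congrArg Walk.length ((p.takeUntil x hx).take_spec hy')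
    rw [Walk.length_append] at h2
    rw [dist_comm]; omega
  · have h1 := dist_le ((p.dropUntil x hx).takeUntil y hy')
    have h2 := congrArg Walk.length ((p.dropUntil x hx).take_spec hy')
    rw [Walk.length_append] at h2
    omega

theorem IsCactus.isCritical_of_short (hG : IsCactus G) {κ : Kind} {c : ℤ → V} (hc : Param C c)
    {k : ℕ} (h0 : C.IsActive S (c 0)) (hk : C.IsActive S (c k)) (hall : ActiveWithin C S c k)
    (hkn : k ≤ κ.critBound C.len) : C.IsCritical κ S (c 0) := by
  have h3 := C.three_le_len
  have hkn' : 2 * k ≤ C.len := by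
    cases κ <;> simp only [Kind.critBound] at hkn <;> omega
  obtain ⟨p, hp, hpv⟩ := hc.exists_arc 0 k
  refine ⟨_, p, ⟨⟨?_, ?_, ?_⟩, ?_⟩, by omega⟩
  · rw [← Walk.IsPath.getVert_injOn_iff]
    intro i hi j hj h
    simp only [Set.mem_ofPred_eq] at hi hj
    rw [hpv _ (by omega), hpv _ (by omega)] at h
    have := hc.inj h (by omega) (by omega)
    omega
  · refine ⟨?_, ?_⟩
    · intro v hv
      rw [Walk.mem_verts_toSubgraph, Walk.mem_support_iff_exists_getVert] at hv
      obtain ⟨i, rfl, hi⟩ := hv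
      rw [hpv _ (by omega)]; exact hc.mem _
    · intro x y hxy
      rw [Walk.toSubgraph_adj_iff] at hxy
      obtain ⟨i, h, hi⟩ := hxy
      rw [hpv _ (by omega), hpv _ (by omega), Sym2.eq_iff] at h
      have := hc.adj_succ (0 + i)
      push_cast at h
      rw [← add_assoc] at h
      rcases h with ⟨rfl, rfl⟩ | ⟨rfl, rfl⟩
      · exact this
      · exact this.symm
  · intro v hv
    obtain ⟨j, hj0, hjk, rfl⟩ := hall v hv
    rw [Walk.mem_support_iff_exists_getVert]
    exact ⟨j.toNat, by rw [hpv _ (by omega)]; congr 1; omega, by omega⟩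
  · intro a b q hq
    have h1 := dist_le_length_of_mem (hq.2.2 _ h0) (hq.2.2 _ hk)
    have h2 := hG.dist_param hc (i := 0) (j := k) (by omega) (by omega)
    omega

theorem Cycle.IsCritical.exists_param {κ : Kind} {v : V} (h : C.IsCritical κ S v) :
    ∃ c k, Param C c ∧ c 0 = v ∧ ActiveWithin C S c k ∧ k ≤ κ.critBound C.len := by
  obtain ⟨b, p, ⟨⟨hp, hpC, hcov⟩, -⟩, hlen⟩ := h
  obtain ⟨c, hc, hcp⟩ := Cycle.exists_param_path hp hpC
  refine ⟨c, p.length, hc, ?_, ?_, hlen⟩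
  · have := hcp 0 (by omega)
    simpa using this.symm
  · intro w hw
    obtain ⟨t, rfl, ht⟩ := Walk.mem_support_iff_exists_getVert.1 (hcov w hw)
    exact ⟨t, by omega, by omega, (hcp t ht).symm⟩

theorem Cycle.exists_isCanonical (h : 1 ≤ C.numActive S) :
    ∃ (lab : Labelling C) (k : ℕ), lab.IsCanonical S k := by
  classical
  have h3 := C.three_le_len
  have hex : ∃ k, ∃ lab : Labelling C, lab.HasMaxActive S k := by
    have hne : {v | C.IsActive S v}.Nonempty := by
      apply Set.nonempty_of_ncard_ne_zero
      unfold Cycle.numActive at h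
      omega
    obtain ⟨v, hv⟩ := hne
    obtain ⟨c, hc, rfl⟩ := Cycle.exists_param_zero hv.1
    obtain ⟨lab, hlab⟩ := hc.exists_labelling
    have h0 : C.IsActive S (lab.vert 0) := by rw [hlab 0 (by omega)]; exact hv
    have hfin : {i | i < C.len ∧ C.IsActive S (lab.vert i)}.Finite :=
      (Set.finite_lt_nat C.len).subset fun i hi => hi.1
    obtain ⟨k, hk⟩ := hfin.exists_maximal ⟨0, by omega, h0⟩
    exact ⟨k, lab, h0, hk.1, fun i hi => by
      by_contra hlt
      exact hlt (hk.2 hi (by omega))⟩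
  obtain ⟨lab, hlab⟩ := Nat.find_spec hex
  exact ⟨lab, _, hlab, fun lab' k' h' => Nat.find_min' hex ⟨lab', h'⟩⟩

theorem Labelling.IsCanonical.exists_param {lab : Labelling C} {k : ℕ} (h : lab.IsCanonical S k) :
    ∃ c, Param C c ∧ (∀ i : ℕ, i ≤ C.len → lab.vert i = c i) ∧ k < C.len ∧ C.IsActive S (c 0) ∧
      C.IsActive S (c k) ∧ ActiveWithin C S c k := by
  obtain ⟨⟨h0, ⟨hk, hkact⟩, hub⟩, -⟩ := h
  obtain ⟨c, hc, hlab⟩ := lab.exists_param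
  refine ⟨c, hc, fun i hi => (hlab i hi).symm, hk, ?_, ?_, ?_⟩
  · have := hlab 0 (by omega)
    rw [Nat.cast_zero] at this
    rwa [this]
  · rwa [hlab k hk.le]
  · intro v hv
    obtain ⟨a, ha0, ha1, rfl⟩ := hc.exists_rep 0 hv.1
    refine ⟨a, ha0, ?_, rfl⟩
    have : a.toNat ≤ k := by
      refine hub ⟨by omega, ?_⟩
      rw [← hlab _ (by omega), Int.toNat_of_nonneg ha0]
      exact hv
    omega

theorem Labelling.IsCanonical.le {lab : Labelling C} {k : ℕ} (h : lab.IsCanonical S k)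
    {c : ℤ → V} (hc : Param C c) {k' : ℕ} (h0 : C.IsActive S (c 0))
    (hall : ActiveWithin C S c k') : k ≤ k' := by
  have h3 := C.three_le_len
  by_cases hlt : C.len ≤ k'
  · have := h.1.2.1.1; omega
  obtain ⟨lab', hlab'⟩ := hc.exists_labelling
  have hfin : {i | i < C.len ∧ C.IsActive S (lab'.vert i)}.Finite :=
    (Set.finite_lt_nat C.len).subset fun i hi => hi.1
  have h0' : C.IsActive S (lab'.vert 0) := by rw [hlab' 0 (by omega)]; exact h0
  obtain ⟨m, hm⟩ := hfin.exists_maximal ⟨0, by omega, h0'⟩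
  refine (h.2 lab' m ⟨h0', hm.1, fun i hi => ?_⟩).trans ?_
  · by_contra hlt
    exact hlt (hm.2 hi (by omega))
  · have := hm.1.2
    have hlt' := hm.1.1
    rw [hlab' m hlt'.le] at this
    obtain ⟨j, hj0, hjk, hj⟩ := hall _ this
    have := hc.inj hj (by omega) (by omega)
    omega

theorem Cycle.eq_or_eq_of_numActive (h : C.numActive S = 2) {a b : V} (ha : C.IsActive S a)
    (hb : C.IsActive S b) (hab : a ≠ b) {v : V} (hv : C.IsActive S v) : v = a ∨ v = b := by
  obtain ⟨x, y, hxy, hset⟩ := Set.ncard_eq_two.1 h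
  have hmem : ∀ w, C.IsActive S w → w = x ∨ w = y := fun w hw => by
    have : w ∈ {v | C.IsActive S v} := hw
    rw [hset] at this
    simpa using this
  rcases hmem a ha with rfl | rfl <;> rcases hmem b hb with rfl | rfl <;>
    rcases hmem v hv with rfl | rfl <;> tauto

theorem Cycle.exists_active_ne (h : 2 ≤ C.numActive S) (v : V) :
    ∃ u, C.IsActive S u ∧ u ≠ v :=
  Set.exists_ne_of_one_lt_ncard (s := {v | C.IsActive S v}) h v

theorem Labelling.IsCanonical.pos {lab : Labelling C} {k : ℕ} (h : lab.IsCanonical S k)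
    (h2 : 2 ≤ C.numActive S) : 0 < k := by
  obtain ⟨c, hc, -, -, h0, -, hall⟩ := h.exists_param
  obtain ⟨u, hu, hne⟩ := Cycle.exists_active_ne h2 (c 0)
  obtain ⟨j, hj0, hjk, rfl⟩ := hall u hu
  rcases hj0.eq_or_lt with rfl | hj0
  · exact absurd rfl hne
  · omega

/-- Starting at the other active vertex gives the complementary arc, of length `g - k`. -/
theorem Labelling.IsCanonical.two_mul_le {lab : Labelling C} {k : ℕ} (h : lab.IsCanonical S k)
    (h2 : C.numActive S = 2) : 2 * k ≤ C.len := by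
  have hpos := h.pos h2.ge
  obtain ⟨c, hc, -, hkn, h0, hk, hall⟩ := h.exists_param
  have hne : c 0 ≠ c k := fun e => by
    have := hc.inj e (by omega) (by omega)
    omega
  have := h.le (hc.shift k) (k' := C.len - k) (by simpa using hk) (by
    intro v hv
    rcases Cycle.eq_or_eq_of_numActive h2 h0 hk hne hv with rfl | rfl
    · refine ⟨C.len - k, by omega, by omega, ?_⟩
      beta_reduce
      rw [show (k : ℤ) + (C.len - k) = 0 + C.len by ring, hc.add_len]
    · exact ⟨0, le_rfl, by omega, by simp⟩)
  omega

/-- Three active vertices that cut the cycle into three geodesics. -/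
def HasGeodesicTriple (C : Cycle G) (S : Finset V) : Prop :=
  ∃ (c : ℤ → V) (p q : ℤ), Param C c ∧ C.IsActive S (c 0) ∧ C.IsActive S (c p) ∧
    C.IsActive S (c q) ∧ 0 < p ∧ p < q ∧ q < C.len ∧ 2 * p ≤ C.len ∧ 2 * (q - p) ≤ C.len ∧
    2 * (C.len - q) ≤ C.len

/-- Let `l` be the last active index up to `g/2` and `l'` the first one beyond. Restarting the
labelling at `l'` and using minimality of `k` gives `l' - l ≤ g - k < g/2`. The triple is `0, l, k`
if `k - l ≤ g/2`, and `l, l', k` otherwise. -/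
theorem Labelling.IsCanonical.hasGeodesicTriple {lab : Labelling C} {k : ℕ}
    (h : lab.IsCanonical S k) (hk : C.len < 2 * k) : HasGeodesicTriple C S := by
  obtain ⟨c, hc, -, hkn, h0, hkact, hall⟩ := h.exists_param
  let A : Set ℕ := {i | C.IsActive S (c i)}
  obtain ⟨l, ⟨(hl : C.IsActive S (c l)), hln⟩, hlmax⟩ :
      ∃ l, IsGreatest {i | i ∈ A ∧ 2 * i ≤ C.len} l := by
    have hfin : {i | i ∈ A ∧ 2 * i ≤ C.len}.Finite :=
      (Set.finite_le_nat C.len).subset fun i hi => by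
        have := hi.2
        simp only [Set.mem_ofPred_eq]; omega
    obtain ⟨l, hl⟩ := hfin.exists_maximal ⟨0, by simpa [A] using h0, by omega⟩
    exact ⟨l, hl.1, fun i hi => by by_contra hlt; exact hlt (hl.2 hi (by omega))⟩
  obtain ⟨l', ⟨(hl' : C.IsActive S (c l')), hl'n⟩, hl'min⟩ :
      ∃ l', IsLeast {i | i ∈ A ∧ C.len < 2 * i} l' := by
    classical
    have hex : ∃ i, i ∈ A ∧ C.len < 2 * i := ⟨k, hkact, hk⟩
    exact ⟨Nat.find hex, Nat.find_spec hex, fun i hi => Nat.find_min' hex hi⟩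
  have hl'k : l' ≤ k := hl'min ⟨hkact, hk⟩
  have hgap : k ≤ C.len - (l' - l) := by
    refine h.le (hc.shift l') (by simpa using hl') ?_
    intro v hv
    obtain ⟨j, hj0, hjk, rfl⟩ := hall v hv
    lift j to ℕ using hj0
    by_cases hj : 2 * j ≤ C.len
    · have := hlmax ⟨hv, hj⟩
      refine ⟨j - l' + C.len, by omega, by omega, ?_⟩
      simp only
      rw [← add_assoc, hc.add_len]
      congr 1; omega
    · have := hl'min ⟨hv, by omega⟩
      exact ⟨j - l', by omega, by omega, by simp⟩
  have hl0 : 0 < l := by omega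
  by_cases hkl : 2 * (k - l) ≤ C.len
  · exact ⟨c, l, k, hc, h0, hl, hkact, by omega, by omega, by omega, by omega, by omega, by omega⟩
  · refine ⟨_, l' - l, k - l, hc.shift l, by simpa using hl, by simpa using hl',
      by simpa using hkact, by omega, by omega, by omega, by omega, by omega, by omega⟩

/-- The pairwise distances of the triple add up to `g`. For three vertices in a window shorter than
`g/2` the sum is twice the largest distance, hence less than `g`. -/
theorem HasGeodesicTriple.not_isCritical (hG : IsCactus G) {κ : Kind}
    (h : HasGeodesicTriple C S) (v : V) : ¬ C.IsCritical κ S v := by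
  intro hcrit
  obtain ⟨c, p, q, hc, h0, hp, hq, hp0, hpq, hqn, h1, h2, h3⟩ := h
  obtain ⟨c', k, hc', -, hall, hk⟩ := hcrit.exists_param
  have h3' := C.three_le_len
  have hk' : 2 * k < C.len := by
    cases κ <;> simp only [Kind.critBound] at hk <;> omega
  obtain ⟨x, hx0, hxk, hx⟩ := hall _ h0
  obtain ⟨y, hy0, hyk, hy⟩ := hall _ hp
  obtain ⟨z, hz0, hzk, hz⟩ := hall _ hq
  have e1 := hG.dist_param hc (i := 0) (j := p) (by omega) (by omega)
  have e2 := hG.dist_param hc (i := p) (j := q) (by omega) (by omega)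
  have e3 := hG.dist_param hc (i := 0) (j := q) (by omega) (by omega)
  rw [← hx, ← hy] at e1
  rw [← hy, ← hz] at e2
  rw [← hx, ← hz] at e3
  have key : ∀ {a b : ℤ}, 0 ≤ a → a ≤ k → 0 ≤ b → b ≤ k →
      (G.dist (c' a) (c' b) : ℤ) = max (b - a) (a - b) := by
    intro a b ha hak hb hbk
    rcases le_total a b with hab | hab
    · rw [hG.dist_param hc' hab (by omega)]; omega
    · rw [dist_comm, hG.dist_param hc' hab (by omega)]; omega
  rw [key hx0 hxk hy0 hyk] at e1
  rw [key hy0 hyk hz0 hzk] at e2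
  rw [key hx0 hxk hz0 hzk] at e3
  omega

theorem HasGeodesicTriple.three_le_numActive [Finite V] (h : HasGeodesicTriple C S) :
    3 ≤ C.numActive S := by
  classical
  obtain ⟨c, p, q, hc, h0, hp, hq, hp0, hpq, hqn, h1, h2, h3⟩ := h
  have hsub : (({c 0, c p, c q} : Finset V) : Set V) ⊆ {v | C.IsActive S v} := by
    intro v hv
    simp only [Finset.coe_insert, Finset.coe_singleton, Set.mem_insert_iff,
      Set.mem_singleton_iff] at hv
    rcases hv with rfl | rfl | rfl <;> assumption
  have := Set.ncard_le_ncard hsub (Set.toFinite _)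
  rw [Set.ncard_coe_finset, Finset.card_eq_three.2 ⟨c 0, c p, c q, ?_, ?_, ?_, rfl⟩] at this
  · exact this
  all_goals
    intro e
    have := hc.inj e (by omega) (by omega)
    omega

end Param

end Cactus

/-! ### Shadows, the common obstruction to both kinds of generators. -/

namespace Cactus

open SimpleGraph

section Shadow

variable {V : Type*} {G : SimpleGraph V} {C : Cycle G} {S : Finset V} {κ : Kind}

/-- How far the neighbour of a vertex at distance `a` has to be to count as a shadow. -/
def Kind.Beyond : Kind → ℕ → ℕ → Prop
  | .vertex, a, b => b = a + 1
  | .edge, a, b => a ≤ b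

/-- The neighbour `y` of `v` lies behind `v` as seen from every element of `S`. -/
def IsShadow (G : SimpleGraph V) (κ : Kind) (S : Finset V) (v y : V) : Prop :=
  G.Adj v y ∧ ∀ s ∈ S, κ.Beyond (G.dist s v) (G.dist s y)

/-- Every vertex has at most one shadow. -/
def HasUniqueShadows (G : SimpleGraph V) (κ : Kind) (S : Finset V) : Prop :=
  ∀ v y y', IsShadow G κ S v y → IsShadow G κ S v y' → y = y'

theorem Kind.beyond_succ (κ : Kind) (a : ℕ) : κ.Beyond a (a + 1) := by
  cases κ <;> simp [Kind.Beyond]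

theorem Kind.Beyond.le {κ : Kind} {a b : ℕ} (h : κ.Beyond a b) : a ≤ b := by
  cases κ <;> simp only [Kind.Beyond] at h <;> omega

theorem Kind.critBound_lt (κ : Kind) (C : Cycle G) : 2 * κ.critBound C.len < C.len := by
  have := C.three_le_len
  cases κ <;> simp only [Kind.critBound] <;> omega

theorem isShadow_of_branch (hconn : G.Connected) {v z : V} (hvz : G.Adj v z)
    (hfree : ∀ s ∈ S, s ∉ branch G v z) : IsShadow G κ S v z := by
  refine ⟨hvz, fun s hs => ?_⟩
  rw [dist_eq_of_mem_branch hconn (hfree s hs) (mem_branch_self hvz.ne'),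
    dist_eq_one_iff_adj.2 hvz]
  exact κ.beyond_succ _

theorem IsShadow.not_mem_branch (hconn : G.Connected) {v y : V} (h : IsShadow G κ S v y)
    (hoff : OffCycles G v y) : ∀ s ∈ S, s ∉ branch G v y := by
  intro s hs hsb
  have h1 := dist_eq_of_mem_branch hconn (hoff.not_mem_branch h.1 hsb) (mem_branch_self h.1.ne)
  rw [dist_eq_one_iff_adj.2 h.1.symm] at h1
  have := (h.2 s hs).le
  omega

/-- The value of `critBound` is the exact threshold: stepping from `c 0` back to `c (-1)` increases
the distance from `c j` iff `j ≤ ⌊g/2⌋ - 1`, and does not decrease it iff `j ≤ ⌈g/2⌉ - 1`, for `0 ≤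
j < g`. -/
theorem IsCactus.isShadow_of_activeWithin (hG : IsCactus G) {c : ℤ → V} (hc : Param C c) {k : ℕ}
    (hall : ActiveWithin C S c k) (hk : k ≤ κ.critBound C.len) :
    IsShadow G κ S (c 0) (c (-1)) := by
  have h3 := C.three_le_len
  refine ⟨(hc.adj_pred 0).adj_sub, fun s hs => ?_⟩
  obtain ⟨j, hj0, hjk, hj⟩ := hall (C.root s) (hG.isActive_iff.2 ⟨s, hs, rfl⟩)
  have hb := κ.critBound_lt C
  rw [hG.dist_eq_of_mem (s := s) (hc.mem 0), hG.dist_eq_of_mem (s := s) (hc.mem (-1)), ← hj]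
  have h1 := hG.dist_param hc (i := 0) (j := j) (by omega) (by omega)
  have h2 := hG.dist_param hc (i := -1) (j := j) (by omega) (by omega)
  rw [dist_comm (u := c j), dist_comm (u := c j)]
  cases κ <;> simp only [Kind.Beyond, Kind.critBound] at hk ⊢ <;> omega

/-- These index ranges are those of ℬ and 𝒟. From `c i` all active vertices lie in a short window on
one side, so the cycle neighbour on the other side is a shadow: `c (i + 1)` in the first range, `c
(i - 1)` in the other two. -/
theorem IsCactus.exists_isShadow (hG : IsCactus G) {c : ℤ → V} (hc : Param C c) {k : ℕ}
    (hall : ActiveWithin C S c k) (hk : k ≤ κ.critBound C.len) {i : ℕ}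
    (hi : (k ≤ i ∧ i ≤ κ.critBound C.len) ∨
      (C.len + k ≤ i + κ.critBound C.len ∧ i < C.len) ∨ i = 0) :
    ∃ y, C.1.Adj (c i) y ∧ IsShadow G κ S (c i) y := by
  rcases hi with hi | hi | rfl
  · have := hG.isShadow_of_activeWithin (κ := κ) (S := S) (hc.reflect i) (k := i) (by
      intro v hv
      obtain ⟨j, hj0, hjk, rfl⟩ := hall v hv
      exact ⟨i - j, by omega, by omega, by simp⟩) hi.2
    exact ⟨_, hc.adj_succ i, by simpa using this⟩
  · have := hG.isShadow_of_activeWithin (κ := κ) (S := S) (hc.shift i) (k := k + C.len - i) (by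
      intro v hv
      obtain ⟨j, hj0, hjk, rfl⟩ := hall v hv
      refine ⟨j + C.len - i, by omega, by omega, ?_⟩
      beta_reduce
      rw [show (i : ℤ) + (j + C.len - i) = j + C.len by ring, hc.add_len]) (by omega)
    exact ⟨_, hc.adj_pred i, by simpa [sub_eq_add_neg] using this⟩
  · exact ⟨_, hc.adj_pred 0, hG.isShadow_of_activeWithin hc hall hk⟩

/-- A shadow on a cycle confines the active vertices to one side of the cycle. -/
theorem IsShadow.activeWithin (hG : IsCactus G) {c : ℤ → V} (hc : Param C c)
    (h : IsShadow G κ S (c 0) (c (-1))) : ActiveWithin C S c (κ.critBound C.len) := by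
  have h3 := C.three_le_len
  intro v hv
  obtain ⟨s, hs, rfl⟩ := hG.isActive_iff.1 hv
  obtain ⟨j, hj0, hjk, hj⟩ := hc.exists_rep 0 (hG.root_mem C s)
  refine ⟨j, hj0, ?_, hj⟩
  have hbe := h.2 s hs
  rw [hG.dist_eq_of_mem (s := s) (hc.mem 0), hG.dist_eq_of_mem (s := s) (hc.mem (-1)), ← hj] at hbe
  have h1 := hG.dist_param hc (i := 0) (j := j) (by omega) (by omega)
  have h2 := hG.dist_param hc (i := -1) (j := j) (by omega) (by omega)
  rw [dist_comm (u := c j), dist_comm (u := c j)] at hbe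
  cases κ <;> simp only [Kind.Beyond, Kind.critBound] at hbe ⊢ <;> omega

theorem Cycle.IsCritical.exists_isShadow (hG : IsCactus G) {v : V} (h : C.IsCritical κ S v) :
    ∃ y, C.1.Adj v y ∧ IsShadow G κ S v y := by
  obtain ⟨c, k, hc, rfl, hall, hk⟩ := h.exists_param
  exact ⟨_, hc.adj_pred 0, hG.isShadow_of_activeWithin hc hall hk⟩

/-- The maximal index of an active vertex. -/
theorem ActiveWithin.exists_max {c : ℤ → V} {m : ℕ} (h : ActiveWithin C S c m)
    (h1 : ∃ v, C.IsActive S v) :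
    ∃ k : ℕ, k ≤ m ∧ C.IsActive S (c k) ∧ ActiveWithin C S c k := by
  have hfin : {i : ℕ | i ≤ m ∧ C.IsActive S (c i)}.Finite :=
    (Set.finite_le_nat m).subset fun i hi => hi.1
  obtain ⟨v, hv⟩ := h1
  obtain ⟨j, hj0, hjm, rfl⟩ := h v hv
  lift j to ℕ using hj0
  obtain ⟨k, hk⟩ := hfin.exists_maximal ⟨j, by omega, hv⟩
  refine ⟨k, hk.1.1, hk.1.2, fun w hw => ?_⟩
  obtain ⟨i, hi0, him, rfl⟩ := h w hw
  lift i to ℕ using hi0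
  refine ⟨i, by omega, ?_, rfl⟩
  by_contra hlt
  have := hk.2 (⟨by omega, hw⟩ : i ∈ {i : ℕ | i ≤ m ∧ C.IsActive S (c i)}) (by omega)
  omega

theorem IsShadow.isCritical (hG : IsCactus G) {v y : V} (h : IsShadow G κ S v y)
    (hvy : C.1.Adj v y) (hv : C.IsActive S v) : C.IsCritical κ S v := by
  obtain ⟨c, hc, rfl, rfl⟩ := Cycle.exists_param_adj hvy
  have hc' := hc.reflect 0
  have h' : IsShadow G κ S ((fun i => c (0 - i)) 0) ((fun i => c (0 - i)) (-1)) := by simpa using h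
  obtain ⟨k, hk, hkact, hall⟩ := (h'.activeWithin hG hc').exists_max ⟨_, hv⟩
  have := hG.isCritical_of_short (κ := κ) hc' (by simpa using hv) hkact hall hk
  simpa using this

/-- Shadows on both sides would confine the active vertices to two windows shorter than `g/2` that
meet only in `v`. -/
theorem not_isShadow_both (hG : IsCactus G) (h2 : 2 ≤ C.numActive S) {v y y' : V}
    (hy : C.1.Adj v y) (hy' : C.1.Adj v y') (h : IsShadow G κ S v y) (h' : IsShadow G κ S v y') :
    y = y' := by
  have h3 := C.three_le_len
  obtain ⟨c, hc, rfl, rfl⟩ := Cycle.exists_param_adj hy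
  rcases hc.adj_cases hy' with rfl | rfl
  · simp
  · exfalso
    have hA := h'.activeWithin hG hc
    have hB := IsShadow.activeWithin (κ := κ) (S := S) hG (hc.reflect 0) (by simpa using h)
    obtain ⟨u, hu, hne⟩ := Cycle.exists_active_ne h2 (c 0)
    have hb := κ.critBound_lt C
    obtain ⟨i, hi0, hi1, hi⟩ := hA u hu
    obtain ⟨j, hj0, hj1, hj⟩ := hB u hu
    have := hc.inj (hi.trans hj.symm) (by omega) (by omega)
    have : i = 0 := by omega
    subst this
    exact hne hi.symm

/-- `S` is a vertex or an edge metric generator. -/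
def IsGenerator [Fintype V] (G : SimpleGraph V) : Kind → Finset V → Prop
  | .vertex, S => IsVertexGenerator G S
  | .edge, S => IsEdgeGenerator G S

theorem edgeDist_mk [Fintype V] (s x y : V) :
    edgeDist G s s(x, y) = min (G.dist s x) (G.dist s y) := rfl

/-- In the vertex variant both shadows are at distance `d(s,v) + 1`; in the edge variant both edges
are at distance `d(s,v)`. -/
theorem IsGenerator.hasUniqueShadows [Fintype V] (h : IsGenerator G κ S) :
    HasUniqueShadows G κ S := by
  intro v y y' hy hy'
  by_contra hne
  cases κ with
  | vertex =>
    obtain ⟨s, hs, hd⟩ := h y y' hne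
    have h1 := hy.2 s hs
    have h2 := hy'.2 s hs
    simp only [Kind.Beyond] at h1 h2
    omega
  | edge =>
    obtain ⟨s, hs, hd⟩ := h s(v, y) (by simpa using hy.1) s(v, y') (by simpa using hy'.1)
      (by simpa [Sym2.eq_iff, hne] using fun h1 h2 => hne (h2.trans h1))
    have h1 := (hy.2 s hs).le
    have h2 := (hy'.2 s hs).le
    rw [edgeDist_mk, edgeDist_mk] at hd
    omega

/-- If at most one vertex of a cycle is active, both neighbours of that vertex on the cycle are
shadows. -/
theorem HasUniqueShadows.isBiactive [Finite V] (hG : IsCactus G) (h : HasUniqueShadows G κ S) :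
    IsBiactive G S := by
  intro C
  have h3 := C.three_le_len
  by_contra hlt
  have hex : ∃ v ∈ C.1.verts, ∀ w, C.IsActive S w → w = v := by
    have hle : {v | C.IsActive S v}.ncard ≤ 1 := by
      unfold Cycle.numActive at hlt; omega
    by_cases hne : ∃ v, C.IsActive S v
    · obtain ⟨v, hv⟩ := hne
      exact ⟨v, hv.1, fun w hw => (Set.ncard_le_one (Set.toFinite _)).1 hle w hw v hv⟩
    · obtain ⟨c, hc⟩ := C.exists_param
      exact ⟨c 0, hc.mem 0, fun w hw => absurd ⟨w, hw⟩ hne⟩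
  obtain ⟨v, hv, hall⟩ := hex
  obtain ⟨c, hc, rfl⟩ := Cycle.exists_param_zero hv
  have h1 : IsShadow G κ S (c 0) (c (-1)) := hG.isShadow_of_activeWithin hc (k := 0)
    (fun w hw => ⟨0, le_rfl, le_rfl, (hall w hw).symm⟩) (Nat.zero_le _)
  have h2 : IsShadow G κ S (c (0 - 0)) (c (0 - -1)) :=
    hG.isShadow_of_activeWithin (hc.reflect 0) (k := 0)
      (fun w hw => ⟨0, le_rfl, le_rfl, by simpa using (hall w hw).symm⟩) (Nat.zero_le _)
  have := hc.inj (h _ _ _ h1 (by simpa using h2)) (by omega) (by omega)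
  omega

theorem HasUniqueShadows.not_adj_criticalGraph (hG : IsCactus G) (h : HasUniqueShadows G κ S)
    (C D : Cycle G) : ¬ (criticalGraph G κ S).Adj C D := by
  rintro ⟨hne, v, hC, hD⟩
  obtain ⟨y, hy, hs⟩ := hC.exists_isShadow hG
  obtain ⟨y', hy', hs'⟩ := hD.exists_isShadow hG
  obtain rfl := h _ _ _ hs hs'
  exact hne (hG.eq_of_adj hy hy')

end Shadow

section Active

variable {V : Type*} [Fintype V] {G : SimpleGraph V} [DecidableRel G.Adj] {C : Cycle G}
  {S : Finset V} {κ : Kind}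

theorem tails_of_not_isActive (hG : IsCactus G) (hbr : IsBranchResolving G S)
    (hS : IsWeaklyBiactive G S) {v : V} (hv : v ∈ C.1.verts) (h : ¬ C.IsActive S v) {w : V}
    (hw : G.Adj v w) (hw' : ¬ C.1.Adj v w) : (∀ s ∈ S, s ∉ branch G v w) ∧
      ∃ l, IsTail G v (l ++ [w]) ∧ ∀ x, x ∈ l ++ [w] ↔ x ∈ branch G v w := by
  have hf : ∀ s ∈ S, s ∉ branch G v w := fun s hs hsb =>
    h ⟨hv, s, hs, hG.branch_subset_comp hv hw hw' hsb⟩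
  exact ⟨hf, (exists_tail_of_branch hG hbr hS hw hf).2⟩

/-- An inactive vertex carries only landmark-free tails. This makes branch-active vertices active
for every admissible set and reduces biactivity to the weak form. -/
theorem Cycle.IsBranchActive.isActive (hG : IsCactus G) (hbr : IsBranchResolving G S)
    (hS : IsWeaklyBiactive G S) {v : V} (h : C.IsBranchActive v) : C.IsActive S v := by
  by_contra hv
  exact not_isBranchActive_of_tails hbr h.1
    (fun w hw hw' => tails_of_not_isActive hG hbr hS h.1 hv hw hw') h

theorem IsWeaklyBiactive.isBiactive (hG : IsCactus G) (hbr : IsBranchResolving G S)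
    (hS : IsWeaklyBiactive G S) : IsBiactive G S := by
  intro C
  refine (hS C).trans (Set.ncard_le_ncard ?_ (Set.toFinite _))
  rintro v (hv | hv)
  · exact hv.isActive hG hbr hS
  · exact hv

theorem exists_freeThread_of_mem_comp (hG : IsCactus G) (hbr : IsBranchResolving G S)
    (hS : IsBiactive G S) {v : V} (hv : v ∈ C.1.verts) (h : ¬ C.IsActive S v) {x : V}
    (hx : x ∈ C.comp v) (hxv : x ≠ v) : ∃ l, IsFreeThread G S v l ∧ x ∈ l := by
  obtain ⟨z, hz, hz', hxz⟩ := Cycle.exists_branch hx hxv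
  obtain ⟨hf, l, hl, hl'⟩ := tails_of_not_isActive hG hbr hS.isWeaklyBiactive hv h hz hz'
  exact ⟨_, ⟨⟨Cycle.three_le_degree hv hz hz', hl⟩, fun y hy hyS => hf y hyS ((hl' y).1 hy)⟩,
    (hl' x).2 hxz⟩

theorem IsThread.exists_branch {v : V} {l : List V} (h : IsThread G v l) :
    ∃ z ∈ l, G.Adj v z ∧ ∀ x, x ∈ l ↔ x ∈ branch G v z := by
  obtain ⟨z, l', rfl, hz⟩ := (isThread_iff.1 h).2.exists_last h.not_mem
  exact ⟨z, by simp, hz, (isThread_iff.1 h).2.mem_iff_mem_branch h.not_mem⟩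

theorem IsThread.not_mem_verts {v : V} {l : List V} (h : IsThread G v l) {x : V} (hx : x ∈ l)
    (C : Cycle G) : x ∉ C.1.verts :=
  (isThread_iff.1 h).2.not_mem_verts h.not_mem C x hx

theorem IsFreeThread.dist_eq (hconn : G.Connected) {v : V} {l : List V}
    (h : IsFreeThread G S v l) {x s : V} (hx : x ∈ l) (hs : s ∈ S) :
    G.dist s x = G.dist s v + G.dist v x := by
  obtain ⟨z, -, -, hz⟩ := h.1.exists_branch
  exact dist_eq_of_mem_branch hconn (fun hsz => h.2 s ((hz s).2 hsz) hs) ((hz x).1 hx)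

theorem IsFreeThread.exists_isShadow (hconn : G.Connected) {v : V} {l : List V}
    (h : IsFreeThread G S v l) : ∃ z ∈ l, IsShadow G κ S v z := by
  obtain ⟨z, hz, hvz, hb⟩ := h.1.exists_branch
  exact ⟨z, hz, isShadow_of_branch hconn hvz fun s hs hsz => h.2 s ((hb s).2 hsz) hs⟩

/-! ### Good sets -/

/-- The common form of the configurations `ℬ` and `𝒟`. -/
def Labelling.ConfigThread (lab : Labelling C) (κ : Kind) (S : Finset V) (k : ℕ) : Prop :=
  k ≤ κ.critBound C.len ∧ ∃ i l, IsFreeThread G S (lab.vert i) l ∧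
    ((k ≤ i ∧ i ≤ κ.critBound C.len) ∨ (C.len + k ≤ i + κ.critBound C.len ∧ i < C.len) ∨ i = 0)

/-- The common form of the configurations `𝒞` and `ℰ`. -/
def Labelling.ConfigLong (lab : Labelling C) (S : Finset V) (k : ℕ) : Kind → Prop
  | .vertex => lab.ConfigC S k
  | .edge => lab.ConfigE S k

/-- Because `⌈g/2⌉ + ⌊g/2⌋ = g`, ℬ and 𝒟 differ only in the value of `critBound`. -/
theorem Cycle.containsConfig_iff : C.ContainsConfig κ S ↔
    ∃ (lab : Labelling C) (k : ℕ), lab.IsCanonical S k ∧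
      (lab.ConfigA S k ∨ lab.ConfigThread κ S k ∨ lab.ConfigLong S k κ) := by
  have h3 := C.three_le_len
  have hB : ∀ (lab : Labelling C) k, lab.ConfigB S k ↔ lab.ConfigThread .vertex S k := by
    intro lab k
    simp only [Labelling.ConfigB, Labelling.ConfigThread, Kind.critBound]
    refine and_congr Iff.rfl (exists_congr fun i => exists_congr fun l => and_congr Iff.rfl ?_)
    omega
  have hD : ∀ (lab : Labelling C) k, lab.ConfigD S k ↔ lab.ConfigThread .edge S k := by
    intro lab k
    simp only [Labelling.ConfigD, Labelling.ConfigThread, Kind.critBound]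
    refine and_congr Iff.rfl (exists_congr fun i => exists_congr fun l => and_congr Iff.rfl ?_)
    omega
  unfold Cycle.ContainsConfig
  cases κ <;> simp only [hB, hD, Labelling.ConfigLong]

/-- `S` is a biactive branch-resolving set without configurations and critical incidences. -/
def IsGood (G : SimpleGraph V) [DecidableRel G.Adj] (κ : Kind) (S : Finset V) : Prop :=
  (IsBiactive G S ∧ IsBranchResolving G S) ∧ (∀ C : Cycle G, ¬ C.ContainsConfig κ S) ∧
    ∀ C D, ¬ (criticalGraph G κ S).Adj C D

theorem HasUniqueShadows.isBranchResolving (hG : IsCactus G) (h : HasUniqueShadows G κ S) :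
    IsBranchResolving G S := by
  intro v l hl l' hl'
  obtain ⟨z, hz, hs⟩ := IsFreeThread.exists_isShadow (κ := κ) hG.1 hl
  obtain ⟨z', hz', hs'⟩ := IsFreeThread.exists_isShadow (κ := κ) hG.1 hl'
  obtain rfl := h _ _ _ hs hs'
  exact (hl.1.eq_of_mem hl'.1 hz hz').2

theorem HasUniqueShadows.not_configThread (hG : IsCactus G) (h : HasUniqueShadows G κ S)
    {lab : Labelling C} {k : ℕ} (hcan : lab.IsCanonical S k) : ¬ lab.ConfigThread κ S k := by
  rintro ⟨hk, i, l, hl, hi⟩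
  have h3 := C.three_le_len
  have hb := κ.critBound_lt C
  obtain ⟨c, hc, hlab, hkn, h0, hkact, hall⟩ := hcan.exists_param
  rw [hlab i (by omega)] at hl
  obtain ⟨y, hy, hs⟩ := hG.exists_isShadow hc hall hk hi
  obtain ⟨z, hz, hs'⟩ := IsFreeThread.exists_isShadow (κ := κ) hG.1 hl
  obtain rfl := h _ _ _ hs hs'
  exact hl.1.not_mem_verts hz C hy.snd_mem

end Active

end Cactus

/-! ### Every generator is good. -/

namespace Cactus

open SimpleGraph

variable {V : Type*} [Fintype V] {G : SimpleGraph V} {C : Cycle G} {S : Finset V} {κ : Kind}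

/-- A generator distinguishes the two ways round a cycle with two antipodal active vertices. -/
theorem IsGenerator.not_configA (hG : IsCactus G) (h : IsGenerator G κ S) {lab : Labelling C}
    {k : ℕ} (hcan : lab.IsCanonical S k) : ¬ lab.ConfigA S k := by
  rintro ⟨h2, ⟨m, hm⟩, hk⟩
  have h3 := C.three_le_len
  have hpos := hcan.pos h2.ge
  obtain ⟨c, hc, hlab, hkn, h0, hkact, hall⟩ := hcan.exists_param
  have hne : c 0 ≠ c k := fun e => by
    have := hc.inj e (by omega) (by omega)
    omega
  have hdist : ∀ s ∈ S, G.dist s (c 1) = G.dist s (c (-1)) := by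
    intro s hs
    rw [hG.dist_eq_of_mem (s := s) (hc.mem 1), hG.dist_eq_of_mem (s := s) (hc.mem (-1))]
    rcases Cycle.eq_or_eq_of_numActive h2 h0 hkact hne (hG.isActive_iff.2 ⟨s, hs, rfl⟩) with e | e
    · rw [e]
      have e1 := hG.dist_param hc (i := 0) (j := 1) (by omega) (by omega)
      have e2 := hG.dist_param hc (i := -1) (j := 0) (by omega) (by omega)
      rw [dist_comm] at e2
      omega
    · rw [e]
      have e1 := hG.dist_param hc (i := 1) (j := k) (by omega) (by omega)
      have e2 := hG.dist_param hc (i := -1) (j := k) (by omega) (by omega)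
      rw [dist_comm] at e1 e2
      omega
  have hne' : c 1 ≠ c (-1) := fun e => by
    have := hc.inj e (by omega) (by omega)
    omega
  cases κ with
  | vertex =>
    obtain ⟨s, hs, hd⟩ := h _ _ hne'
    exact hd (hdist s hs)
  | edge =>
    have a1 : G.Adj (c 0) (c 1) := (hc.adj_succ 0).adj_sub
    have a2 : G.Adj (c 0) (c (-1)) := (hc.adj_pred 0).adj_sub
    obtain ⟨s, hs, hd⟩ := h s(c 0, c 1) a1 s(c 0, c (-1)) a2 (by
      simpa [Sym2.eq_iff, hne'] using fun h1 h2 => hne' (h2.trans h1))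
    apply hd
    rw [edgeDist_mk, edgeDist_mk, hdist s hs]

variable [DecidableRel G.Adj]

/-- The unresolved pair consists of the thread vertex at height `g/2 - k` over `c i` and the cycle
vertex `c (g/2 + k - i)`. Seen from `c 0` both are at distance `g/2 - k + i`, seen from `c k` both
at distance `g/2 - i`. -/
theorem IsGenerator.not_configC (hG : IsCactus G) (h : IsGenerator G .vertex S)
    {lab : Labelling C} {k : ℕ} (hcan : lab.IsCanonical S k) : ¬ lab.ConfigC S k := by
  rintro ⟨h2, heven, hk, i, l, hik, hl, hlen⟩
  have h3 := C.three_le_len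
  have hpos := hcan.pos h2.ge
  have hkA : k ≠ C.len / 2 := fun hk' => h.not_configA hG hcan ⟨h2, heven, hk'⟩
  obtain ⟨m, hm⟩ := heven
  obtain ⟨c, hc, hlab, hkn, h0, hkact, hall⟩ := hcan.exists_param
  rw [hlab i (by omega)] at hl
  have hne : c 0 ≠ c k := fun e => by
    have := hc.inj e (by omega) (by omega)
    omega
  obtain ⟨x, hx, hxd⟩ := (isThread_iff.1 hl.1).2.exists_dist_eq hG.1 hl.1.not_mem
    (C.len / 2 - k) (by omega) hlen
  obtain ⟨s, hs, hd⟩ := h x (c (m + k - i)) (by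
    rintro rfl; exact hl.1.not_mem_verts hx C (hc.mem _))
  apply hd
  rw [hl.dist_eq hG.1 hx hs, hxd, hG.dist_eq_of_mem (s := s) (hc.mem i),
    hG.dist_eq_of_mem (s := s) (hc.mem (m + k - i))]
  rcases Cycle.eq_or_eq_of_numActive h2 h0 hkact hne (hG.isActive_iff.2 ⟨s, hs, rfl⟩) with e | e
  · rw [e]
    have e1 := hG.dist_param hc (i := 0) (j := i) (by omega) (by omega)
    have e2 := hG.dist_param hc (i := 0) (j := m + k - i) (by omega) (by omega)
    omega
  · rw [e]
    have e1 := hG.dist_param hc (i := i) (j := k) (by omega) (by omega)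
    have e2 := hG.dist_param hc (i := k) (j := m + k - i) (by omega) (by omega)
    rw [dist_comm] at e1
    omega

/-- The thread edge whose nearer end has height `⌊g/2⌋ - k` over `c i` is not told apart from an
edge on the far side of the cycle. For odd `g` this is the cycle edge after index `⌊g/2⌋ + k - i`;
for even `g` it is the first edge of the thread that ℰ requires there. -/
theorem IsGenerator.not_configE (hG : IsCactus G) (h : IsGenerator G .edge S)
    {lab : Labelling C} {k : ℕ} (hcan : lab.IsCanonical S k) : ¬ lab.ConfigE S k := by
  rintro ⟨h2, i, l, hik, hl, hlen, hev⟩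
  have h3 := C.three_le_len
  have hpos := hcan.pos h2.ge
  have hk := hcan.two_mul_le h2
  have hkA : 2 * k ≠ C.len := fun hk' =>
    h.not_configA hG hcan ⟨h2, ⟨k, by omega⟩, by omega⟩
  obtain ⟨c, hc, hlab, hkn, h0, hkact, hall⟩ := hcan.exists_param
  rw [hlab i (by omega)] at hl
  have hne : c 0 ≠ c k := fun e => by
    have := hc.inj e (by omega) (by omega)
    omega
  obtain ⟨x, hx, hxd⟩ := (isThread_iff.1 hl.1).2.exists_dist_eq hG.1 hl.1.not_mem
    (C.len / 2 - k + 1) (by omega) (by omega)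
  have hxC := hl.1.not_mem_verts hx C
  obtain ⟨y, hyx, hyd⟩ := exists_adj_dist_eq hG.1 hxd
  have hyd' : ∀ s ∈ S, G.dist s y = G.dist s (c i) + G.dist (c i) y := by
    intro s hs
    rcases (isThread_iff.1 hl.1).2.closed hl.1.not_mem x hx y hyx.symm with hy | rfl
    · exact hl.dist_eq hG.1 hy hs
    · simp
  have hex : ∃ f ∈ G.edgeSet, x ∉ f ∧ ∀ s ∈ S,
      edgeDist G s f = G.dist s (c i) + (C.len / 2 - k) := by
    by_cases heven : Even C.len
    · obtain ⟨l', hl'⟩ := hev heven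
      obtain ⟨m, hm⟩ := heven
      rw [hlab _ (by omega), show ((C.len / 2 + k - i : ℕ) : ℤ) = m + k - i by omega] at hl'
      obtain ⟨z, hz, hadj, -⟩ := hl'.1.exists_branch
      refine ⟨s(c (m + k - i), z), hadj, ?_, fun s hs => ?_⟩
      · rw [Sym2.mem_iff, not_or]
        refine ⟨by rintro rfl; exact hxC (hc.mem _), ?_⟩
        rintro rfl
        have := hc.inj (hl.1.eq_of_mem hl'.1 hx hz).1 (by omega) (by omega)
        omega
      · rw [edgeDist_mk, hl'.dist_eq hG.1 hz hs, min_eq_left (by omega),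
          hG.dist_eq_of_mem (s := s) (hc.mem i), hG.dist_eq_of_mem (s := s) (hc.mem (m + k - i))]
        rcases Cycle.eq_or_eq_of_numActive h2 h0 hkact hne
          (hG.isActive_iff.2 ⟨s, hs, rfl⟩) with e | e
        · rw [e]
          have e1 := hG.dist_param hc (i := 0) (j := i) (by omega) (by omega)
          have e2 := hG.dist_param hc (i := 0) (j := m + k - i) (by omega) (by omega)
          omega
        · rw [e]
          have e1 := hG.dist_param hc (i := i) (j := k) (by omega) (by omega)
          have e2 := hG.dist_param hc (i := k) (j := m + k - i) (by omega) (by omega)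
          rw [dist_comm] at e1
          omega
    · obtain ⟨m, hm⟩ := Nat.not_even_iff_odd.1 heven
      refine ⟨s(c (m + k - i), c (m + k - i + 1)), (hc.adj_succ _).adj_sub, ?_, fun s hs => ?_⟩
      · rw [Sym2.mem_iff, not_or]
        exact ⟨by rintro rfl; exact hxC (hc.mem _), by rintro rfl; exact hxC (hc.mem _)⟩
      · rw [edgeDist_mk, hG.dist_eq_of_mem (s := s) (hc.mem i),
          hG.dist_eq_of_mem (s := s) (hc.mem (m + k - i)),
          hG.dist_eq_of_mem (s := s) (hc.mem (m + k - i + 1))]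
        rcases Cycle.eq_or_eq_of_numActive h2 h0 hkact hne
          (hG.isActive_iff.2 ⟨s, hs, rfl⟩) with e | e
        · rw [e]
          have e1 := hG.dist_param hc (i := 0) (j := i) (by omega) (by omega)
          have e2 := hG.dist_param hc (i := 0) (j := m + k - i) (by omega) (by omega)
          have e3 := hG.dist_param hc (i := 0) (j := m + k - i + 1) (by omega) (by omega)
          omega
        · rw [e]
          have e1 := hG.dist_param hc (i := i) (j := k) (by omega) (by omega)
          have e2 := hG.dist_param hc (i := k) (j := m + k - i) (by omega) (by omega)
          have e3 := hG.dist_param hc (i := k) (j := m + k - i + 1) (by omega) (by omega)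
          rw [dist_comm] at e1
          omega
  obtain ⟨f, hf, hxf, hfd⟩ := hex
  obtain ⟨s, hs, hd⟩ := h s(y, x) hyx f hf (by rintro rfl; exact hxf (by simp))
  apply hd
  rw [hfd s hs, edgeDist_mk, hyd' s hs, hl.dist_eq hG.1 hx hs]
  omega

theorem IsGenerator.isGood (hG : IsCactus G) (h : IsGenerator G κ S) : IsGood G κ S := by
  have hu := h.hasUniqueShadows
  refine ⟨⟨hu.isBiactive hG, hu.isBranchResolving hG⟩, fun C hC => ?_,
    hu.not_adj_criticalGraph hG⟩
  obtain ⟨lab, k, hcan, hA | hT | hL⟩ := Cycle.containsConfig_iff.1 hC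
  · exact h.not_configA hG hcan hA
  · exact hu.not_configThread hG hcan hT
  · cases κ with
    | vertex => exact h.not_configC hG hcan hL
    | edge => exact h.not_configE hG hcan hL

end Cactus

/-! ### Good sets have unique shadows. -/

namespace Cactus

open SimpleGraph

section Path

variable {V : Type*} [Fintype V] {G : SimpleGraph V} [DecidableRel G.Adj]

/-- Two vertices on one level have, by induction, a common predecessor; it would have degree three,
or degree two if it is `u`. -/
theorem dist_injective_of_degree_le_two (hconn : G.Connected) (hdeg : ∀ x, G.degree x ≤ 2) {u : V}
    (hu : G.degree u ≤ 1) {x y : V} (h : G.dist u x = G.dist u y) : x = y := by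
  induction hm : G.dist u x generalizing x y with
  | zero =>
    have h1 := hconn.dist_eq_zero_iff.1 hm
    have h2 := hconn.dist_eq_zero_iff.1 (h ▸ hm)
    exact h1.symm.trans h2
  | succ m ih =>
    obtain ⟨x', hx', hxm⟩ := exists_adj_dist_eq hconn hm
    obtain ⟨y', hy', hym⟩ := exists_adj_dist_eq hconn (h ▸ hm)
    obtain rfl := ih (hxm.trans hym.symm) hxm
    by_contra hne
    rcases Nat.eq_zero_or_pos m with rfl | hpos
    · obtain rfl := hconn.dist_eq_zero_iff.1 hxm
      have := two_le_degree hx' hy' hne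
      omega
    · obtain ⟨w, hw, hwm⟩ := exists_adj_dist_eq hconn (u := u) (x := x') (m := m - 1) (by omega)
      have := three_le_degree hx' hy' hw.symm hne (by rintro rfl; omega) (by rintro rfl; omega)
      have := hdeg x'
      omega

theorem nonempty_iso_pathGraph (hconn : G.Connected) (hdeg : ∀ x, G.degree x ≤ 2) {u : V}
    (hu : G.degree u ≤ 1) : Nonempty (G ≃g pathGraph (Fintype.card V)) := by
  have hinj := fun {x y} => dist_injective_of_degree_le_two hconn hdeg hu (x := x) (y := y)
  have hlt : ∀ x, G.dist u x < Fintype.card V := by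
    intro x
    obtain ⟨p, hp, hpl⟩ := hconn.exists_path_of_dist u x
    rw [← hpl]
    exact hp.length_lt
  let f : V → Fin (Fintype.card V) := fun x => ⟨G.dist u x, hlt x⟩
  have hf : Function.Bijective f := by
    rw [Fintype.bijective_iff_injective_and_card]
    exact ⟨fun x y h => hinj (by simpa [f] using h), by simp⟩
  have hstep : ∀ x y, G.dist u x + 1 = G.dist u y → G.Adj x y := by
    intro x y h
    obtain ⟨x', hx', hd⟩ := exists_adj_dist_eq hconn h.symm
    rwa [hinj hd] at hx'
  refine ⟨⟨Equiv.ofBijective f hf, ?_⟩⟩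
  intro x y
  rw [pathGraph_adj]
  simp only [Equiv.ofBijective_apply, f]
  constructor
  · rintro (h | h)
    · exact hstep x y h
    · exact (hstep y x h).symm
  · intro h
    have h1 := dist_le_dist_add_one hconn h u
    have h2 := dist_le_dist_add_one hconn h.symm u
    have h3 : G.dist u x ≠ G.dist u y := fun e => h.ne (hinj e)
    omega

end Path

section Roots

variable {V : Type*} {G : SimpleGraph V} {S : Finset V}

theorem exists_branch_of_ne (hconn : G.Connected) {v x : V} (h : x ≠ v) :
    ∃ w, G.Adj v w ∧ x ∈ branch G v w := by
  obtain ⟨p, hp⟩ := (hconn.preconnected v x).exists_isPath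
  cases p with
  | nil => exact absurd rfl h
  | @cons _ z _ hz q =>
    rw [Walk.cons_isPath_iff] at hp
    exact ⟨z, hz, q, hp.2⟩

theorem IsCactus.root_eq_root (hG : IsCactus G) {C D : Cycle G} (hCD : C ≠ D) {x y : V}
    (hx : x ∈ D.1.verts) (hy : y ∈ D.1.verts) : C.root x = C.root y := by
  obtain ⟨c, hc, rfl⟩ := Cycle.exists_param_zero hx
  obtain ⟨j, hj0, -, rfl⟩ := hc.exists_rep 0 hy
  lift j to ℕ using hj0
  clear hy
  induction j with
  | zero => rfl
  | succ j ih =>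
    have hD := hc.adj_succ j
    rw [ih, Nat.cast_succ]
    exact (hG.root_eq_of_adj hD.adj_sub fun hC => hCD (hG.eq_of_adj hC hD)).symm

/-- The part of the graph that hangs at `D` away from `C` is seen from `C` in one direction. -/
theorem IsCactus.root_root (hG : IsCactus G) {C D : Cycle G} {x z : V} (hx : x ∈ C.1.verts)
    (hCD : C ≠ D) (hz : D.root z ≠ D.root x) : C.root z = C.root (D.root z) := by
  have hreach : (G.deleteEdges D.1.edgeSet).Reachable (D.root z) z := hG.mem_comp_root D z
  obtain ⟨p⟩ := hreach
  suffices H : ∀ {a b : V} (q : (G.deleteEdges D.1.edgeSet).Walk a b),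
      D.root a = D.root z → C.root b = C.root a from
    H p (hG.root_self (hG.root_mem D z))
  intro a b q
  induction q with
  | nil => exact fun _ => rfl
  | @cons a b d hab q ih =>
    intro ha
    obtain ⟨hab, hD⟩ := Cycle.comp_adj_iff.1 hab
    rw [ih ((hG.root_eq_of_adj hab hD).trans ha)]
    refine hG.root_eq_of_adj hab fun hC => hz ?_
    rw [← ha]
    exact hG.root_eq_root hCD.symm hC.fst_mem hx

/-- `D` has an active vertex other than the one facing `C`. A landmark behind it is seen from `C` in
the direction of `D`. -/
theorem IsCactus.isActive_root (hG : IsCactus G) {C D : Cycle G} (hCD : C ≠ D)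
    (h2 : 2 ≤ D.numActive S) {x : V} (hx : x ∈ D.1.verts) : C.IsActive S (C.root x) := by
  obtain ⟨c, hc⟩ := C.exists_param
  obtain ⟨u, hu, hne⟩ := Cycle.exists_active_ne h2 (D.root (c 0))
  obtain ⟨s, hs, rfl⟩ := hG.isActive_iff.1 hu
  rw [hG.isActive_iff]
  refine ⟨s, hs, ?_⟩
  rw [hG.root_root (hc.mem 0) hCD hne]
  exact hG.root_eq_root hCD (hG.root_mem D s) hx

end Roots

variable {V : Type*} [Fintype V] {G : SimpleGraph V} [DecidableRel G.Adj] {C : Cycle G}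
  {S : Finset V} {κ : Kind}

/-- The shadow confines the active vertices to a short window beginning at `v`. Trimming the window
to its extreme active vertices `c (k - m)` and `c k` gives a canonical labelling in which `v` has
index `0` or `g - (k - m)`, as in ℬ and 𝒟. -/
theorem containsConfig_of_shadow_of_thread (hG : IsCactus G) (h2 : 2 ≤ C.numActive S) {v y : V}
    (hvy : C.1.Adj v y) (hs : IsShadow G κ S v y) {l : List V} (hl : IsFreeThread G S v l) :
    C.ContainsConfig κ S := by
  have h3 := C.three_le_len
  have hb := κ.critBound_lt C
  obtain ⟨c, hc, rfl, rfl⟩ : ∃ c, Param C c ∧ c 0 = v ∧ c (-1) = y := by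
    obtain ⟨c, hc, h0, h1⟩ := Cycle.exists_param_adj hvy
    exact ⟨_, hc.reflect 0, by simpa using h0, by simpa using h1⟩
  obtain ⟨u, hu, -⟩ := Cycle.exists_active_ne h2 (c 0)
  obtain ⟨k, hk, hkact, hall⟩ := (hs.activeWithin hG hc).exists_max ⟨u, hu⟩
  obtain ⟨m, hm, hmact, hall'⟩ := hall.reflect.exists_max ⟨u, hu⟩
  have hc' := (hc.reflect k).reflect m
  have e : (fun i : ℤ => c (k - (m - i))) = fun i => c (k - m + i) := by
    funext i; congr 1; ring
  have hall'' := hall'.reflect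
  rw [e] at hc' hall''
  obtain ⟨lab, hlab, hcan⟩ := hG.isCanonical_of_short hc' (by simpa using hmact)
    (by simpa using hkact) hall'' (by omega)
  rw [Cycle.containsConfig_iff]
  refine ⟨lab, m, hcan, Or.inr (Or.inl ⟨by omega, ?_⟩)⟩
  by_cases hkm : k = m
  · refine ⟨0, l, ?_, by omega⟩
    rw [hlab 0 (by omega)]
    simpa [hkm] using hl
  · refine ⟨C.len - (k - m), l, ?_, by omega⟩
    rw [hlab _ (by omega)]
    have e2 : (k : ℤ) - m + ((C.len - (k - m) : ℕ) : ℤ) = 0 + C.len := by omega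
    rw [e2, hc.add_len]
    exact hl

/-- Each kind of coincidence is excluded by one clause. Two shadows over bridges are two free tails,
impossible by branch resolution unless the graph is a path. One over a bridge and one on a cycle
give ℬ or 𝒟. Two on the same cycle contradict biactivity, and on different cycles they give a
critical incidence. -/
theorem IsGood.hasUniqueShadows (hG : IsCactus G) (h : IsGood G κ S)
    (hpath : ∀ n, 3 ≤ n → IsEmpty (G ≃g pathGraph n)) : HasUniqueShadows G κ S := by
  classical
  obtain ⟨⟨hbi, hbr⟩, hconf, hcrit⟩ := h
  have mixed : ∀ v y y', IsShadow G κ S v y → IsShadow G κ S v y' →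
      ∀ C : Cycle G, C.1.Adj v y → OffCycles G v y' → False := by
    intro v y y' hs hs' C hC hoff
    have hf := hs'.not_mem_branch hG.1 hoff
    obtain ⟨-, l, hl, hl'⟩ := exists_tail_of_branch hG hbr hbi.isWeaklyBiactive hs'.1 hf
    refine hconf C (containsConfig_of_shadow_of_thread hG (hbi C) hC hs (l := l ++ [y']) ?_)
    exact ⟨⟨Cycle.three_le_degree hC.fst_mem hs'.1 (hoff C), hl⟩,
      fun x hx hxS => hf x hxS ((hl' x).1 hx)⟩
  intro v y y' hs hs'
  by_contra hne
  by_cases hy : OffCycles G v y <;> by_cases hy' : OffCycles G v y'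
  · have hf := hs.not_mem_branch hG.1 hy
    have hf' := hs'.not_mem_branch hG.1 hy'
    have ht := (exists_tail_of_branch hG hbr hbi.isWeaklyBiactive hs.1 hf).2
    have ht' := (exists_tail_of_branch hG hbr hbi.isWeaklyBiactive hs'.1 hf').2
    by_cases hd : 3 ≤ G.degree v
    · exact hne (eq_of_free_tails hbr hd ht ht' hf hf')
    -- Here `v` has only the neighbours `y` and `y'`, so `v` and two tails make up the whole graph.
    · have hdeg : ∀ x, G.degree x ≤ 2 := by
        intro x
        by_cases hxv : x = v
        · subst hxv; omega
        · obtain ⟨w, hw, hxw⟩ := exists_branch_of_ne hG.1 hxv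
          have hw' : w = y ∨ w = y' := by
            by_contra! hcon
            exact hd (three_le_degree hs.1 hs'.1 hw hne hcon.1.symm hcon.2.symm)
          rcases hw' with rfl | rfl
          · obtain ⟨l, hl, hl'⟩ := ht
            exact hl.degree_le ((hl' x).2 hxw)
          · obtain ⟨l, hl, hl'⟩ := ht'
            exact hl.degree_le ((hl' x).2 hxw)
      obtain ⟨l, ⟨-, -, u, t, -, hu, -⟩, -⟩ := ht
      obtain ⟨e⟩ := nonempty_iso_pathGraph hG.1 hdeg hu.le
      refine (hpath _ ?_).false e
      have := Finset.card_le_univ ({v, y, y'} : Finset V)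
      rwa [Finset.card_eq_three.2 ⟨v, y, y', hs.1.ne, hs'.1.ne, hne, rfl⟩] at this
  · unfold OffCycles at hy'
    push Not at hy'
    obtain ⟨C, hC⟩ := hy'
    exact mixed v y' y hs' hs C hC hy
  · unfold OffCycles at hy
    push Not at hy
    obtain ⟨C, hC⟩ := hy
    exact mixed v y y' hs hs' C hC hy'
  · unfold OffCycles at hy hy'
    push Not at hy hy'
    obtain ⟨C, hC⟩ := hy
    obtain ⟨D, hD⟩ := hy'
    by_cases hCD : C = D
    · subst hCD
      exact hne (not_isShadow_both hG (hbi C) hC hD hs hs')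
    · have a1 := hG.isActive_root hCD (hbi D) hD.fst_mem
      have a2 := hG.isActive_root (Ne.symm hCD) (hbi C) hC.fst_mem
      rw [hG.root_self hC.fst_mem] at a1
      rw [hG.root_self hD.fst_mem] at a2
      exact hcrit C D ⟨hCD, v, hs.isCritical hG hC a1, hs'.isCritical hG hD a2⟩

end Cactus

/-! ### Separating objects that have different positions on a cycle. -/

namespace Cactus

open SimpleGraph

section Circle

/-- The distance of two positions on a circle of circumference `2 * n`. -/
def circleDist (n a b : ℤ) : ℤ := min (max (a - b) (b - a)) (2 * n - max (a - b) (b - a))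

/-- The landmark at position `2 * l` does not tell apart the objects with positions `p`, `q`. -/
def Unresolved (n p q H H' l : ℤ) : Prop :=
  (2 * l ≠ p ∧ 2 * l ≠ q ∧ circleDist n (2 * l) p + H = circleDist n (2 * l) q + H') ∨
    (2 * l = p ∧ circleDist n p q + H' ≤ H)

/-- The two landmarks and their antipodes cut the circle into four arcs on which both distances are
linear. Lengths are doubled so that midpoints of edges have integral positions. -/
theorem circleDist_cases {n k x : ℤ} (hk : 0 < k) (hkn : 2 * k ≤ n) (hx : 0 ≤ x) :
    (x < 2 * k ∧ circleDist n (2 * 0) x = x ∧ circleDist n (2 * k) x = 2 * k - x) ∨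
    (2 * k ≤ x ∧ x ≤ n ∧ circleDist n (2 * 0) x = x ∧ circleDist n (2 * k) x = x - 2 * k) ∨
    (n < x ∧ x < n + 2 * k ∧ circleDist n (2 * 0) x = 2 * n - x ∧
      circleDist n (2 * k) x = x - 2 * k) ∨
    (n + 2 * k ≤ x ∧ circleDist n (2 * 0) x = 2 * n - x ∧
      circleDist n (2 * k) x = 2 * n - x + 2 * k) := by
  have e0 : circleDist n (2 * 0) x = min x (2 * n - x) := by simp only [circleDist]; omega
  rw [e0]
  rcases lt_or_ge x (2 * k) with h | h
  · have : circleDist n (2 * k) x = min (2 * k - x) (2 * n - (2 * k - x)) := by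
      simp only [circleDist]; omega
    exact Or.inl (by omega)
  · have : circleDist n (2 * k) x = min (x - 2 * k) (2 * n - (x - 2 * k)) := by
      simp only [circleDist]; omega
    rcases le_or_gt x n with h' | h'
    · exact Or.inr (Or.inl (by omega))
    · rcases lt_or_ge x (n + 2 * k) with h'' | h''
      · exact Or.inr (Or.inr (Or.inl (by omega)))
      · exact Or.inr (Or.inr (Or.inr (by omega)))

/-- Position `p` belongs to the higher object. The first alternative is the geometry of 𝒞 and ℰ,
with 𝒜 as the limit `2 * k = n`; the second is 𝒜; the other three put `p` into the index ranges of ℬ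
and 𝒟. -/
theorem unresolved_cases {n k p q H H' : ℤ} (hk : 0 < k) (hkn : 2 * k ≤ n) (hp : 0 ≤ p)
    (hpn : p < 2 * n) (hq : 0 ≤ q) (hqn : q < 2 * n) (hpq : p ≠ q) (hH : H' ≤ H)
    (h0 : Unresolved n p q H H' 0) (hk' : Unresolved n p q H H' k) :
    (0 < p ∧ p < 2 * k ∧ 2 * k + (H - H') = n ∧ q = n + 2 * k - p) ∨
    (H = H' ∧ 2 * k = n ∧ 0 < q ∧ q < 2 * k ∧ p = n + 2 * k - q) ∨
    (2 * k ≤ p ∧ p < q ∧ q ≤ n ∧ H = H' + (q - p)) ∨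
    (p = 0 ∧ n + 2 * k ≤ q ∧ H = H' + (2 * n - q)) ∨
    (n + 2 * k ≤ q ∧ q < p ∧ H = H' + (p - q)) := by
  have cp := circleDist_cases hk hkn hp
  have cq := circleDist_cases hk hkn hq
  rcases h0 with ⟨h0, h0', e0⟩ | ⟨rfl, e0⟩
  · rcases hk' with ⟨hk1, hk2, ek⟩ | ⟨rfl, ek⟩
    · rcases cp with ⟨p1, p2, p3⟩ | ⟨p1, p1', p2, p3⟩ | ⟨p1, p1', p2, p3⟩ | ⟨p1, p2, p3⟩ <;>
        rcases cq with ⟨q1, q2, q3⟩ | ⟨q1, q1', q2, q3⟩ | ⟨q1, q1', q2, q3⟩ | ⟨q1, q2, q3⟩ <;>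
        rw [p2, q2] at e0 <;> rw [p3, q3] at ek
      · exfalso; omega
      · exfalso; omega
      · exact Or.inl (by omega)
      · exfalso; omega
      · exfalso; omega
      · exact Or.inr (Or.inr (Or.inl (by omega)))
      · exfalso; omega
      · exfalso; omega
      · exact Or.inr (Or.inl (by omega))
      · exfalso; omega
      · exfalso; omega
      · exfalso; omega
      · exfalso; omega
      · exfalso; omega
      · exfalso; omega
      · exact Or.inr (Or.inr (Or.inr (Or.inr (by omega))))
    · rcases cq with ⟨q1, q2, q3⟩ | ⟨q1, q1', q2, q3⟩ | ⟨q1, q1', q2, q3⟩ | ⟨q1, q2, q3⟩ <;>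
        rw [q2] at e0 <;> rw [q3] at ek
      · exfalso; omega
      · exact Or.inr (Or.inr (Or.inl (by omega)))
      · exfalso; omega
      · exfalso; omega
  · rcases hk' with ⟨hk1, hk2, ek⟩ | ⟨hk1, ek⟩
    · rcases cp with ⟨p1, p2, p3⟩ | ⟨p1, p1', p2, p3⟩ | ⟨p1, p1', p2, p3⟩ | ⟨p1, p2, p3⟩
      · rcases cq with ⟨q1, q2, q3⟩ | ⟨q1, q1', q2, q3⟩ | ⟨q1, q1', q2, q3⟩ | ⟨q1, q2, q3⟩ <;>
          rw [q2] at e0 <;> rw [p3, q3] at ek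
        · exfalso; omega
        · exfalso; omega
        · exfalso; omega
        · exact Or.inr (Or.inr (Or.inr (Or.inl (by omega))))
      all_goals exfalso; omega
    · exfalso; omega

/-- This is why 𝒜, 𝒞 and ℰ demand exactly two active vertices. -/
theorem unresolved_third {n k p q H H' l : ℤ} (hkn : 2 * k ≤ n) (hl : 0 < l) (hlk : l < k)
    (h : (0 < p ∧ p < 2 * k ∧ 2 * k + (H - H') = n ∧ q = n + 2 * k - p) ∨
      (H = H' ∧ 2 * k = n ∧ 0 < q ∧ q < 2 * k ∧ p = n + 2 * k - q)) :
    ¬ Unresolved n p q H H' l := by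
  simp only [Unresolved, circleDist] at *
  omega

theorem not_unresolved_triple {n a b p q H H' : ℤ} (ha : 0 < a) (hab : a < b) (hbn : b < n)
    (h1 : 2 * a ≤ n) (h2 : 2 * (b - a) ≤ n) (h3 : 2 * (n - b) ≤ n) (hp : 0 ≤ p)
    (hpn : p < 2 * n) (hq : 0 ≤ q) (hqn : q < 2 * n) (hpq : p ≠ q) (hH : H' ≤ H)
    (u0 : Unresolved n p q H H' 0) (ua : Unresolved n p q H H' a)
    (ub : Unresolved n p q H H' b) : False := by
  have := unresolved_cases ha h1 hp hpn hq hqn hpq hH u0 ua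
  simp only [Unresolved, circleDist] at ub
  rcases this with h | h | h | h | h <;> omega


end Circle

section Dist

variable {V : Type*} {G : SimpleGraph V} {C : Cycle G} {c : ℤ → V}

theorem IsCactus.two_mul_dist_param (hG : IsCactus G) (hc : Param C c) {i j : ℤ} (hi : 0 ≤ i)
    (hin : i < C.len) (hj : 0 ≤ j) (hjn : j ≤ C.len) :
    2 * (G.dist (c i) (c j) : ℤ) = circleDist C.len (2 * i) (2 * j) := by
  unfold circleDist
  rcases le_total i j with h | h
  · have := hG.dist_param hc h (by omega)
    omega
  · have := hG.dist_param hc h (by omega)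
    rw [dist_comm] at this
    omega

theorem exists_adj_dist_lt (hconn : G.Connected) {v x : V} (h : x ≠ v) :
    ∃ z, G.Adj v z ∧ G.dist z x + 1 = G.dist v x := by
  have hpos := hconn.pos_dist_of_ne h.symm
  obtain ⟨z, hz, hd⟩ := exists_adj_dist_eq hconn (u := x) (x := v) (m := G.dist v x - 1)
    (by rw [dist_comm]; omega)
  exact ⟨z, hz.symm, by rw [dist_comm, hd]; omega⟩

theorem IsCactus.not_adj_of_dist_lt (hG : IsCactus G) {v x z : V} (hx : C.root x = v)
    (hd : G.dist z x < G.dist v x) : ¬ C.1.Adj v z := by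
  intro h
  have := hG.dist_eq_of_mem (s := x) h.snd_mem
  rw [hx, dist_comm (u := x) (v := z), dist_comm (u := x)] at this
  omega

end Dist

section Profile

variable {V : Type*} [Fintype V] {G : SimpleGraph V} [DecidableRel G.Adj] {C : Cycle G}
  {S : Finset V} {κ : Kind} {c : ℤ → V}

/-- The doubled distances `D` to a vertex or an edge that sits at the position `p` on the cycle `C`
of doubled length and hangs at a doubled height `H` over it. -/
structure IsProfile (C : Cycle G) (S : Finset V) (κ : Kind) (c : ℤ → V) (D : V → ℤ) (p H : ℤ) :
    Prop where
  nonneg : 0 ≤ p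
  lt : p < 2 * C.len
  height_nonneg : 0 ≤ H
  far : ∀ (s : V) (l : ℤ), 0 ≤ l → l < C.len → C.root s = c l → 2 * l ≠ p →
    D s = 2 * G.dist s (c l) + circleDist C.len (2 * l) p + H
  near : ∀ (s : V) (l : ℤ), 0 ≤ l → l < C.len → C.root s = c l → 2 * l = p →
    D s ≤ 2 * G.dist s (c l) + H
  vertex : κ = .vertex → p % 2 = 0 ∧ H % 2 = 0
  edge : κ = .edge → (p % 2 = 1 ∧ H = 0) ∨ (p % 2 = 0 ∧ H % 2 = 1)
  shadow : ∀ i : ℤ, p = 2 * i → 0 < H → (∀ s ∈ S, 2 * G.dist s (c i) + H ≤ D s) →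
    ∃ z, ¬ C.1.Adj (c i) z ∧ IsShadow G κ S (c i) z
  thread : ∀ i : ℤ, p = 2 * i → 0 < H → ∃ x ∈ C.comp (c i), x ≠ c i ∧
    ∀ l, IsThread G (c i) l → x ∈ l → H ≤ 2 * l.length

theorem IsCactus.exists_profile_vertex (hG : IsCactus G) (hc : Param C c) (S : Finset V) (x : V) :
    ∃ i : ℤ, 0 ≤ i ∧ i < C.len ∧ c i = C.root x ∧
      IsProfile C S .vertex c (fun s => 2 * G.dist s x) (2 * i) (2 * G.dist (c i) x) := by
  have h3 := C.three_le_len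
  obtain ⟨i, hi0, hin, hi⟩ := hc.exists_rep 0 (hG.root_mem C x)
  refine ⟨i, hi0, by omega, hi, ?_⟩
  refine ⟨by omega, by omega, by omega, ?_, ?_, by omega, by simp, ?_, ?_⟩
  · intro s l hl hln hs hne
    have h1 : C.root s ≠ C.root x := fun e => by
      have := hc.inj (hs.symm.trans (e.trans hi.symm)) (by omega) (by omega)
      omega
    have h2 := hG.dist_eq_of_root_ne h1
    rw [hs] at h2
    have h4 := hG.dist_eq_of_mem (s := x) (hc.mem l)
    rw [← hi, dist_comm (v := c l), dist_comm (u := x), dist_comm (u := c i) (v := c l)] at h4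
    have h5 := hG.two_mul_dist_param hc hl hln hi0 (by omega)
    simp only [h2, h4]
    push_cast
    omega
  · intro s l hl hln hs he
    obtain rfl : l = i := by omega
    have := hG.1.dist_triangle (u := s) (v := c l) (w := x)
    omega
  · intro j hj hH hs
    obtain rfl : i = j := by omega
    obtain ⟨z, hz, hd⟩ := exists_adj_dist_lt hG.1 (v := c i) (x := x)
      (by rintro rfl; simp at hH)
    refine ⟨z, hG.not_adj_of_dist_lt hi.symm (by omega), hz, fun s hsS => ?_⟩
    have h1 := hs s hsS
    have h2 := hG.1.dist_triangle (u := s) (v := z) (w := x)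
    have h4 := dist_le_dist_add_one hG.1 hz s
    simp only [Kind.Beyond]
    omega
  · intro j hj hH
    obtain rfl : i = j := by omega
    refine ⟨x, (hG.mem_comp_iff (hc.mem i)).2 hi.symm, by rintro rfl; simp at hH, ?_⟩
    intro l hl hxl
    have := (isThread_iff.1 hl).2.dist_le_length hG.1 hl.not_mem x hxl
    omega

/-- Twice the distance plus one is the doubled distance to the midpoint of the edge, so an edge off
the cycle has an odd height. -/
theorem IsCactus.profile_edge_of_not_adj (hG : IsCactus G) (hc : Param C c) (S : Finset V)
    {x y : V} (hxy : G.Adj x y) (hC : ¬ C.1.Adj x y) {i : ℤ} (hi0 : 0 ≤ i) (hin : i < C.len)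
    (hi : c i = C.root x) (hle : G.dist (c i) x ≤ G.dist (c i) y) :
    IsProfile C S .edge c (fun s => 2 * edgeDist G s s(x, y) + 1) (2 * i)
      (2 * G.dist (c i) x + 1) := by
  have h3 := C.three_le_len
  have hi' : c i = C.root y := hi.trans (hG.root_eq_of_adj hxy hC).symm
  have hyi : y ≠ c i := by
    rintro rfl
    rw [SimpleGraph.dist_self, Nat.le_zero, hG.1.dist_eq_zero_iff] at hle
    exact hxy.ne hle.symm
  refine ⟨by omega, by omega, by omega, ?_, ?_, by simp, fun _ => by omega, ?_, ?_⟩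
  · intro s l hl hln hs hne
    have hd : ∀ x, c i = C.root x →
        G.dist s x = G.dist s (c l) + (G.dist (c l) (c i) + G.dist (c i) x) := by
      intro x hi
      have h1 : C.root s ≠ C.root x := fun e => by
        have := hc.inj (hs.symm.trans (e.trans hi.symm)) (by omega) (by omega)
        omega
      have h2 := hG.dist_eq_of_root_ne h1
      rw [hs] at h2
      have h4 := hG.dist_eq_of_mem (s := x) (hc.mem l)
      rw [← hi, dist_comm (v := c l), dist_comm (u := x), dist_comm (u := c i) (v := c l)] at h4
      omega
    have h5 := hG.two_mul_dist_param hc hl hln hi0 (by omega)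
    simp only [edgeDist_mk]
    rw [hd x hi, hd y hi']
    push_cast
    omega
  · intro s l hl hln hs he
    obtain rfl : l = i := by omega
    have := hG.1.dist_triangle (u := s) (v := c l) (w := x)
    simp only [edgeDist_mk]
    omega
  · intro j hj hH hs
    obtain rfl : i = j := by omega
    by_cases hxi : x = c i
    · subst hxi
      refine ⟨y, hC, hxy, fun s hsS => ?_⟩
      have h1 := hs s hsS
      rw [SimpleGraph.dist_self] at h1
      simp only [Kind.Beyond, edgeDist_mk] at h1 ⊢
      omega
    · obtain ⟨z, hz, hd⟩ := exists_adj_dist_lt hG.1 (v := c i) (x := x) hxi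
      refine ⟨z, hG.not_adj_of_dist_lt hi.symm (by omega), hz, fun s hsS => ?_⟩
      have h1 := hs s hsS
      have h2 := hG.1.dist_triangle (u := s) (v := z) (w := x)
      simp only [Kind.Beyond, edgeDist_mk] at h1 ⊢
      omega
  · intro j hj hH
    obtain rfl : i = j := by omega
    refine ⟨y, (hG.mem_comp_iff (hc.mem i)).2 hi'.symm, hyi, ?_⟩
    intro l hl hyl
    have h1 := (isThread_iff.1 hl).2.dist_le_length hG.1 hl.not_mem y hyl
    -- A bridge has no two equidistant ends, so `y` is farther from `c i` than `x`, and the thread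
    -- reaches beyond the midpoint.
    have h2 : OffCycles G x y := fun D hD => hl.not_mem_verts hyl D hD.snd_mem
    have h4 := h2.dist_ne hG.1 hxy (c i)
    omega

theorem IsCactus.profile_edge_of_adj (hG : IsCactus G) (hc : Param C c) (S : Finset V) {j : ℤ}
    (hj0 : 0 ≤ j) (hjn : j < C.len) :
    IsProfile C S .edge c (fun s => 2 * edgeDist G s s(c j, c (j + 1)) + 1) (2 * j + 1) 0 := by
  have h3 := C.three_le_len
  refine ⟨by omega, by omega, le_rfl, ?_, ?_, by simp, fun _ => by omega, ?_, ?_⟩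
  · intro s l hl hln hs hne
    simp only [edgeDist_mk]
    rw [hG.dist_eq_of_mem (s := s) (hc.mem j), hG.dist_eq_of_mem (s := s) (hc.mem (j + 1)), hs]
    have h4 := hG.two_mul_dist_param hc hl hln hj0 (by omega)
    have h5 := hG.two_mul_dist_param hc (j := j + 1) hl hln (by omega) (by omega)
    have h6 : min (circleDist C.len (2 * l) (2 * j)) (circleDist C.len (2 * l) (2 * (j + 1))) + 1
        = circleDist C.len (2 * l) (2 * j + 1) := by
      simp only [circleDist]
      omega
    push_cast
    omega
  · intros; omega
  · intros; omega
  · intros; omega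

/-- An edge has a profile with respect to every cycle, and its position determines the root. -/
theorem IsCactus.exists_profile_edge (hG : IsCactus G) (hc : Param C c) (S : Finset V)
    {x y : V} (hxy : G.Adj x y) :
    ∃ p H, IsProfile C S .edge c (fun s => 2 * edgeDist G s s(x, y) + 1) p H ∧
      ((C.1.Adj x y ∧ ∃ j : ℤ, 0 ≤ j ∧ j < C.len ∧ p = 2 * j + 1 ∧ s(x, y) = s(c j, c (j + 1))) ∨
      (¬ C.1.Adj x y ∧ ∃ i : ℤ, 0 ≤ i ∧ i < C.len ∧ p = 2 * i ∧ c i = C.root x)) := by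
  have h3 := C.three_le_len
  by_cases hC : C.1.Adj x y
  · obtain ⟨j, hj0, hjn, hj⟩ : ∃ j : ℤ, 0 ≤ j ∧ j < C.len ∧ s(x, y) = s(c j, c (j + 1)) := by
      obtain ⟨i, hi0, hin, rfl⟩ := hc.exists_rep 1 hC.fst_mem
      rcases hc.adj_cases hC with rfl | rfl
      · by_cases hi : i = C.len
        · refine ⟨0, le_rfl, by omega, ?_⟩
          rw [hi, show (C.len : ℤ) = 0 + C.len by ring, hc.add_len,
            show (0 : ℤ) + C.len + 1 = 0 + 1 + C.len by ring, hc.add_len]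
        · exact ⟨i, by omega, by omega, rfl⟩
      · exact ⟨i - 1, by omega, by omega, by rw [sub_add_cancel, Sym2.eq_swap]⟩
    exact ⟨2 * j + 1, 0, hj ▸ hG.profile_edge_of_adj hc S hj0 hjn,
      Or.inl ⟨hC, j, hj0, hjn, rfl, hj⟩⟩
  · obtain ⟨i, hi0, hin, hi⟩ := hc.exists_rep 0 (hG.root_mem C x)
    rcases le_total (G.dist (c i) x) (G.dist (c i) y) with hle | hle
    · exact ⟨_, _, hG.profile_edge_of_not_adj hc S hxy hC hi0 (by omega) hi hle,
        Or.inr ⟨hC, i, hi0, by omega, rfl, hi⟩⟩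
    · have := hG.profile_edge_of_not_adj hc S hxy.symm (fun h => hC h.symm) hi0 (by omega)
        (hi.trans (hG.root_eq_of_adj hxy hC).symm) hle
      rw [Sym2.eq_swap] at this
      exact ⟨_, _, this, Or.inr ⟨hC, i, hi0, by omega, rfl, hi⟩⟩

/-- A landmark rooted at `p` may lie inside the part that hangs there, so its distance is only
bounded above; hence the inequality in `Unresolved`. A landmark rooted at the position `q` of the
lower object always resolves the pair. -/
theorem IsProfile.unresolved {D D' : V → ℤ} {p q H H' : ℤ} (h : IsProfile C S κ c D p H)
    (h' : IsProfile C S κ c D' q H') (hpq : p ≠ q) (hH : H' ≤ H) {s : V} (hs : D s = D' s) {l : ℤ}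
    (hl : 0 ≤ l) (hln : l < C.len) (hr : C.root s = c l) : Unresolved C.len p q H H' l := by
  by_cases hp : 2 * l = p
  · have h1 := h.near s l hl hln hr hp
    have h2 := h'.far s l hl hln hr (by omega)
    rw [hp] at h2
    exact Or.inr ⟨hp, by omega⟩
  · have h1 := h.far s l hl hln hr hp
    by_cases hq : 2 * l = q
    · exfalso
      have h2 := h'.near s l hl hln hr hq
      have hp0 := h.nonneg
      have hpn := h.lt
      simp only [circleDist] at h1
      omega
    · have h2 := h'.far s l hl hln hr hq
      exact Or.inl ⟨hp, hq, by omega⟩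

/-- The first two alternatives of `unresolved_cases` leave only two active vertices, and an object
of positive height at an inactive vertex sits on a free thread; this yields 𝒜, 𝒞 or ℰ. In the others
the cycle contains a shadow of the vertex at `p`, and the higher object supplies a second shadow off
the cycle. -/
theorem exists_ne_of_profile_of_le (hG : IsCactus G) (hgood : IsGood G κ S)
    (hS : HasUniqueShadows G κ S) {D D' : V → ℤ}
    {lab : Labelling C} {k : ℕ} (hcan : lab.IsCanonical S k) (hc : Param C c)
    (hlab : ∀ i : ℕ, i ≤ C.len → lab.vert i = c i) (h0 : C.IsActive S (c 0))
    (hkact : C.IsActive S (c k)) (hall : ActiveWithin C S c k) (hkn : 2 * k ≤ C.len)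
    {p q H H' : ℤ} (hP : IsProfile C S κ c D p H) (hP' : IsProfile C S κ c D' q H') (hpq : p ≠ q)
    (hH : H' ≤ H) : ∃ s ∈ S, D s ≠ D' s := by
  have h3 := C.three_le_len
  have hkpos := hcan.pos (hgood.1.1 C)
  by_contra! hD
  have hun : ∀ l : ℤ, 0 ≤ l → l < C.len → C.IsActive S (c l) → Unresolved C.len p q H H' l := by
    intro l hl hln hact
    obtain ⟨s, hs, hr⟩ := hG.isActive_iff.1 hact
    exact hP.unresolved hP' hpq hH (hD s hs) hl hln hr
  have hcases := unresolved_cases (n := C.len) (k := k) (by omega) (by omega) hP.nonneg hP.lt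
    hP'.nonneg hP'.lt hpq hH (hun 0 le_rfl (by omega) h0) (hun k (by omega) (by omega) hkact)
  have hconf : ¬ (lab.ConfigA S k ∨ lab.ConfigThread κ S k ∨ lab.ConfigLong S k κ) :=
    fun h => hgood.2.1 C (Cycle.containsConfig_iff.2 ⟨lab, k, hcan, h⟩)
  have hvertex := hP.vertex
  have hvertex' := hP'.vertex
  have hedge := hP.edge
  have hedge' := hP'.edge
  have hH0 := hP'.height_nonneg
  have hp0 := hP.nonneg
  have hpn := hP.lt
  have hqn := hP'.lt
  rcases or_assoc.2 hcases with hc12 | hc345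
  · have hact : ∀ l : ℤ, 0 ≤ l → l < C.len → C.IsActive S (c l) → l = 0 ∨ l = k := by
      intro l hl hln hact
      obtain ⟨j, hj0, hjk, hj⟩ := hall _ hact
      have := hc.inj hj (by omega) (by omega)
      obtain rfl : l = j := by omega
      by_contra! hne
      exact unresolved_third (by omega) (by omega) (by omega) hc12 (hun l hl hln hact)
    have htwo : C.numActive S = 2 := by
      refine le_antisymm ?_ (hgood.1.1 C)
      have hsub : {v | C.IsActive S v} ⊆ {c 0, c k} := by
        intro v hv
        obtain ⟨j, hj0, hjk, rfl⟩ := hall v hv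
        rcases hact j hj0 (by omega) hv with rfl | rfl
        · exact Or.inl rfl
        · exact Or.inr rfl
      exact (Set.ncard_le_ncard hsub (Set.toFinite _)).trans
        ((Set.ncard_insert_le _ _).trans (by simp))
    by_cases hA : 2 * k = C.len
    · exact hconf (Or.inl ⟨htwo, ⟨k, by omega⟩, by omega⟩)
    obtain ⟨hp1, hp2, hkH, hq⟩ := hc12.resolve_right (by omega)
    have hthread : ∀ {D : V → ℤ} {p H : ℤ}, IsProfile C S κ c D p H → 0 < H → ∀ i : ℕ,
        p = 2 * i → i ≠ 0 → i ≠ k → ∃ l, IsFreeThread G S (lab.vert i) l ∧ H ≤ 2 * l.length := by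
      intro D p H hP hH i hpi hi0 hik
      have hlt := hP.lt
      obtain ⟨x, hx, hxi, hlen⟩ := hP.thread i hpi hH
      have hna : ¬ C.IsActive S (c i) := fun h => by
        rcases hact i (by omega) (by omega) h with h | h <;> omega
      obtain ⟨l, hl, hxl⟩ := exists_freeThread_of_mem_comp hG hgood.1.2 hgood.1.1 (hc.mem i) hna
        hx hxi
      refine ⟨l, ?_, hlen l hl.1 hxl⟩
      rw [hlab i (by omega)]
      exact hl
    have hHpos : 0 < H := by omega
    have hpe : p % 2 = 0 := by
      cases κ with
      | vertex => exact (hvertex rfl).1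
      | edge => rcases hedge rfl with h | h <;> omega
    obtain ⟨l, hl, hlen⟩ := hthread hP hHpos (p / 2).toNat (by omega) (by omega) (by omega)
    refine hconf (Or.inr (Or.inr ?_))
    cases κ with
    | vertex =>
      have h1 := hvertex rfl
      have h2 := hvertex' rfl
      exact ⟨htwo, ⟨C.len / 2, by omega⟩, by omega, _, l, by omega, hl, by omega⟩
    | edge =>
      have h1 := hedge rfl
      have h2 := hedge' rfl
      refine ⟨htwo, _, l, by omega, hl, by omega, fun heven => ?_⟩
      have heven := Nat.even_iff.1 heven
      obtain ⟨l', hl', -⟩ := hthread hP' (by omega) (q / 2).toNat (by omega) (by omega) (by omega)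
      refine ⟨l', ?_⟩
      rwa [show C.len / 2 + k - (p / 2).toNat = (q / 2).toNat by omega]
  · have hHpos : 0 < H := by omega
    have hpe : p % 2 = 0 := by
      cases κ with
      | vertex => exact (hvertex rfl).1
      | edge => rcases hedge rfl with h | h <;> omega
    obtain ⟨i, rfl⟩ : ∃ i : ℕ, p = 2 * i := ⟨(p / 2).toNat, by omega⟩
    have hqe : κ = .vertex → q % 2 = 0 := fun h => (hvertex' h).1
    have hcb : k ≤ κ.critBound C.len ∧ ((k ≤ i ∧ i ≤ κ.critBound C.len) ∨
        (C.len + k ≤ i + κ.critBound C.len ∧ i < C.len) ∨ i = 0) := by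
      cases κ with
      | vertex => have := hqe rfl; simp only [Kind.critBound]; omega
      | edge => simp only [Kind.critBound]; omega
    obtain ⟨y, hy, hys⟩ := hG.exists_isShadow hc hall hcb.1 hcb.2
    obtain ⟨z, hz, hzs⟩ := hP.shadow i rfl hHpos (by
      intro s hs
      obtain ⟨l, hl0, hln, hl⟩ := hc.exists_rep 0 (hG.root_mem C s)
      -- For a landmark rooted at `c i` the profile of `D` bounds the distance only from above; the
      -- lower bound is read off from the equal value of `D'`.
      by_cases hli : 2 * l = 2 * i
      · obtain rfl : l = i := by omega
        have h1 := hP'.far s i hl0 (by omega) hl.symm (by omega)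
        rw [hD s hs, h1]
        simp only [circleDist]
        omega
      · have h1 := hP.far s l hl0 (by omega) hl.symm hli
        have h2 := hG.dist_eq_of_mem (s := s) (hc.mem i)
        have h4 := hG.two_mul_dist_param hc (i := l) (j := i) hl0 (by omega) (by omega) (by omega)
        rw [← hl] at h2
        omega)
    exact hz (hS _ _ _ hys hzs ▸ hy)

/-- Objects at different positions of a cycle are told apart by a good set. -/
theorem exists_ne_of_profile (hG : IsCactus G) (hgood : IsGood G κ S)
    (hS : HasUniqueShadows G κ S) (C : Cycle G) {D D' : V → ℤ}
    (h : ∀ c, Param C c → ∃ p q H H', p ≠ q ∧ IsProfile C S κ c D p H ∧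
      IsProfile C S κ c D' q H') : ∃ s ∈ S, D s ≠ D' s := by
  have h2 := hgood.1.1 C
  obtain ⟨lab, k, hcan⟩ := Cycle.exists_isCanonical (S := S) (C := C) (by omega)
  by_cases hk : C.len < 2 * k
  · by_contra! hD
    obtain ⟨c, a, b, hc, h0, ha, hb, ha0, hab, hbn, h1, h2, h3⟩ := hcan.hasGeodesicTriple hk
    obtain ⟨p, q, H, H', hpq, hP, hP'⟩ := h c hc
    wlog hH : H' ≤ H generalizing D D' p q H H'
    · exact this (fun c hc => by
        obtain ⟨p, q, H, H', hpq, hP, hP'⟩ := h c hc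
        exact ⟨q, p, H', H, hpq.symm, hP', hP⟩) (fun s hs => (hD s hs).symm) q p H' H hpq.symm
        hP' hP (by omega)
    have hun : ∀ l : ℤ, 0 ≤ l → l < C.len → C.IsActive S (c l) →
        Unresolved C.len p q H H' l := by
      intro l hl hln hact
      obtain ⟨s, hs, hr⟩ := hG.isActive_iff.1 hact
      exact hP.unresolved hP' hpq hH (hD s hs) hl hln hr
    exact not_unresolved_triple ha0 hab hbn h1 h2 h3 hP.nonneg hP.lt hP'.nonneg hP'.lt hpq hH
      (hun 0 le_rfl (by omega) h0) (hun a (by omega) (by omega) ha)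
      (hun b (by omega) (by omega) hb)
  · obtain ⟨c, hc, hlab, hkn, h0, hkact, hall⟩ := hcan.exists_param
    obtain ⟨p, q, H, H', hpq, hP, hP'⟩ := h c hc
    rcases le_total H' H with hH | hH
    · exact exists_ne_of_profile_of_le hG hgood hS hcan hc hlab h0 hkact hall (by omega) hP hP'
        hpq hH
    · obtain ⟨s, hs, hne⟩ := exists_ne_of_profile_of_le hG hgood hS hcan hc hlab h0 hkact hall
        (by omega) hP' hP hpq.symm hH
      exact ⟨s, hs, hne.symm⟩

end Profile

end Cactus

/-! ### Objects that no cycle separates. -/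

namespace Cactus

open SimpleGraph

section Bridges

variable {V : Type*} {G : SimpleGraph V} {S : Finset V} {κ : Kind}

/-- An edge on no cycle is crossed by the shortest paths between its two sides. -/
theorem OffCycles.dist_eq_or (hconn : G.Connected) {x z : V} (hxz : G.Adj x z)
    (hoff : OffCycles G x z) (s : V) : G.dist s x = G.dist s z + 1 ∨
      ∀ y, G.dist z y < G.dist x y → G.dist s y = G.dist s x + G.dist x y := by
  by_cases hs : s ∈ branch G x z
  · left
    rw [dist_eq_of_mem_branch hconn (hoff.not_mem_branch hxz hs) (mem_branch_self hxz.ne),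
      dist_eq_one_iff_adj.2 hxz.symm]
  · right
    intro y hy
    refine dist_eq_of_mem_branch hconn hs ?_
    by_contra hyb
    have := dist_eq_of_mem_branch hconn hyb (mem_branch_self hxz.ne')
    rw [dist_comm, dist_comm (u := y)] at this
    omega

/-- The first step from `x` towards `y` is a bridge, since a step on a cycle would separate the
roots. Every landmark lies beyond it, as otherwise `y` would be farther than `x`. The same holds
from `y`, so both ends move inward with all hypotheses preserved, and by induction they meet in a
vertex of which `x` and `y` are shadows. -/
theorem eq_of_not_separated [Finite V] (hG : IsCactus G) (hS : HasUniqueShadows G κ S)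
    (hne : S.Nonempty) {x y : V} (hroot : ∀ C : Cycle G, C.root x = C.root y)
    (heq : ∀ s ∈ S, G.dist s x = G.dist s y) : x = y := by
  have _ := Fintype.ofFinite V
  induction hm : G.dist x y using Nat.strong_induction_on generalizing x y with
  | _ m ih =>
  by_contra hxy
  have toward : ∀ x y, x ≠ y → (∀ C : Cycle G, C.root x = C.root y) →
      (∀ s ∈ S, G.dist s x = G.dist s y) → ∀ z, G.Adj x z → G.dist z y + 1 = G.dist x y →
      OffCycles G x z ∧ ∀ s ∈ S, G.dist s x = G.dist s z + 1 := by
    intro x y hxy hroot heq z hz hd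
    have hoff : OffCycles G x z := by
      intro C hC
      refine hG.not_adj_of_dist_lt (C := C) (v := x) (x := y) (z := z) ?_ (by omega) hC
      rw [← hroot C, hG.root_self hC.fst_mem]
    refine ⟨hoff, fun s hs => (hoff.dist_eq_or hG.1 hz s).resolve_right fun h => ?_⟩
    have h1 := h y (by omega)
    have h2 := heq s hs
    have := hG.1.pos_dist_of_ne hxy
    omega
  obtain ⟨z, hz, hd⟩ := exists_adj_dist_lt hG.1 (v := x) (x := y) (Ne.symm hxy)
  obtain ⟨hoff, hsz⟩ := toward x y hxy hroot heq z hz hd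
  by_cases hzy : z = y
  · subst hzy
    obtain ⟨s, hs⟩ := hne
    have := hsz s hs
    have := heq s hs
    omega
  obtain ⟨w, hw, hd'⟩ := exists_adj_dist_lt hG.1 (v := y) (x := z) hzy
  have hwx : G.dist w x + 1 = G.dist y x := by
    have h1 := hG.1.dist_triangle (u := w) (v := z) (w := x)
    have h2 := hG.1.dist_triangle (u := y) (v := w) (w := x)
    rw [dist_eq_one_iff_adj.2 hz.symm] at h1
    rw [dist_eq_one_iff_adj.2 hw] at h2
    rw [dist_comm (u := y) (v := z)] at hd'
    rw [dist_comm (u := y) (v := x)] at *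
    omega
  obtain ⟨hoff', hsw⟩ := toward y x (Ne.symm hxy) (fun C => (hroot C).symm)
    (fun s hs => (heq s hs).symm) w hw hwx
  have hzw : z = w := by
    refine ih (G.dist z w) ?_ (fun C => ?_) (fun s hs => ?_) rfl
    · rw [dist_comm (u := z) (v := w)]
      rw [dist_comm (u := y) (v := z)] at hd'
      omega
    · rw [hG.root_eq_of_adj hz (hoff C), hG.root_eq_of_adj hw (hoff' C), hroot C]
    · have h1 := hsz s hs
      have h2 := hsw s hs
      have h3 := heq s hs
      omega
  subst hzw
  refine hxy (hS z x y ⟨hz.symm, fun s hs => ?_⟩ ⟨hw.symm, fun s hs => ?_⟩)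
  · rw [hsz s hs]; exact κ.beyond_succ _
  · rw [hsw s hs]; exact κ.beyond_succ _

theorem exists_minimal_ends {a b c d : V} : ∃ a' b' c' d',
    s(a', b') = s(a, b) ∧ s(c', d') = s(c, d) ∧ G.dist b' c' ≤ G.dist a' c' ∧
      G.dist b' c' ≤ G.dist a' d' ∧ G.dist b' c' ≤ G.dist b' d' := by
  by_contra! h
  have h1 := h a b c d rfl rfl
  have h2 := h a b d c rfl Sym2.eq_swap
  have h3 := h b a c d Sym2.eq_swap rfl
  have h4 := h b a d c Sym2.eq_swap Sym2.eq_swap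
  omega

/-- With the nearest ends `b'` and `c'` facing each other, all landmarks lie on the inner side of
both bridges. Then `b'` and `c'` are equidistant from every landmark, hence equal, and `a'` and `d'`
are two shadows of that vertex. -/
theorem eq_of_edgeDist_eq [Fintype V] (hG : IsCactus G) (hS : HasUniqueShadows G .edge S)
    (hne : S.Nonempty) {a b c d : V} (hab : G.Adj a b) (hcd : G.Adj c d) (ho : OffCycles G a b)
    (ho' : OffCycles G c d) (hroot : ∀ C : Cycle G, C.root a = C.root c)
    (heq : ∀ s ∈ S, edgeDist G s s(a, b) = edgeDist G s s(c, d)) : s(a, b) = s(c, d) := by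
  obtain ⟨a', b', c', d', e1, e2, m1, m2, m3⟩ := exists_minimal_ends (G := G) (a := a) (b := b)
    (c := c) (d := d)
  have hab' : G.Adj a' b' ∧ OffCycles G a' b' ∧ ∀ C : Cycle G, C.root b' = C.root a := by
    rcases Sym2.eq_iff.1 e1 with ⟨rfl, rfl⟩ | ⟨rfl, rfl⟩
    · exact ⟨hab, ho, fun C => hG.root_eq_of_adj hab (ho C)⟩
    · exact ⟨hab.symm, ho.symm, fun C => rfl⟩
  have hcd' : G.Adj c' d' ∧ OffCycles G c' d' ∧ ∀ C : Cycle G, C.root c' = C.root c := by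
    rcases Sym2.eq_iff.1 e2 with ⟨rfl, rfl⟩ | ⟨rfl, rfl⟩
    · exact ⟨hcd, ho', fun C => rfl⟩
    · exact ⟨hcd.symm, ho'.symm, fun C => hG.root_eq_of_adj hcd (ho' C)⟩
  rw [← e1, ← e2] at heq ⊢
  obtain ⟨hab, ho, hr⟩ := hab'
  obtain ⟨hcd, ho', hr'⟩ := hcd'
  by_contra hef
  have n1 := ho.dist_ne hG.1 hab c'
  have n2 := ho'.dist_ne hG.1 hcd b'
  have n3 := ho.dist_ne hG.1 hab d'
  rw [dist_comm (u := c'), dist_comm (u := c')] at n1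
  rw [dist_comm (u := d'), dist_comm (u := d')] at n3
  have dcd := dist_eq_one_iff_adj.2 hcd
  have dcd' := dist_eq_one_iff_adj.2 hcd.symm
  have dab := dist_eq_one_iff_adj.2 hab
  have t1 := dist_le_dist_add_one hG.1 hcd b'
  -- Otherwise the bridge `a'b'` separates `c'` from `d'`, and the two edges coincide.
  have hbd : G.dist b' d' < G.dist a' d' := by
    by_contra hlt
    have h1 := ho.dist_eq_or hG.1 hab d'
    rw [dist_comm (u := d') (v := a'), dist_comm (u := d') (v := b')] at h1
    rcases h1 with h1 | h1
    · omega
    · have h2 := h1 c' (by omega)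
      rw [dcd'] at h2
      have hbc : b' = c' := hG.1.dist_eq_zero_iff.1 (by omega)
      have had : a' = d' := hG.1.dist_eq_zero_iff.1 (by omega)
      exact hef (by rw [hbc, had, Sym2.eq_swap])
  have hca : G.dist c' a' < G.dist d' a' := by
    by_contra hlt
    rw [dist_comm (u := c'), dist_comm (u := d')] at hlt
    have t2 := dist_le_dist_add_one hG.1 hab.symm c'
    rw [dist_comm (u := c'), dist_comm (u := c')] at t2
    have n4 := ho'.dist_ne hG.1 hcd a'
    omega
  have hsa : ∀ s ∈ S, G.dist s a' = G.dist s b' + 1 := by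
    intro s hs
    refine (ho.dist_eq_or hG.1 hab s).resolve_right fun h => ?_
    have h1 := h c' (by omega)
    have h2 := h d' hbd
    have h3 := heq s hs
    rw [edgeDist_mk, edgeDist_mk] at h3
    omega
  have hsd : ∀ s ∈ S, G.dist s d' = G.dist s c' + 1 := by
    intro s hs
    refine (ho'.symm.dist_eq_or hG.1 hcd.symm s).resolve_right fun h => ?_
    have h1 := h a' hca
    have h2 := h b' (by rw [dist_comm, dist_comm (u := d')]; omega)
    have h3 := heq s hs
    rw [dist_comm (u := d') (v := b')] at h2
    rw [edgeDist_mk, edgeDist_mk] at h3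
    omega
  obtain rfl : b' = c' := by
    refine eq_of_not_separated hG hS hne (fun C => ?_) fun s hs => ?_
    · rw [hr C, hr' C, hroot C]
    · have h1 := hsa s hs
      have h2 := hsd s hs
      have h3 := heq s hs
      rw [edgeDist_mk, edgeDist_mk] at h3
      omega
  have : a' = d' := by
    refine hS b' _ _ ⟨hab.symm, fun s hs => ?_⟩ ⟨hcd, fun s hs => ?_⟩
    · rw [hsa s hs]; exact Kind.beyond_succ _ _
    · rw [hsd s hs]; exact Kind.beyond_succ _ _
  rw [this] at hef
  exact hef Sym2.eq_swap

end Bridges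

variable {V : Type*} [Fintype V] {G : SimpleGraph V} [DecidableRel G.Adj] {S : Finset V} {κ : Kind}

/-- With no landmark every neighbour is a shadow, so all degrees are at most one. -/
theorem HasUniqueShadows.nonempty (hG : IsCactus G) (hS : HasUniqueShadows G κ S)
    (hpath : IsEmpty (G ≃g pathGraph (Fintype.card V))) : S.Nonempty := by
  rw [Finset.nonempty_iff_ne_empty]
  rintro rfl
  have hdeg : ∀ x, G.degree x ≤ 1 := by
    intro x
    by_contra! h
    obtain ⟨y, hy, z, hz, hyz⟩ := Finset.one_lt_card.1 h
    rw [mem_neighborFinset] at hy hz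
    exact hyz (hS x y z ⟨hy, by simp⟩ ⟨hz, by simp⟩)
  obtain ⟨u⟩ := hG.1.nonempty
  obtain ⟨e⟩ := nonempty_iso_pathGraph hG.1 (fun x => (hdeg x).trans (by omega)) (hdeg u)
  exact hpath.false e

theorem IsGood.isVertexGenerator (hG : IsCactus G) (h : IsGood G .vertex S)
    (hpath : ∀ n, 2 ≤ n → IsEmpty (G ≃g pathGraph n)) : IsVertexGenerator G S := by
  have hS := h.hasUniqueShadows hG fun n hn => hpath n (by omega)
  intro x y hxy
  by_cases hsep : ∃ C : Cycle G, C.root x ≠ C.root y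
  · obtain ⟨C, hC⟩ := hsep
    obtain ⟨s, hs, hne⟩ := exists_ne_of_profile hG h hS C (D := fun s => 2 * G.dist s x)
      (D' := fun s => 2 * G.dist s y) fun c hc => by
        obtain ⟨i, hi0, hin, hi, hP⟩ := hG.exists_profile_vertex hc S x
        obtain ⟨j, hj0, hjn, hj, hP'⟩ := hG.exists_profile_vertex hc S y
        refine ⟨_, _, _, _, fun e => hC ?_, hP, hP'⟩
        rw [← hi, ← hj, show i = j by omega]
    exact ⟨s, hs, fun e => hne (by simp [e])⟩
  · push Not at hsep
    by_contra! hD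
    refine hxy (eq_of_not_separated hG hS (hS.nonempty hG (hpath _ ?_)) hsep hD)
    exact Fintype.one_lt_card_iff.2 ⟨x, y, hxy⟩

theorem IsGood.isEdgeGenerator (hG : IsCactus G) (h : IsGood G .edge S)
    (hpath : ∀ n, 3 ≤ n → IsEmpty (G ≃g pathGraph n)) : IsEdgeGenerator G S := by
  classical
  have hS := h.hasUniqueShadows hG hpath
  rintro ⟨a, b⟩ hab ⟨c, d⟩ hcd hne
  change G.Adj a b at hab
  change G.Adj c d at hcd
  change s(a, b) ≠ s(c, d) at hne
  change ∃ s ∈ S, edgeDist G s s(a, b) ≠ edgeDist G s s(c, d)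
  by_cases hsep : ∃ C : Cycle G, C.1.Adj a b ∨ C.1.Adj c d ∨ C.root a ≠ C.root c
  · obtain ⟨C, hC⟩ := hsep
    obtain ⟨s, hs, hne⟩ := exists_ne_of_profile hG h hS C
      (D := fun s => 2 * edgeDist G s s(a, b) + 1) (D' := fun s => 2 * edgeDist G s s(c, d) + 1)
      fun r hr => by
        obtain ⟨p, H, hP, h1⟩ := hG.exists_profile_edge hr S hab
        obtain ⟨q, H', hP', h2⟩ := hG.exists_profile_edge hr S hcd
        refine ⟨p, q, H, H', ?_, hP, hP'⟩
        rintro rfl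
        rcases h1 with ⟨h1, i, -, -, hi, hi'⟩ | ⟨h1, i, -, -, hi, hi'⟩ <;>
          rcases h2 with ⟨h2, j, -, -, hj, hj'⟩ | ⟨h2, j, -, -, hj, hj'⟩
        · obtain rfl : i = j := by omega
          exact hne (hi'.trans hj'.symm)
        · omega
        · omega
        · obtain rfl : i = j := by omega
          exact (hC.resolve_left h1).resolve_left h2 (hi'.symm.trans hj')
    exact ⟨s, hs, fun e => hne (by simp [e])⟩
  · push Not at hsep
    by_contra! hD
    refine hne (eq_of_edgeDist_eq hG hS (hS.nonempty hG (hpath _ ?_)) hab hcd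
      (fun C => (hsep C).1) (fun C => (hsep C).2.1) (fun C => (hsep C).2.2) hD)
    -- Two distinct edges span at least three vertices, so the path exclusion applies.
    by_contra! hlt
    have hcov : ∀ x y z : V, x ≠ y → z = x ∨ z = y := by
      intro x y z hxy
      by_contra! hz
      have := Finset.card_le_univ ({x, y, z} : Finset V)
      rw [Finset.card_eq_three.2 ⟨x, y, z, hxy, hz.1.symm, hz.2.symm, rfl⟩] at this
      omega
    have h1 := hcov a b c hab.ne
    have h2 := hcov a b d hab.ne
    have h3 := hcd.ne
    rcases h1 with rfl | rfl <;> rcases h2 with rfl | rfl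
    · exact h3 rfl
    · exact hne rfl
    · exact hne Sym2.eq_swap
    · exact h3 rfl

end Cactus

/-! ### Dependence of configurations on the set. -/

namespace Cactus

open SimpleGraph

section Congr

variable {V : Type*} {G : SimpleGraph V} {C : Cycle G} {S S' : Finset V} {κ : Kind}

theorem Cycle.IsCritical.congr (h : ∀ v, C.IsActive S v ↔ C.IsActive S' v) {v : V}
    (hv : C.IsCritical κ S v) : C.IsCritical κ S' v := by
  simpa only [Cycle.IsCritical, Cycle.IsSPath, Cycle.IsCoveringPath, h] using hv

theorem Cycle.IsCritical.mem_verts {v : V} (h : C.IsCritical κ S v) : v ∈ C.1.verts := by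
  obtain ⟨c, k, hc, rfl, -⟩ := h.exists_param
  exact hc.mem 0

theorem Labelling.IsCanonical.congr (h : ∀ v, C.IsActive S v ↔ C.IsActive S' v)
    {lab : Labelling C} {k : ℕ} (hk : lab.IsCanonical S k) : lab.IsCanonical S' k := by
  simpa only [Labelling.IsCanonical, Labelling.HasMaxActive, h] using hk

theorem Cycle.numActive_congr (h : ∀ v, C.IsActive S v ↔ C.IsActive S' v) :
    C.numActive S = C.numActive S' := by
  simp only [Cycle.numActive, h]

theorem Cycle.IsActive.mono (hS : S ⊆ S') {v : V} (h : C.IsActive S v) : C.IsActive S' v :=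
  ⟨h.1, h.2.imp fun _ hs => ⟨hS hs.1, hs.2⟩⟩

theorem HasGeodesicTriple.mono (hS : S ⊆ S') (h : HasGeodesicTriple C S) :
    HasGeodesicTriple C S' := by
  obtain ⟨c, p, q, hc, h0, hp, hq, h⟩ := h
  exact ⟨c, p, q, hc, h0.mono hS, hp.mono hS, hq.mono hS, h⟩

/-- For active vertices at indices `0` and `j ≤ g/2`, the index `⌊g/2⌋ + 1` is the first past the
half; all three gaps are then at most `g/2`. -/
theorem exists_hasGeodesicTriple [DecidableEq V] (h2 : 2 ≤ C.numActive S) :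
    ∃ w ∈ C.1.verts, HasGeodesicTriple C (insert w S) := by
  have h3 := C.three_le_len
  obtain ⟨c, j, hc, h0, hj, hj0, hjn⟩ : ∃ (c : ℤ → V) (j : ℤ), Param C c ∧ C.IsActive S (c 0) ∧
      C.IsActive S (c j) ∧ 0 < j ∧ 2 * j ≤ C.len := by
    obtain ⟨c, hc⟩ := C.exists_param
    obtain ⟨a, ha, -⟩ := Cycle.exists_active_ne h2 (c 0)
    obtain ⟨b, hb, hab⟩ := Cycle.exists_active_ne h2 a
    obtain ⟨c, hc, rfl⟩ := Cycle.exists_param_zero ha.1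
    obtain ⟨j, hj0, hjn, rfl⟩ := hc.exists_rep 0 hb.1
    have hj : 0 < j := lt_of_le_of_ne hj0 (by rintro rfl; exact hab rfl)
    by_cases hjn' : 2 * j ≤ C.len
    · exact ⟨c, j, hc, ha, hb, hj, hjn'⟩
    · refine ⟨_, C.len - j, hc.reflect 0, by simpa using ha, ?_, by omega, by omega⟩
      have := hc.add_len (j - C.len)
      rw [sub_add_cancel] at this
      simpa [← this] using hb
  have hsub : S ⊆ insert (c (C.len / 2 + 1 : ℕ)) S := Finset.subset_insert _ _
  exact ⟨_, hc.mem _, c, j, (C.len / 2 + 1 : ℕ), hc, h0.mono hsub, hj.mono hsub,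
    ⟨hc.mem _, _, Finset.mem_insert_self _ _, C.mem_comp_self _⟩, hj0, by omega, by omega, hjn,
    by omega, by omega⟩

theorem IsCactus.isCritical_end (hG : IsCactus G) {c : ℤ → V} (hc : Param C c) {k i : ℕ}
    (h0 : C.IsActive S (c 0)) (hk : C.IsActive S (c k)) (hall : ActiveWithin C S c k)
    (hkb : k ≤ κ.critBound C.len) (hi : i = 0 ∨ i = k) : C.IsCritical κ S (c i) := by
  rcases hi with rfl | rfl
  · exact hG.isCritical_of_short hc h0 hk hall hkb
  · have := hG.isCritical_of_short (κ := κ) (hc.reflect i) (by simpa using hk) (by simpa using h0)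
      hall.reflect hkb
    simpa using this

end Congr

variable {V : Type*} [Fintype V] {G : SimpleGraph V} [DecidableRel G.Adj] {C : Cycle G}
  {S S' : Finset V} {κ : Kind}

/-- The configurations depend only on the active vertices, on the free threads at inactive
vertices, and on the existence of free threads at critical vertices. -/
theorem Cycle.ContainsConfig.transfer (hG : IsCactus G)
    (hact : ∀ v, C.IsActive S v ↔ C.IsActive S' v)
    (hthr : ∀ v ∈ C.1.verts, ¬ C.IsActive S v → ∀ l, IsFreeThread G S v l → IsFreeThread G S' v l)
    (hcrit : ∀ v l, C.IsCritical κ S v → IsFreeThread G S v l → ∃ l', IsFreeThread G S' v l')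
    (h : C.ContainsConfig κ S) : C.ContainsConfig κ S' := by
  have h3 := C.three_le_len
  rw [Cycle.containsConfig_iff] at h ⊢
  obtain ⟨lab, k, hcan, h⟩ := h
  refine ⟨lab, k, hcan.congr hact, ?_⟩
  have hnum := Cycle.numActive_congr hact
  obtain ⟨c, hc, hlab, hkn, h0, hk, hall⟩ := hcan.exists_param
  have hidx : ∀ i : ℕ, i < C.len → C.IsActive S (c i) → i ≤ k := by
    intro i hi hia
    obtain ⟨j, hj0, hjk, hj⟩ := hall _ hia
    have := hc.inj hj (by omega) (by omega)
    omega
  have hcritBound := κ.critBound_lt C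
  have hthread : k ≤ κ.critBound C.len → ∀ i l, (i = 0 ∨ i = k) →
      IsFreeThread G S (lab.vert i) l → lab.ConfigThread κ S' k := by
    intro hkb i l hi hl
    rw [hlab i (by omega)] at hl
    obtain ⟨l', hl'⟩ := hcrit _ _ (hG.isCritical_end hc h0 hk hall hkb hi) hl
    refine ⟨hkb, i, l', ?_, by omega⟩
    rwa [hlab i (by omega)]
  have hfree : ∀ (i : ℕ) l, i < C.len → ¬ C.IsActive S (c i) → IsFreeThread G S (lab.vert i) l →
      IsFreeThread G S' (lab.vert i) l := by
    intro i l hi hia hl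
    rw [hlab i hi.le] at hl ⊢
    exact hthr _ (hc.mem i) hia l hl
  have hends : C.numActive S = 2 → ∀ i : ℕ, i ≤ k → C.IsActive S (c i) → i = 0 ∨ i = k := by
    intro htwo i hik hia
    have hpos := hcan.pos htwo.ge
    rcases Cycle.eq_or_eq_of_numActive htwo h0 hk (fun e => by
      have := hc.inj e (by omega) (by omega)
      omega) hia with e | e
    · have := hc.inj e (by omega) (by omega); omega
    · have := hc.inj e (by omega) (by omega); omega
  rcases h with ⟨htwo, hA⟩ | ⟨hkb, i, l, hl, hi⟩ | h
  · exact Or.inl ⟨hnum ▸ htwo, hA⟩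
  · by_cases hia : C.IsActive S (c i)
    · have := hidx i (by omega) hia
      exact Or.inr (Or.inl (hthread hkb i l (by omega) hl))
    · exact Or.inr (Or.inl ⟨hkb, i, l, hfree i l (by omega) hia hl, hi⟩)
  · cases κ with
    | vertex =>
      obtain ⟨htwo, heven, hkn2, i, l, hik, hl, hlen⟩ := h
      -- A free thread at an active vertex sits at index `0` or `k`, where it already gives ℬ unless
      -- `k = g/2`, which is 𝒜. So length matters only for threads at inactive vertices, which carry
      -- over unchanged.
      by_cases hA : k = C.len / 2
      · exact Or.inl ⟨hnum ▸ htwo, heven, hA⟩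
      by_cases hia : C.IsActive S (c i)
      · exact Or.inr (Or.inl (hthread (by simp only [Kind.critBound]; omega) i l
          (hends htwo i hik hia) hl))
      · exact Or.inr (Or.inr ⟨hnum ▸ htwo, heven, hkn2, i, l, hik,
          hfree i l (by omega) hia hl, hlen⟩)
    | edge =>
      obtain ⟨htwo, i, l, hik, hl, hlen, hj⟩ := h
      have hk2 := hcan.two_mul_le htwo
      by_cases hA : 2 * k = C.len
      · exact Or.inl ⟨hnum ▸ htwo, ⟨k, by omega⟩, by omega⟩
      by_cases hia : C.IsActive S (c i)
      · exact Or.inr (Or.inl (hthread (by simp only [Kind.critBound]; omega) i l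
          (hends htwo i hik hia) hl))
      · refine Or.inr (Or.inr ⟨hnum ▸ htwo, i, l, hik, hfree i l (by omega) hia hl, hlen,
          fun heven => ?_⟩)
        obtain ⟨l', hl'⟩ := hj heven
        have heven := Nat.even_iff.1 heven
        have hi0 : i ≠ 0 := by rintro rfl; exact hia h0
        refine ⟨l', hfree _ l' (by omega) (fun hja => ?_) hl'⟩
        have := hidx _ (by omega) hja
        omega

/-- Three active vertices exclude 𝒜, 𝒞 and ℰ, and the short window needed for ℬ and 𝒟 would have a
critical end. -/
theorem HasGeodesicTriple.not_containsConfig (hG : IsCactus G) (h : HasGeodesicTriple C S) :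
    ¬ C.ContainsConfig κ S := by
  rw [Cycle.containsConfig_iff]
  rintro ⟨lab, k, hcan, hconf⟩
  have hthree := h.three_le_numActive
  obtain ⟨c, hc, hlab, hkn, h0, hk, hall⟩ := hcan.exists_param
  rcases hconf with ⟨htwo, -⟩ | ⟨hkb, -⟩ | hconf
  · omega
  · exact h.not_isCritical hG _ (hG.isCritical_of_short hc h0 hk hall hkb)
  · cases κ with
    | vertex => have := hconf.1; omega
    | edge => have := hconf.1; omega

end Cactus

/-! ### Cells and the size of smallest biactive branch-resolving sets. -/

namespace Cactus

open SimpleGraph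

theorem exists_transversal {α V : Type*} {R : α → V → Prop} (hR : ∀ a b x, R a x → R b x → a = b)
    {Q : Set α} {S : Finset V} (h : ∀ a ∈ Q, ∃ x ∈ S, R a x) {r : ℕ} (hr : r ≤ Q.ncard) :
    ∃ T ⊆ S, T.card = r ∧ (∀ x ∈ T, ∃ a ∈ Q, R a x) ∧
      ∃ Q' ⊆ Q, Q'.ncard = r ∧ ∀ a ∈ Q', ∃ x ∈ T, R a x := by
  rcases isEmpty_or_nonempty V with hV | hV
  · have hQ : Q = ∅ := Set.eq_empty_of_forall_notMem fun a ha => (h a ha).elim fun x _ => hV.elim x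
    subst hQ
    have hr0 : r = 0 := by simpa using hr
    exact ⟨∅, by simp, by simp [hr0], by simp, ∅, by simp, by simp [hr0], by simp⟩
  obtain ⟨Q', hQ', hcard⟩ := Set.exists_subset_card_eq hr
  choose! f hfS hfR using h
  have hinj : Set.InjOn f Q' := fun a ha b hb hab =>
    hR a b (f a) (hfR a (hQ' ha)) (hab ▸ hfR b (hQ' hb))
  have hsub : f '' Q' ⊆ S := by
    rintro _ ⟨a, ha, rfl⟩
    exact hfS a (hQ' ha)
  have hfin : (f '' Q').Finite := S.finite_toSet.subset hsub
  refine ⟨hfin.toFinset, ?_, ?_, ?_, Q', hQ', hcard, fun a ha => ?_⟩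
  · intro x hx
    exact hsub (hfin.mem_toFinset.1 hx)
  · rw [← Set.ncard_eq_toFinset_card _ hfin, hinj.ncard_image, hcard]
  · intro x hx
    obtain ⟨a, ha, rfl⟩ := hfin.mem_toFinset.1 hx
    exact ⟨a, hQ' ha, hfR a (hQ' ha)⟩
  · exact ⟨f a, hfin.mem_toFinset.2 ⟨a, ha, rfl⟩, hfR a (hQ' ha)⟩

variable {V : Type*} [Fintype V] {G : SimpleGraph V} [DecidableRel G.Adj] {C : Cycle G}
  {S S' : Finset V} {κ : Kind}

theorem IsThread.ne_nil {v : V} {l : List V} (h : IsThread G v l) : l ≠ [] := by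
  obtain ⟨-, -, -, u, t, rfl, -⟩ := h
  simp

theorem finite_threads (G : SimpleGraph V) [DecidableRel G.Adj] (v : V) :
    {l | IsThread G v l}.Finite := by
  have : Nonempty V := ⟨v⟩
  have : ∀ l ∈ {l | IsThread G v l}, ∃ x ∈ (Finset.univ : Finset V), x ∈ l := fun l hl => by
    obtain ⟨x, hx⟩ := List.exists_mem_of_ne_nil l hl.ne_nil
    exact ⟨x, Finset.mem_univ _, hx⟩
  choose! f hf hfl using this
  exact Set.Finite.of_injOn (f := f) (t := Set.univ) (fun _ _ => Set.mem_univ _)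
    (fun a ha b hb hab => (ha.eq_of_mem hb (hfl a ha) (hab ▸ hfl b hb)).2) (Set.toFinite _)

theorem IsThread.root_eq (hG : IsCactus G) {v : V} {l : List V} (h : IsThread G v l) {x : V}
    (hx : x ∈ l) (C : Cycle G) : C.root x = C.root v := by
  obtain ⟨z, hzl, hvz, hz⟩ := h.exists_branch
  refine branch_induction (P := fun x => C.root x = C.root v) ?_ ?_ ((hz x).1 hx)
  · exact hG.root_eq_of_adj hvz fun hC => h.not_mem_verts hzl C hC.snd_mem
  · intro a b ha hroot hab hb
    rw [← hroot]
    exact hG.root_eq_of_adj hab fun hC => h.not_mem_verts ((hz a).2 ha) C hC.fst_mem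

/-- Either `D` passes through the root, which then has degree four, or the vertex of `D` facing `C`
has a third edge. -/
theorem IsCactus.isBranchActive_root (hG : IsCactus G) {C D : Cycle G} (hCD : C ≠ D) {x : V}
    (hx : x ∈ D.1.verts) : C.IsBranchActive (C.root x) := by
  refine ⟨hG.root_mem C x, ?_⟩
  by_cases hu : C.root x ∈ D.1.verts
  · left
    obtain ⟨a, b, hab, ha, hb, -⟩ := Cycle.exists_nbrs hu
    exact Cycle.four_le_degree (C := C) (hG.root_mem C x) ha.adj_sub
      (fun h => hCD (hG.eq_of_adj h ha)) hb.adj_sub (fun h => hCD (hG.eq_of_adj h hb)) hab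
  · right
    have hne : D.root (C.root x) ≠ C.root x := fun e => hu (e ▸ hG.root_mem D _)
    refine ⟨D.root (C.root x), ?_, hne, ?_⟩
    · rw [hG.mem_comp_iff (hG.root_mem C x)]
      exact hG.root_eq_root hCD (hG.root_mem D _) hx
    · obtain ⟨z, hz, hz', -⟩ := Cycle.exists_branch (hG.mem_comp_root D (C.root x)) hne.symm
      exact Cycle.three_le_degree (hG.root_mem D _) hz hz'

/-- Two threads and two cycle edges would give degree four. Consequently the cells of vertices may
ignore vertices that fail to be branch-active on a cycle: nothing is required there. -/
theorem numThreads_le_one {v : V} (hv : v ∈ C.1.verts) (h : ¬ C.IsBranchActive v) :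
    numThreads G v ≤ 1 := by
  rw [numThreads, Set.ncard_le_one (finite_threads G v)]
  intro l hl l' hl'
  by_contra hne
  obtain ⟨z, hzl, hvz, -⟩ := hl.exists_branch
  obtain ⟨z', hzl', hvz', -⟩ := hl'.exists_branch
  refine h ⟨hv, Or.inl (Cycle.four_le_degree hv hvz (fun hC => ?_) hvz' (fun hC => ?_) ?_)⟩
  · exact hl.not_mem_verts hzl C hC.snd_mem
  · exact hl'.not_mem_verts hzl' C hC.snd_mem
  · rintro rfl
    exact hne (hl.eq_of_mem hl' hzl hzl').2

/-! ### Cells -/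

open Classical in
/-- The disjoint vertex sets in which the threads at a vertex and the activity on a cycle are
decided. -/
noncomputable def cell (G : SimpleGraph V) [DecidableRel G.Adj] : V ⊕ Cycle G → Finset V
  | .inl v => {x | (∃ l, IsThread G v l ∧ x ∈ l) ∧ ∀ C : Cycle G, v ∈ C.1.verts →
      C.IsBranchActive v}
  | .inr C => {x | ¬ C.IsBranchActive (C.root x)}

/-- The number of elements that a biactive branch-resolving set needs in a cell. -/
noncomputable def cellRank (G : SimpleGraph V) [DecidableRel G.Adj] : V ⊕ Cycle G → ℕ
  | .inl v => numThreads G v - 1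
  | .inr C => 2 - C.numBranchActive

/-- The requirement on a biactive branch-resolving set in a cell. -/
def Satisfies (G : SimpleGraph V) [DecidableRel G.Adj] (S : Finset V) : V ⊕ Cycle G → Prop
  | .inl v => {l | IsFreeThread G S v l}.Subsingleton
  | .inr C => 2 ≤ {v | C.IsBranchActive v ∨ C.IsActive S v}.ncard

theorem mem_cell_inl {v x : V} : x ∈ cell G (.inl v) ↔ (∃ l, IsThread G v l ∧ x ∈ l) ∧
    ∀ C : Cycle G, v ∈ C.1.verts → C.IsBranchActive v := by
  simp [cell]

theorem mem_cell_inr {x : V} : x ∈ cell G (.inr C) ↔ ¬ C.IsBranchActive (C.root x) := by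
  simp [cell]

theorem IsFreeThread.anti (hS : S ⊆ S') {v : V} {l : List V} (h : IsFreeThread G S' v l) :
    IsFreeThread G S v l :=
  ⟨h.1, fun x hx hxS => h.2 x hx (hS hxS)⟩

theorem Satisfies.mono (hS : S ⊆ S') {i : V ⊕ Cycle G} (h : Satisfies G S i) :
    Satisfies G S' i := by
  cases i with
  | inl v => exact Set.Subsingleton.anti h fun l hl => IsFreeThread.anti hS hl
  | inr C =>
    exact le_trans h (Set.ncard_le_ncard (fun v hv => hv.imp_right fun h => h.mono hS)
      (Set.toFinite _))

/-- Biactivity itself is not local; the weak form grants branch-active vertices for free and can be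
decided in the cell of the cycle. -/
theorem isBBR_iff (hG : IsCactus G) :
    (IsBiactive G S ∧ IsBranchResolving G S) ↔ ∀ i, Satisfies G S i := by
  constructor
  · rintro ⟨hbi, hbr⟩ (v | C)
    · exact hbr v
    · exact hbi.isWeaklyBiactive C
  · intro h
    have hbr : IsBranchResolving G S := fun v => h (.inl v)
    exact ⟨IsWeaklyBiactive.isBiactive hG hbr fun C => h (.inr C), hbr⟩

/-- At a vertex, representatives of all but one thread suffice; at a cycle, landmarks behind `2 -
b(C)` active vertices that are not branch-active. The objects represented are disjoint, so the
representatives are distinct. -/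
theorem Satisfies.exists_subset (hG : IsCactus G) {i : V ⊕ Cycle G} (h : Satisfies G S i) :
    ∃ T ⊆ S, T ⊆ cell G i ∧ T.card = cellRank G i ∧ Satisfies G T i := by
  cases i with
  | inl v =>
    by_cases hle : numThreads G v ≤ 1
    · refine ⟨∅, Finset.empty_subset _, Finset.empty_subset _, ?_, ?_⟩
      · simp only [cellRank, Finset.card_empty]; omega
      · intro l hl l' hl'
        rw [numThreads, Set.ncard_le_one (finite_threads G v)] at hle
        exact hle l hl.1 l' hl'.1
    · let Q : Set (List V) := {l | IsThread G v l ∧ ∃ x ∈ S, x ∈ l}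
      have hsub : Q ⊆ {l | IsThread G v l} := fun l hl => hl.1
      have hdiff : ∀ Q' ⊆ {l | IsThread G v l},
          ({l | IsThread G v l} \ Q').ncard + Q'.ncard = numThreads G v := fun Q' hQ' =>
        Set.ncard_sdiff_add_ncard_of_subset hQ' (finite_threads G v)
      have hQ : numThreads G v - 1 ≤ Q.ncard := by
        have h1 := hdiff Q hsub
        have h2 : ({l | IsThread G v l} \ Q).ncard ≤ 1 := by
          rw [Set.ncard_le_one ((finite_threads G v).subset Set.sdiff_subset)]
          have : ∀ l ∈ {l | IsThread G v l} \ Q, IsFreeThread G S v l := fun l hl =>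
            ⟨hl.1, fun x hx hxS => hl.2 ⟨hl.1, x, hxS, hx⟩⟩
          exact fun l hl l' hl' => h (this l hl) (this l' hl')
        omega
      obtain ⟨T, hTS, hTc, hTQ, Q', hQ', hQc, hT⟩ := exists_transversal
        (R := fun l x => IsThread G v l ∧ x ∈ l)
        (fun l l' x h h' => (h.1.eq_of_mem h'.1 h.2 h'.2).2) (Q := Q) (S := S)
        (fun l hl => hl.2.imp fun x hx => ⟨hx.1, hl.1, hx.2⟩) hQ
      refine ⟨T, hTS, fun x hx => ?_, hTc, ?_⟩
      · obtain ⟨l, -, hl⟩ := hTQ x hx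
        refine mem_cell_inl.2 ⟨⟨l, hl⟩, fun C hC => ?_⟩
        by_contra hb
        exact hle (numThreads_le_one hC hb)
      · have h1 := hdiff Q' (hQ'.trans hsub)
        have h2 : ({l | IsThread G v l} \ Q').ncard ≤ 1 := by omega
        rw [Set.ncard_le_one ((finite_threads G v).subset Set.sdiff_subset)] at h2
        have : ∀ l, IsFreeThread G T v l → l ∈ {l | IsThread G v l} \ Q' := fun l hl =>
          ⟨hl.1, fun hlQ => by
            obtain ⟨x, hxT, hx⟩ := hT l hlQ
            exact hl.2 x hx.2 hxT⟩
        exact fun l hl l' hl' => h2 l (this l hl) l' (this l' hl')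
  | inr C =>
    let Q : Set V := {u | ¬ C.IsBranchActive u ∧ C.IsActive S u}
    have hQ : 2 - C.numBranchActive ≤ Q.ncard := by
      have h1 : 2 ≤ ({v | C.IsBranchActive v} ∪ Q).ncard := by
        refine le_trans h (Set.ncard_le_ncard ?_ (Set.toFinite _))
        rintro v (hv | hv)
        · exact Or.inl hv
        · by_cases hb : C.IsBranchActive v
          · exact Or.inl hb
          · exact Or.inr ⟨hb, hv⟩
      have h2 := Set.ncard_union_le {v | C.IsBranchActive v} Q
      unfold Cycle.numBranchActive
      omega
    obtain ⟨T, hTS, hTc, hTQ, Q', hQ', hQc, hT⟩ := exists_transversal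
      (R := fun u x => C.root x = u) (fun u u' x h h' => h.symm.trans h') (Q := Q) (S := S)
      (fun u hu => hG.isActive_iff.1 hu.2) hQ
    refine ⟨T, hTS, fun x hx => ?_, hTc, ?_⟩
    · obtain ⟨u, hu, rfl⟩ := hTQ x hx
      exact mem_cell_inr.2 hu.1
    · have hdisj : Disjoint {v | C.IsBranchActive v} Q' :=
        Set.disjoint_left.2 fun v hv hvQ => (hQ' hvQ).1 hv
      have h1 := Set.ncard_union_eq hdisj (Set.toFinite _) (Set.toFinite _)
      have h2 : ({v | C.IsBranchActive v} ∪ Q').ncard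
          ≤ {v | C.IsBranchActive v ∨ C.IsActive T v}.ncard := by
        refine Set.ncard_le_ncard ?_ (Set.toFinite _)
        rintro v (hv | hv)
        · exact Or.inl hv
        · exact Or.inr (hG.isActive_iff.2 (hT v hv))
      change 2 ≤ _
      unfold Cycle.numBranchActive at hQc
      omega

/-- The cell of a cycle lies behind vertices that are not branch-active. Neither another cycle nor a
degree-three vertex off the cycle can hang there, and a thread at a cycle vertex that is not
branch-active is assigned to the cycle alone. -/
theorem disjoint_cell (hG : IsCactus G) {i j : V ⊕ Cycle G} (hij : i ≠ j) :
    Disjoint (cell G i) (cell G j) := by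
  have key : ∀ v (C : Cycle G), Disjoint (cell G (.inl v)) (cell G (.inr C)) := by
    intro v C
    rw [Finset.disjoint_left]
    intro x hx hxC
    obtain ⟨⟨l, hl, hxl⟩, hb⟩ := mem_cell_inl.1 hx
    rw [mem_cell_inr, hl.root_eq hG hxl C] at hxC
    by_cases hv : v ∈ C.1.verts
    · rw [hG.root_self hv] at hxC
      exact hxC (hb C hv)
    · exact hxC ⟨hG.root_mem C v, Or.inr ⟨v, hG.mem_comp_root C v,
        fun e => hv (e ▸ hG.root_mem C v), hl.1⟩⟩
  rcases i with v | C <;> rcases j with w | D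
  · rw [Finset.disjoint_left]
    intro x hx hx'
    obtain ⟨⟨l, hl, hxl⟩, -⟩ := mem_cell_inl.1 hx
    obtain ⟨⟨l', hl', hxl'⟩, -⟩ := mem_cell_inl.1 hx'
    exact hij (congrArg _ (hl.eq_of_mem hl' hxl hxl').1)
  · exact key v D
  · exact (key w C).symm
  · rw [Finset.disjoint_left]
    intro x hx hx'
    rw [mem_cell_inr] at hx hx'
    have hCD : C ≠ D := fun e => hij (congrArg _ e)
    obtain ⟨c, hc⟩ := C.exists_param
    by_cases hr : D.root x = D.root (c 0)
    · rw [hr] at hx'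
      exact hx' (hG.isBranchActive_root hCD.symm (hc.mem 0))
    · rw [hG.root_root (hc.mem 0) hCD hr] at hx
      exact hx (hG.isBranchActive_root hCD (hG.root_mem D x))

theorem sum_cellRank : ∑ i, cellRank G i = surplusThreads G + missingBranchActive G := by
  rw [Fintype.sum_sum_type]
  simp only [cellRank, surplusThreads, missingBranchActive]
  congr 1
  rw [Finset.sum_filter]
  refine Finset.sum_congr rfl fun v _ => ?_
  split_ifs <;> omega

theorem satisfies_univ (i : V ⊕ Cycle G) : Satisfies G Finset.univ i := by
  cases i with
  | inl v =>
    intro l hl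
    obtain ⟨x, hx⟩ := List.exists_mem_of_ne_nil l hl.1.ne_nil
    exact absurd (Finset.mem_univ x) (hl.2 x hx)
  | inr C =>
    have h3 := C.three_le_len
    have : C.len ≤ {v | C.IsBranchActive v ∨ C.IsActive Finset.univ v}.ncard :=
      Set.ncard_le_ncard (fun v hv => Or.inr ⟨hv, v, Finset.mem_univ _, C.mem_comp_self v⟩)
        (Set.toFinite _)
    change 2 ≤ _
    omega

section Counting

variable [DecidableEq V]

theorem Satisfies.le_card (hG : IsCactus G) {i : V ⊕ Cycle G} (h : Satisfies G S i) :
    cellRank G i ≤ (S ∩ cell G i).card := by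
  obtain ⟨T, hTS, hTc, hcard, -⟩ := h.exists_subset hG
  rw [← hcard]
  exact Finset.card_le_card (Finset.subset_inter hTS hTc)

theorem Satisfies.of_inter_subset (hG : IsCactus G) {i : V ⊕ Cycle G} (h : Satisfies G S i)
    (hS : S ∩ cell G i ⊆ S') : Satisfies G S' i := by
  obtain ⟨T, hTS, hTc, -, hT⟩ := h.exists_subset hG
  exact hT.mono ((Finset.subset_inter hTS hTc).trans hS)

theorem sum_card_inter_cell_le (hG : IsCactus G) (S : Finset V) :
    ∑ i, (S ∩ cell G i).card ≤ S.card := by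
  rw [← Finset.card_biUnion]
  · exact Finset.card_le_card (Finset.biUnion_subset.2 fun i _ => Finset.inter_subset_left)
  · intro i _ j _ hij
    exact (disjoint_cell hG hij).mono Finset.inter_subset_right Finset.inter_subset_right

theorem sum_cellRank_le_card (hG : IsCactus G) (h : ∀ i, Satisfies G S i) :
    ∑ i, cellRank G i ≤ S.card :=
  (Finset.sum_le_sum fun i _ => (h i).le_card hG).trans (sum_card_inter_cell_le hG S)

/-- Choosing a sufficient set in each cell. -/
theorem exists_splice (hG : IsCactus G) (F : V ⊕ Cycle G → Finset V)
    (hF : ∀ i, Satisfies G (F i) i) (hcard : ∀ i, (F i ∩ cell G i).card = cellRank G i) :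
    ∃ S, (∀ i, Satisfies G S i) ∧ S.card ≤ ∑ i, cellRank G i ∧
      (∀ i, S ∩ cell G i = F i ∩ cell G i) ∧ ∀ x ∈ S, ∃ i, x ∈ F i := by
  have hinter : ∀ i, (Finset.univ.biUnion fun i => F i ∩ cell G i) ∩ cell G i = F i ∩ cell G i := by
    intro i
    ext x
    simp only [Finset.mem_inter, Finset.mem_biUnion, Finset.mem_univ, true_and]
    constructor
    · rintro ⟨⟨j, hj, hxj⟩, hxi⟩
      by_cases hij : i = j
      · subst hij; exact ⟨hj, hxi⟩
      · exact absurd hxj (Finset.disjoint_left.1 (disjoint_cell hG hij) hxi)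
    · rintro ⟨h1, h2⟩
      exact ⟨⟨i, h1, h2⟩, h2⟩
  refine ⟨Finset.univ.biUnion fun i => F i ∩ cell G i, fun i => ?_, ?_, hinter, ?_⟩
  · refine (hF i).of_inter_subset hG ?_
    rw [← hinter i]
    exact Finset.inter_subset_left
  · exact Finset.card_biUnion_le.trans (Finset.sum_le_sum fun i _ => (hcard i).le)
  · intro x hx
    simp only [Finset.mem_inter, Finset.mem_biUnion, Finset.mem_univ, true_and] at hx
    obtain ⟨i, hi, -⟩ := hx
    exact ⟨i, hi⟩

theorem exists_tight_subset (hG : IsCactus G) (h : ∀ i, Satisfies G S i) :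
    ∃ T ⊆ S, (∀ i, Satisfies G T i) ∧ T.card ≤ ∑ i, cellRank G i := by
  choose F hFS hFc hcard hF using fun i => (h i).exists_subset hG
  obtain ⟨T, hT, hTc, -, hTF⟩ := exists_splice hG F hF fun i => by
    rw [Finset.inter_eq_left.2 (hFc i), hcard i]
  exact ⟨T, fun x hx => (hTF x hx).elim fun i hi => hFS i hi, hT, hTc⟩

theorem isSmallestBBR_iff (hG : IsCactus G) :
    IsSmallestBBR G S ↔ (∀ i, Satisfies G S i) ∧ S.card ≤ ∑ i, cellRank G i := by
  unfold IsSmallestBBR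
  simp only [isBBR_iff hG]
  refine and_congr_right fun hS => ⟨fun h => ?_, fun h S' hS' => ?_⟩
  · obtain ⟨T, -, hT, hTc⟩ := exists_tight_subset hG hS
    exact (h T hT).trans hTc
  · exact h.trans (sum_cellRank_le_card hG hS')

theorem exists_isSmallestBBR_subset (hG : IsCactus G)
    (h : IsBiactive G S ∧ IsBranchResolving G S) : ∃ T ⊆ S, IsSmallestBBR G T := by
  obtain ⟨T, hTS, hT, hTc⟩ := exists_tight_subset hG ((isBBR_iff hG).1 h)
  exact ⟨T, hTS, (isSmallestBBR_iff hG).2 ⟨hT, hTc⟩⟩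

theorem exists_isSmallestBBR (hG : IsCactus G) : ∃ S, IsSmallestBBR G S := by
  obtain ⟨T, -, hT⟩ := exists_isSmallestBBR_subset (S := Finset.univ) hG
    ((isBBR_iff hG).2 satisfies_univ)
  exact ⟨T, hT⟩

theorem IsSmallestBBR.card_eq (hG : IsCactus G) (h : IsSmallestBBR G S) :
    S.card = surplusThreads G + missingBranchActive G := by
  rw [isSmallestBBR_iff hG] at h
  rw [← sum_cellRank]
  exact le_antisymm h.2 (sum_cellRank_le_card hG h.1)

/-- The lower bounds of all cells add up to the cardinality, so each of them is attained. -/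
theorem IsSmallestBBR.card_inter (hG : IsCactus G) (h : IsSmallestBBR G S) (i : V ⊕ Cycle G) :
    (S ∩ cell G i).card = cellRank G i := by
  rw [isSmallestBBR_iff hG] at h
  have hle : ∀ i ∈ Finset.univ, cellRank G i ≤ (S ∩ cell G i).card :=
    fun i _ => (h.1 i).le_card hG
  have heq := (Finset.sum_eq_sum_iff_of_le hle).1 (le_antisymm (Finset.sum_le_sum hle)
    ((sum_card_inter_cell_le hG S).trans h.2))
  exact (heq i (Finset.mem_univ i)).symm

theorem IsSmallestBBR.splice (hG : IsCactus G) {F : V ⊕ Cycle G → Finset V}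
    (hF : ∀ i, IsSmallestBBR G (F i)) :
    ∃ S, IsSmallestBBR G S ∧ ∀ i, S ∩ cell G i = F i ∩ cell G i := by
  obtain ⟨S, hS, hSc, hi, -⟩ := exists_splice hG F
    (fun i => ((isSmallestBBR_iff hG).1 (hF i)).1 i) fun i => (hF i).card_inter hG i
  exact ⟨S, (isSmallestBBR_iff hG).2 ⟨hS, hSc⟩, hi⟩

end Counting

end Cactus

/-! ### Nice sets and the two bounds. -/

namespace Cactus

open SimpleGraph

variable {V : Type*} [Fintype V] {G : SimpleGraph V} [DecidableRel G.Adj] {C : Cycle G}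
  {S S' : Finset V} {κ : Kind}

theorem IsCactus.isBranchActive_of_mem (hG : IsCactus G) {C D : Cycle G} (hCD : C ≠ D) {v : V}
    (hC : v ∈ C.1.verts) (hD : v ∈ D.1.verts) : C.IsBranchActive v := by
  have := hG.isBranchActive_root hCD hD
  rwa [hG.root_self hC] at this

section Cells

variable [DecidableEq V]

theorem Cycle.IsActive.of_inter_subset (hG : IsCactus G)
    (h' : IsBiactive G S' ∧ IsBranchResolving G S') (he : S ∩ cell G (.inr C) ⊆ S') {v : V}
    (h : C.IsActive S v) : C.IsActive S' v := by
  by_cases hb : C.IsBranchActive v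
  · exact hb.isActive hG h'.2 h'.1.isWeaklyBiactive
  · obtain ⟨s, hs, rfl⟩ := hG.isActive_iff.1 h
    exact hG.isActive_iff.2 ⟨s, he (Finset.mem_inter.2 ⟨hs, mem_cell_inr.2 hb⟩), rfl⟩

theorem isActive_congr (hG : IsCactus G) (h : IsBiactive G S ∧ IsBranchResolving G S)
    (h' : IsBiactive G S' ∧ IsBranchResolving G S')
    (he : S ∩ cell G (.inr C) = S' ∩ cell G (.inr C)) (v : V) :
    C.IsActive S v ↔ C.IsActive S' v :=
  ⟨fun hv => hv.of_inter_subset hG h' (he ▸ Finset.inter_subset_left),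
    fun hv => hv.of_inter_subset hG h (he ▸ Finset.inter_subset_left)⟩

theorem IsFreeThread.of_inter_subset (hG : IsCactus G) (he : S' ∩ cell G (.inr C) ⊆ S) {v : V}
    {l : List V} (hv : v ∈ C.1.verts) (hb : ¬ C.IsBranchActive v) (h : IsFreeThread G S v l) :
    IsFreeThread G S' v l := by
  refine ⟨h.1, fun x hx hxS => h.2 x hx (he (Finset.mem_inter.2 ⟨hxS, mem_cell_inr.2 ?_⟩))⟩
  rwa [h.1.root_eq hG hx C, hG.root_self hv]

/-- Hitting every thread at `v` costs one element more than hitting all but one. -/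
theorem cellRank_lt_card (hG : IsCactus G) {v : V} (hv : C.IsBranchActive v) {l : List V}
    (hl : IsThread G v l) (hfree : ∀ l', ¬ IsFreeThread G S v l') :
    cellRank G (.inl v) < (S ∩ cell G (.inl v)).card := by
  obtain ⟨T, hTS, hTc, hT, -⟩ := exists_transversal (R := fun l x => IsThread G v l ∧ x ∈ l)
    (fun l l' x h h' => (h.1.eq_of_mem h'.1 h.2 h'.2).2) (Q := {l | IsThread G v l}) (S := S)
    (fun l hl => by
      by_contra! h
      exact hfree l ⟨hl, fun x hx hxS => h x hxS hl hx⟩) le_rfl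
  have hsub : T ⊆ S ∩ cell G (.inl v) := by
    refine Finset.subset_inter hTS fun x hx => mem_cell_inl.2 ⟨?_, fun D hD => ?_⟩
    · obtain ⟨l, -, hl⟩ := hT x hx
      exact ⟨l, hl⟩
    · by_cases hCD : C = D
      · exact hCD ▸ hv
      · exact hG.isBranchActive_of_mem (Ne.symm hCD) hD hv.1
  have hpos : 0 < {l | IsThread G v l}.ncard :=
    (Set.ncard_pos (finite_threads G v)).2 ⟨l, hl⟩
  have := Finset.card_le_card hsub
  simp only [cellRank, numThreads]
  omega

/-- With equal cells the activity on `C` is the same, and so are the free threads at vertices that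
are not branch-active. The configuration can vanish only if `S'` hits all threads at some critical
branch-active vertex, which takes a surplus element there. -/
theorem exists_critical_of_containsConfig (hG : IsCactus G)
    (h : IsBiactive G S ∧ IsBranchResolving G S) (h' : IsBiactive G S' ∧ IsBranchResolving G S')
    (he : S ∩ cell G (.inr C) = S' ∩ cell G (.inr C)) (hS : C.ContainsConfig κ S)
    (hS' : ¬ C.ContainsConfig κ S') :
    ∃ v, C.IsCritical κ S' v ∧ cellRank G (.inl v) < (S' ∩ cell G (.inl v)).card := by
  by_contra! hcon
  have hact := isActive_congr hG h h' he
  have he' : S' ∩ cell G (.inr C) ⊆ S := he ▸ Finset.inter_subset_left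
  refine hS' (hS.transfer hG hact (fun v hv hna l hl => ?_) fun v l hcrit hl => ?_)
  · exact hl.of_inter_subset hG he' hv fun hb => hna (hb.isActive hG h.2 h.1.isWeaklyBiactive)
  · by_cases hb : C.IsBranchActive v
    · by_contra! hno
      have := cellRank_lt_card hG hb hl.1 hno
      have := hcon v (hcrit.congr hact)
      omega
    · exact ⟨l, hl.of_inter_subset hG he' hcrit.mem_verts hb⟩

theorem IsSmallestBBR.containsConfig_congr (hG : IsCactus G) (h : IsSmallestBBR G S)
    (h' : IsSmallestBBR G S') (he : S ∩ cell G (.inr C) = S' ∩ cell G (.inr C))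
    (hS : C.ContainsConfig κ S) : C.ContainsConfig κ S' := by
  by_contra hS'
  obtain ⟨v, -, hv⟩ := exists_critical_of_containsConfig hG h.1 h'.1 he hS hS'
  rw [h'.card_inter hG] at hv
  exact lt_irrefl _ hv

end Cells

/-- For smallest sets a configuration on `C` depends only on the cell of `C`, so the witnesses of
negativity can be spliced. -/
theorem exists_avoidsConfigs (hG : IsCactus G) (κ : Kind) : ∃ S, AvoidsConfigs G κ S := by
  classical
  obtain ⟨S₀, hS₀⟩ := exists_isSmallestBBR hG
  have hF : ∀ i : V ⊕ Cycle G, ∃ S, IsSmallestBBR G S ∧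
      ∀ C, i = .inr C → C.IsNegative κ → ¬ C.ContainsConfig κ S := by
    rintro (v | C)
    · exact ⟨S₀, hS₀, by simp⟩
    · by_cases hC : C.IsNegative κ
      · obtain ⟨S, hS, hSC⟩ := hC
        refine ⟨S, hS, fun D hD _ => ?_⟩
        obtain rfl := Sum.inr_injective hD
        exact hSC
      · refine ⟨S₀, hS₀, fun D hD hD' => ?_⟩
        obtain rfl := Sum.inr_injective hD
        exact absurd hD' hC
  choose F hF hFC using hF
  obtain ⟨S, hS, hSF⟩ := IsSmallestBBR.splice hG hF
  exact ⟨S, hS, fun C hC hconf => hFC (.inr C) C rfl hC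
    (hS.containsConfig_congr hG (hF _) (hSF _) hconf)⟩

theorem exists_isNice (hG : IsCactus G) (κ : Kind) : ∃ S, IsNice G κ S := by
  obtain ⟨S, hS, hmin⟩ := Set.exists_min_image {S | AvoidsConfigs G κ S}
    (fun S => (criticalGraph G κ S).edgeSet.ncard) (Set.toFinite _) (exists_avoidsConfigs hG κ)
  exact ⟨S, hS, hmin⟩

/-- A critical incidence with respect to a nice set cannot be avoided by any smallest set without
configurations on the cycle. -/
theorem IsNice.isCritical_of_isCritical (hG : IsCactus G) (hS : IsNice G κ S)
    {T : Finset V} (hT : IsSmallestBBR G T) (hTC : ¬ C.ContainsConfig κ T) {D : Cycle G}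
    (hCD : C ≠ D) {v : V} (hC : C.IsCritical κ S v) (hD : D.IsCritical κ S v) :
    C.IsCritical κ T v := by
  classical
  by_contra hcrit
  -- If `T` avoided the incidence, exchanging the cell of `C` for that of `T` would lower the number
  -- of critical incidences.
  obtain ⟨S₁, hS₁, hcell⟩ := IsSmallestBBR.splice hG
    (F := fun i => if i = .inr C then T else S)
    (fun i => by split_ifs; exacts [hT, hS.1.1])
  have hcellC : S₁ ∩ cell G (.inr C) = T ∩ cell G (.inr C) := by simpa using hcell (.inr C)
  have hcellE : ∀ E, E ≠ C → S₁ ∩ cell G (.inr E) = S ∩ cell G (.inr E) := fun E hE => by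
    simpa [hE] using hcell (.inr E)
  have havoid : AvoidsConfigs G κ S₁ := by
    refine ⟨hS₁, fun E hE hconf => ?_⟩
    by_cases hEC : E = C
    · subst hEC
      exact hTC (hS₁.containsConfig_congr hG hT hcellC hconf)
    · exact hS.1.2 E hE (hS₁.containsConfig_congr hG hS.1.1 (hcellE E hEC) hconf)
  -- A new incidence at `w ≠ v` would make both `v` and `w` branch-active. Then the cell of `C` has
  -- rank zero and all smallest sets have the same critical vertices on `C`.
  have hno : ∀ E, ¬ (criticalGraph G κ S₁).Adj C E := by
    rintro E ⟨hCE, w, hw, hw'⟩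
    have hw := hw.congr (isActive_congr hG hS₁.1 hT.1 hcellC)
    have hwv : w ≠ v := by rintro rfl; exact hcrit hw
    have hb : 2 ≤ C.numBranchActive := by
      have hsub : ({w, v} : Set V) ⊆ {v | C.IsBranchActive v} := by
        rintro u (rfl | rfl)
        · exact hG.isBranchActive_of_mem hCE hw.mem_verts hw'.mem_verts
        · exact hG.isBranchActive_of_mem hCD hC.mem_verts hD.mem_verts
      rw [← Set.ncard_pair hwv]
      exact Set.ncard_le_ncard hsub (Set.toFinite _)
    have hempty : ∀ S, IsSmallestBBR G S → S ∩ cell G (.inr C) = ∅ := fun S hS => by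
      rw [← Finset.card_eq_zero, hS.card_inter hG]
      simp only [cellRank]
      omega
    exact hcrit (hC.congr (isActive_congr hG hS.1.1.1 hT.1
      ((hempty S hS.1.1).trans (hempty T hT).symm)))
  have hlt : (criticalGraph G κ S₁).edgeSet ⊂ (criticalGraph G κ S).edgeSet := by
    rw [edgeSet_ssubset_edgeSet]
    refine lt_of_le_of_ne ?_ ?_
    · intro E F hEF
      obtain ⟨hne, w, hE, hF⟩ := id hEF
      have hEC : E ≠ C := by rintro rfl; exact hno _ hEF
      have hFC : F ≠ C := by rintro rfl; exact hno _ hEF.symm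
      exact ⟨hne, w, hE.congr (isActive_congr hG hS₁.1 hS.1.1.1 (hcellE E hEC)),
        hF.congr (isActive_congr hG hS₁.1 hS.1.1.1 (hcellE F hFC))⟩
    · intro e
      have : (criticalGraph G κ S).Adj C D := ⟨hCD, v, hC, hD⟩
      rw [← e] at this
      exact hno D this
  have := hS.2 S₁ havoid
  have := Set.ncard_lt_ncard hlt (Set.toFinite _)
  omega

/-- A smallest set `T ⊆ S` is compared with `S`. Let `Y` be the cycles and `W` the vertices with a
surplus in their cells, and `Z` the cycles outside `Y` on which `T` has a configuration. Then `Y ∪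
Z` contains all positive cycles, its negative cycles form a vertex cover, and it costs at least one
surplus element per cycle. -/
theorem IsNice.exists_isVertexCover (hG : IsCactus G) {S₀ : Finset V} (h₀ : IsNice G κ S₀)
    (hS : IsGood G κ S) : ∃ X : Set (Cycle G), (incidentGraph G κ S₀).IsVertexCover X ∧
      surplusThreads G + missingBranchActive G + numPositive G κ + X.ncard ≤ S.card := by
  classical
  obtain ⟨T, hTS, hT⟩ := exists_isSmallestBBR_subset hG hS.1
  let Y : Finset (Cycle G) := {C | cellRank G (.inr C) < (S ∩ cell G (.inr C)).card}
  let Z : Finset (Cycle G) := {C | C ∉ Y ∧ C.ContainsConfig κ T}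
  let W : Finset V := {v | cellRank G (.inl v) < (S ∩ cell G (.inl v)).card}
  have hcell : ∀ C, C ∉ Y → T ∩ cell G (.inr C) = S ∩ cell G (.inr C) := by
    intro C hC
    refine Finset.eq_of_subset_of_card_le (Finset.inter_subset_inter_right hTS) ?_
    rw [hT.card_inter hG]
    simpa [Y] using hC
  have hZ : ∀ C ∈ Z, ∃ v, C.IsCritical κ S v ∧ v ∈ W := by
    intro C hC
    obtain ⟨hCY, hCT⟩ := (Finset.mem_filter.1 hC).2
    obtain ⟨v, hv, hv'⟩ := exists_critical_of_containsConfig hG hT.1 hS.1 (hcell C hCY) hCT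
      (hS.2.1 C)
    exact ⟨v, hv, by simpa [W] using hv'⟩
  -- Two cycles of `Z` cannot share their vertex in `W`, since it is critical for `S` on each and
  -- `S` has no critical incidence.
  have hZW : Z.card ≤ W.card := by
    obtain ⟨v₀⟩ := hG.1.nonempty
    have : Nonempty V := ⟨v₀⟩
    choose! f hf hfW using hZ
    refine Finset.card_le_card_of_injOn f hfW fun C hC D hD hCD => ?_
    by_contra hne
    exact hS.2.2 C D ⟨hne, f C, hf C hC, hCD ▸ hf D hD⟩
  have hcount : ∑ i, cellRank G i + Y.card + W.card ≤ S.card := by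
    refine le_trans ?_ (sum_card_inter_cell_le hG S)
    have hsat := (isBBR_iff hG).1 hS.1
    have hWc : W.card = ∑ v, if cellRank G (.inl v) < (S ∩ cell G (.inl v)).card then 1 else 0 :=
      Finset.card_filter _ _
    have hYc : Y.card =
        ∑ C, if cellRank G (.inr C) < (S ∩ cell G (.inr C)).card then 1 else 0 :=
      Finset.card_filter _ _
    rw [hWc, hYc, Fintype.sum_sum_type, Fintype.sum_sum_type]
    have h1 : ∑ v, cellRank G (.inl v) +
        (∑ v, if cellRank G (.inl v) < (S ∩ cell G (.inl v)).card then 1 else 0)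
        ≤ ∑ v, (S ∩ cell G (.inl v)).card := by
      rw [← Finset.sum_add_distrib]
      refine Finset.sum_le_sum fun v _ => ?_
      have := (hsat (.inl v)).le_card hG
      split_ifs <;> omega
    have h2 : ∑ C, cellRank G (.inr C) +
        (∑ C, if cellRank G (.inr C) < (S ∩ cell G (.inr C)).card then 1 else 0)
        ≤ ∑ C, (S ∩ cell G (.inr C)).card := by
      rw [← Finset.sum_add_distrib]
      refine Finset.sum_le_sum fun C _ => ?_
      have := (hsat (.inr C)).le_card hG
      split_ifs <;> omega
    omega
  have hYZ : (Y ∪ Z).card = Y.card + Z.card :=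
    Finset.card_union_of_disjoint (Finset.disjoint_left.2 fun C hC hC' =>
      (Finset.mem_filter.1 hC').2.1 hC)
  have hpos : {C : Cycle G | ¬ C.IsNegative κ} ⊆ ((Y ∪ Z : Finset _) : Set (Cycle G)) := by
    intro C hC
    by_cases hCY : C ∈ Y
    · simp [hCY]
    · have : C ∈ Z := by
        refine Finset.mem_filter.2 ⟨Finset.mem_univ _, hCY, ?_⟩
        by_contra hCT
        exact hC ⟨T, hT, hCT⟩
      simp [this]
  refine ⟨((Y ∪ Z : Finset _) : Set (Cycle G)) \ {C | ¬ C.IsNegative κ}, ?_, ?_⟩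
  -- On an uncovered edge `T` has no configuration on either cycle, so niceness keeps `v` critical
  -- for `T` on both. Outside `Y` the cells of `T` and `S` agree, and the incidence would persist in
  -- `S`.
  · rintro C D ⟨hC, hD, hne, v, hCv, hDv⟩
    by_contra! hcon
    have hout : ∀ C : Cycle G, C.IsNegative κ →
        C ∉ ((Y ∪ Z : Finset _) : Set (Cycle G)) \ {C | ¬ C.IsNegative κ} →
        C ∉ Y ∧ ¬ C.ContainsConfig κ T := by
      intro C hC hout
      have hCY : C ∉ Y := fun h => hout ⟨by simp [h], fun h => h hC⟩
      refine ⟨hCY, fun h => hout ⟨?_, fun h => h hC⟩⟩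
      have : C ∈ Z := Finset.mem_filter.2 ⟨Finset.mem_univ _, hCY, h⟩
      simp [this]
    obtain ⟨hCY, hCT⟩ := hout C hC hcon.1
    obtain ⟨hDY, hDT⟩ := hout D hD hcon.2
    have h1 := h₀.isCritical_of_isCritical hG hT hCT hne hCv hDv
    have h2 := h₀.isCritical_of_isCritical hG hT hDT hne.symm hDv hCv
    exact hS.2.2 C D ⟨hne, v, h1.congr (isActive_congr hG hT.1 hS.1 (hcell C hCY)),
      h2.congr (isActive_congr hG hT.1 hS.1 (hcell D hDY))⟩
  · have := Set.ncard_sdiff_add_ncard_of_subset hpos (Set.toFinite _)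
    rw [Set.ncard_coe_finset] at this
    rw [← sum_cellRank]
    unfold numPositive
    omega

/-- One vertex is added on each positive cycle and each cycle of `X` to create a geodesic triple.
The other cycles are negative and keep their active vertices, and a critical incidence between two
of them would be an uncovered edge. -/
theorem AvoidsConfigs.exists_isGood (hG : IsCactus G) {S₀ : Finset V} (h₀ : AvoidsConfigs G κ S₀)
    {X : Set (Cycle G)} (hX : (incidentGraph G κ S₀).IsVertexCover X) : ∃ S, IsGood G κ S ∧
      S.card ≤ surplusThreads G + missingBranchActive G + numPositive G κ + X.ncard := by
  classical
  let Z : Finset (Cycle G) := {C | C ∈ X ∨ ¬ C.IsNegative κ}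
  choose w hw hwt using fun C : Cycle G => exists_hasGeodesicTriple (h₀.1.1.1 C)
  let S := S₀ ∪ Z.image w
  have hsub : S₀ ⊆ S := Finset.subset_union_left
  have htriple : ∀ C ∈ Z, HasGeodesicTriple C S := fun C hC =>
    (hwt C).mono (Finset.insert_subset
      (Finset.mem_union_right _ (Finset.mem_image_of_mem w hC)) hsub)
  have hact : ∀ C ∉ Z, ∀ v, C.IsActive S v ↔ C.IsActive S₀ v := by
    refine fun C hC v => ⟨fun hv => ?_, fun hv => hv.mono hsub⟩
    obtain ⟨s, hs, rfl⟩ := hG.isActive_iff.1 hv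
    rcases Finset.mem_union.1 hs with hs | hs
    · exact hG.isActive_iff.2 ⟨s, hs, rfl⟩
    · obtain ⟨D, hD, rfl⟩ := Finset.mem_image.1 hs
      -- The new vertex lies on another cycle, and the direction of that cycle is already active on
      -- `C` by biactivity of `S₀`.
      exact hG.isActive_root (C := C) (D := D) (fun e => hC (e ▸ hD)) (h₀.1.1.1 D) (hw D)
  refine ⟨S, ⟨?_, fun C hconf => ?_, ?_⟩, ?_⟩
  · exact (isBBR_iff hG).2 fun i => ((isBBR_iff hG).1 h₀.1.1 i).mono hsub
  · by_cases hC : C ∈ Z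
    · exact (htriple C hC).not_containsConfig hG hconf
    · have hneg : C.IsNegative κ := by
        by_contra h
        exact hC (Finset.mem_filter.2 ⟨Finset.mem_univ _, Or.inr h⟩)
      exact h₀.2 C hneg (hconf.transfer hG (hact C hC) (fun v _ _ l hl => hl.anti hsub)
        fun v l _ hl => ⟨l, hl.anti hsub⟩)
  · rintro C D ⟨hne, v, hC, hD⟩
    have hCZ : C ∉ Z := fun h => (htriple C h).not_isCritical hG v hC
    have hDZ : D ∉ Z := fun h => (htriple D h).not_isCritical hG v hD
    simp only [Z, Finset.mem_filter, Finset.mem_univ, true_and, not_or, not_not] at hCZ hDZ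
    have := hX (v := C) (w := D) ⟨hCZ.2, hDZ.2, hne, v,
      hC.congr (hact C (by simpa [Z] using hCZ)), hD.congr (hact D (by simpa [Z] using hDZ))⟩
    exact this.elim hCZ.1 hDZ.1
  · have hZ : Z.card ≤ X.ncard + numPositive G κ := by
      have : (Z : Set (Cycle G)) = X ∪ {C | ¬ C.IsNegative κ} := by ext C; simp [Z]
      rw [← Set.ncard_coe_finset, this]
      exact Set.ncard_union_le _ _
    have h1 : S.card ≤ S₀.card + (Z.image w).card := Finset.card_union_le _ _
    have h2 := Finset.card_image_le (s := Z) (f := w)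
    have h3 := h₀.1.card_eq hG
    omega

theorem sInf_card_isGenerator (hG : IsCactus G) (hgen : ∀ S, IsGenerator G κ S ↔ IsGood G κ S)
    {S₀ : Finset V} (h₀ : IsNice G κ S₀) :
    ((sInf {n | ∃ S : Finset V, IsGenerator G κ S ∧ S.card = n} : ℕ) : ℕ∞) =
      surplusThreads G + missingBranchActive G + numPositive G κ
        + (incidentGraph G κ S₀).vertexCoverNum := by
  obtain ⟨X, hXc, hX⟩ := vertexCoverNum_exists (incidentGraph G κ S₀)
  obtain ⟨S, hS, hSc⟩ := h₀.1.exists_isGood hG hX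
  rw [← (Set.toFinite X).cast_ncard_eq] at hXc
  apply le_antisymm
  · have h1 : sInf {n | ∃ S : Finset V, IsGenerator G κ S ∧ S.card = n} ≤ S.card :=
      Nat.sInf_le ⟨S, (hgen S).2 hS, rfl⟩
    rw [← hXc]
    exact_mod_cast h1.trans hSc
  · obtain ⟨T, hT, hTc⟩ := Nat.sInf_mem
      (s := {n | ∃ S : Finset V, IsGenerator G κ S ∧ S.card = n}) ⟨_, S, (hgen S).2 hS, rfl⟩
    obtain ⟨X', hX', hX'c⟩ := h₀.exists_isVertexCover hG ((hgen T).1 hT)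
    have h1 := hX'.vertexCoverNum_le
    rw [← (Set.toFinite X').cast_ncard_eq] at h1
    refine (add_le_add_right h1 _).trans ?_
    rw [← hTc]
    exact_mod_cast hX'c

end Cactus

/-! ### The dimension formulas. -/

theorem theorem4 {V : Type*} [Fintype V] (G : SimpleGraph V) [DecidableRel G.Adj]
    (hG : Cactus.IsCactus G) :
    (∃ S, Cactus.IsNice G .vertex S) ∧
    (∃ S, Cactus.IsNice G .edge S) ∧
    ((∀ n, 2 ≤ n → IsEmpty (G ≃g SimpleGraph.pathGraph n)) →
      ∀ S, Cactus.IsNice G .vertex S →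
        (Cactus.dim G : ℕ∞) =
          Cactus.surplusThreads G + Cactus.missingBranchActive G + Cactus.numPositive G .vertex
            + (Cactus.incidentGraph G .vertex S).vertexCoverNum) ∧
    ((∀ n, 3 ≤ n → IsEmpty (G ≃g SimpleGraph.pathGraph n)) →
      ∀ S, Cactus.IsNice G .edge S →
        (Cactus.edim G : ℕ∞) =
          Cactus.surplusThreads G + Cactus.missingBranchActive G + Cactus.numPositive G .edge
            + (Cactus.incidentGraph G .edge S).vertexCoverNum) := by
  refine ⟨Cactus.exists_isNice hG _, Cactus.exists_isNice hG _, fun hpath S hS => ?_,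
    fun hpath S hS => ?_⟩
  · exact Cactus.sInf_card_isGenerator hG
      (fun T => ⟨fun h => h.isGood hG, fun h => h.isVertexGenerator hG hpath⟩) hS
  · exact Cactus.sInf_card_isGenerator hG
      (fun T => ⟨fun h => h.isGood hG, fun h => h.isEdgeGenerator hG hpath⟩) hS
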